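/- Let $\gamma\in(0,1)$, $b=d>0$, $a\le 0$, $c<0$. For $\epsilon,\mu,\mu_2>0$ consider on $\mathbb R^2$ the Boussinesq--Full dispersion system, denoted $(\mathrm{BFD})_{\epsilon,\mu,\mu_2}$, for real-valued $\zeta$ and $\mathbb R^2$-valued $\mathbf v$: $$(1-b\mu\Delta)\partial_t\zeta+\tfrac1\gamma\nabla\cdot\big((1-\epsilon\zeta)\mathbf v\big)-\tfrac{\sqrt\mu}{\gamma^2}|D|\coth(\sqrt{\mu_2}|D|)\nabla\cdot\mathbf v+\tfrac{\mu}{\gamma}\Big(a-\tfrac1{\gamma^2}\coth^2(\sqrt{\mu_2}|D|)\Big)\Delta\nabla\cdot\mathbf v=0,$$ $$(1-d\mu\Delta)\partial_t\mathbf v+(1-\gamma)\nabla\zeta-\tfrac{\epsilon}{2\gamma}\nabla(|\mathbf v|^2)+c\mu(1-\gamma)\Delta\nabla\zeta=0,$$ with initial data $(\zeta,\mathbf v)|_{t=0}=(\zeta_0,\mathbf v_0)$. Let $X_\mu=H^1(\mathbb R^2)$ with norm $\|u\|_{X_\mu}^2=\|u\|_{L^2}^2+\mu\|\nabla u\|_{L^2}^2$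 (for vector fields, the square root of the sum of the squares of the norms of the components), and put $N_\mu(\zeta,\mathbf v)=\|\zeta\|_{X_\mu}+\|\mathbf v\|_{X_\mu}$. A global solution is a pair $(\zeta,\mathbf v)\in C([0,\infty);X_\mu\times X_\mu)$ that satisfies the system in the sense of tempered distributions in $x$ at every $t\ge0$, and has the given data. We say that the Cauchy problem is *globally well-posed with constant $C$* for the data $(\zeta_0,\mathbf v_0)$ if it has exactly one global solution and this solution satisfies $N_\mu(\zeta(t),\mathbf v(t))\le C\,N_\mu(\zeta_0,\mathbf v_0)$ for all $t\ge0$. 1. (Change of variables.) Let $\epsilon,\mu,\mu_2>0$ and $$\zeta(t,X)=\epsilon^{-1}\tilde\zeta(t/\sqrt\mu,X/\sqrt\mu),\qquad \mathbf v(t,X)=\epsilon^{-1}\tilde{\mathbf v}(t/\sqrt\mu,X/\sqrt\mu).$$ Then $(\zeta,\mathbf v)$ is a global solution of $(\mathrm{BFD})_{\epsilon,\mu,\mu_2}$ with data $\epsilon^{-1}(\tilde\zeta_0,\tilde{\mathbf v}_0)(\cdot/\sqrt\mu)$ if and only if $(\tilde\zeta,\tilde{\mathbf v})$ is a global solution of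 $(\mathrm{BFD})_{1,1,\mu_2/\mu}$ with data $(\tilde\zeta_0,\tilde{\mathbf v}_0)$. Moreover $\|\epsilon^{-1}u(\cdot/\sqrt\mu)\|_{X_\mu}=\frac{\sqrt\mu}{\epsilon}\|u\|_{X_1}$ for every scalar function or vector field $u$ (both sides being $+\infty$ when $u\notin H^1$). 2. (Global existence for small $\epsilon\sim\mu$.) For every $\kappa\ge1$ there is $C>0$ such that for every $M>0$ there is $\epsilon_0>0$ such that for all $0<\epsilon\le\epsilon_0$, $\kappa^{-1}\epsilon\le\mu\le\kappa\epsilon$, $\kappa^{-1}\le\mu_2\le\kappa$ and all data with $N_\mu(\zeta_0,\mathbf v_0)\le M$, the Cauchy problem for $(\mathrm{BFD})_{\epsilon,\mu,\mu_2}$ is globally well-posed with constant $C$. 3. (Small solutions, $\epsilon=\mu=1$.) For every $m>0$ there are $C,\eta>0$ such that for all $\mu_2\ge m$ and all data with $N_1(\zeta_0,\mathbf v_0)\le\eta$, the Cauchy problem for $(\mathrm{BFD})_{1,1,\mu_2}$ is globally well-posed with constant $C$. 4. (Small solutions, $\epsilon\sim\mu\sim1$.) For every $\kappa\ge1$ there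 are $C,\eta>0$ such that for all $\epsilon,\mu,\mu_2\in[\kappa^{-1},\kappa]$ and all data with $N_\mu(\zeta_0,\mathbf v_0)\le\eta$, the Cauchy problem for $(\mathrm{BFD})_{\epsilon,\mu,\mu_2}$ is globally well-posed with constant $C$. The constants $C,\epsilon_0,\eta$ may also depend on $\gamma,a,b,c,d$. -/

import Mathlib

open MeasureTheory Set Filter Topology
open scoped FourierTransform SchwartzMap LineDeriv Laplacian ENNReal

noncomputable section

/-- The plane `ℝ²` with its Euclidean norm. -/
abbrev Plane : Type := EuclideanSpace ℝ (Fin 2)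

/-- The `j`-th vector of the canonical basis of the plane. -/
def basisVec (j : Fin 2) : Plane := EuclideanSpace.single j 1

/-! ### The Sobolev space `X⁰_μ(ℝ²)` -/

open Classical in
/-- The norm of `X⁰_μ(ℝ²)`, that is of `H¹(ℝ²)` with
`‖u‖² = ‖u‖²_{L²} + μ ‖∇u‖²_{L²} = ∫ (1 + μ |2πξ|²) |û(ξ)|² dξ`,
where `û(ξ) = ∫ e^{-2πi x·ξ} u(x) dx` is the (unitary) Fourier transform on `L²`.
It takes values in `[0, ∞]`; `u` belongs to `X⁰_μ(ℝ²)` exactly when it is finite.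
It is `∞` for `u ∉ L²`. -/
def xNorm (μ : ℝ) (u : Plane → ℝ) : ℝ≥0∞ :=
  if h : MemLp (fun x => (u x : ℂ)) 2 volume then
    (∫⁻ ξ, ENNReal.ofReal (1 + μ * (2 * Real.pi * ‖ξ‖) ^ 2) *
      ‖(𝓕 (h.toLp (fun x => (u x : ℂ))) : Lp ℂ 2 (volume : Measure Plane)) ξ‖ₑ ^ 2) ^ (1 / 2 : ℝ)
  else ⊤

/-- The norm of a vector field whose components lie in `X⁰_μ(ℝ²)`. -/
def xNormVec (μ : ℝ) (v : Plane → Plane) : ℝ≥0∞ :=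
  (∑ j : Fin 2, xNorm μ (fun x => v x j) ^ 2) ^ (1 / 2 : ℝ)

/-- `(ζ, v) ∈ C([0,∞); X⁰_μ(ℝ²) × X⁰_μ(ℝ²))`. -/
def ContinuousInX (μ : ℝ) (ζ : ℝ → Plane → ℝ) (v : ℝ → Plane → Plane) : Prop :=
  (∀ t, 0 ≤ t → xNorm μ (ζ t) < ⊤ ∧ xNormVec μ (v t) < ⊤) ∧
  ∀ t, 0 ≤ t →
    Tendsto (fun s => xNorm μ (ζ s - ζ t) + xNormVec μ (v s - v t)) (𝓝[Ici 0] t) (𝓝 0)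

/-! ### The Boussinesq–Full dispersion system -/

/-- The Fourier multiplier `m(D)`, with `D = -i∇`. The Fourier variable `ξ` of Mathlib's transform
corresponds to the frequency `2πξ`. -/
def multiplier (m : Plane → ℝ) (f : Plane → ℂ) : Plane → ℂ :=
  𝓕⁻ (fun ξ : Plane => (m ((2 * Real.pi) • ξ) : ℂ) * 𝓕 f ξ)

/-- The function `r ↦ r coth(√μ₂ r)`, `r ≥ 0`, extended by continuity at `0`. -/
def rCoth (μ₂ r : ℝ) : ℝ :=
  if r = 0 then 1 / √μ₂ else r * (Real.cosh (√μ₂ * r) / Real.sinh (√μ₂ * r))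

/-- The symbol of the operator
`-(√μ/γ²) |D| coth(√μ₂|D|) + (μ/γ) (a - (1/γ²) coth²(√μ₂|D|)) Δ`. -/
def dispSymbol (γ a μ μ₂ : ℝ) (ξ : Plane) : ℝ :=
  -(√μ / γ ^ 2) * rCoth μ₂ ‖ξ‖ + μ / γ * (-a * ‖ξ‖ ^ 2 + 1 / γ ^ 2 * rCoth μ₂ ‖ξ‖ ^ 2)

/-- `(ζ, v) ∈ C([0,∞); X⁰_μ × X⁰_μ)` is a global solution, with initial data `(ζ₀, v₀)`, of
```
(1 - bμΔ)∂ₜζ + (1/γ) ∇·((1 - εζ)v) - (√μ/γ²) |D| coth(√μ₂|D|) ∇·v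
    + (μ/γ) (a - (1/γ²) coth²(√μ₂|D|)) Δ∇·v = 0,
(1 - dμΔ)∂ₜv + (1-γ)∇ζ - (ε/(2γ)) ∇|v|² + cμ(1-γ) Δ∇ζ = 0.
```
The equations hold in the sense of tempered distributions on `ℝ²` at every time `t ≥ 0`
(all operators in `x` are moved to a Schwartz test function `φ`; the multiplier is even and real,
hence symmetric). -/
structure IsGlobalSolution (γ a b c d ε μ μ₂ : ℝ) (ζ₀ : Plane → ℝ) (v₀ : Plane → Plane)
    (ζ : ℝ → Plane → ℝ) (v : ℝ → Plane → Plane) : Prop where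
  continuous : ContinuousInX μ ζ v
  initial_zeta : ζ 0 =ᵐ[volume] ζ₀
  initial_v : v 0 =ᵐ[volume] v₀
  eq_zeta : ∀ φ : 𝓢(Plane, ℂ), ∀ t, 0 ≤ t →
    HasDerivWithinAt
      (fun s => ∫ x, (ζ s x : ℂ) * (φ x - ((b * μ : ℝ) : ℂ) * (Δ φ) x))
      (∑ j : Fin 2,
        ((1 / γ : ℝ) * (∫ x, (((1 - ε * ζ t x) * v t x j : ℝ) : ℂ) * (∂_{basisVec j} φ) x) +
          ∫ x, (v t x j : ℂ) * multiplier (dispSymbol γ a μ μ₂) (∂_{basisVec j} φ : 𝓢(Plane, ℂ)) x))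
      (Ici 0) t
  eq_v : ∀ j : Fin 2, ∀ φ : 𝓢(Plane, ℂ), ∀ t, 0 ≤ t →
    HasDerivWithinAt
      (fun s => ∫ x, (v s x j : ℂ) * (φ x - ((d * μ : ℝ) : ℂ) * (Δ φ) x))
      ((1 - γ : ℝ) * (∫ x, (ζ t x : ℂ) *
          ((∂_{basisVec j} φ) x + ((c * μ : ℝ) : ℂ) * (Δ (∂_{basisVec j} φ)) x)) -
        (ε / (2 * γ) : ℝ) * ∫ x, ((‖v t x‖ ^ 2 : ℝ) : ℂ) * (∂_{basisVec j} φ) x)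
      (Ici 0) t

/-- The Cauchy problem with data `(ζ₀, v₀)` has a solution in `C([0,∞); X⁰_μ × X⁰_μ)`, which is
bounded by `C` times the size of the data at all times, and which is the only solution in
`C([0,∞); X⁰_μ × X⁰_μ)`. -/
def HasUniqueBoundedGlobalSolution (C γ a b c d ε μ μ₂ : ℝ)
    (ζ₀ : Plane → ℝ) (v₀ : Plane → Plane) : Prop :=
  ∃ (ζ : ℝ → Plane → ℝ) (v : ℝ → Plane → Plane),
    IsGlobalSolution γ a b c d ε μ μ₂ ζ₀ v₀ ζ v ∧
    (∀ t, 0 ≤ t →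
      xNorm μ (ζ t) + xNormVec μ (v t) ≤ ENNReal.ofReal C * (xNorm μ ζ₀ + xNormVec μ v₀)) ∧
    ∀ (ζ' : ℝ → Plane → ℝ) (v' : ℝ → Plane → Plane),
      IsGlobalSolution γ a b c d ε μ μ₂ ζ₀ v₀ ζ' v' →
        ∀ t, 0 ≤ t → ζ' t =ᵐ[volume] ζ t ∧ v' t =ᵐ[volume] v t

/-! ### The change of variables -/

/-- `X ↦ ε⁻¹ u(X/√μ)`. -/
def rescaleSpace {F : Type*} [SMul ℝ F] (ε μ : ℝ) (u : Plane → F) : Plane → F :=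
  fun X => ε⁻¹ • u ((√μ)⁻¹ • X)

/-- `(t, X) ↦ ε⁻¹ w(t/√μ, X/√μ)`. -/
def rescale {F : Type*} [SMul ℝ F] (ε μ : ℝ) (w : ℝ → Plane → F) : ℝ → Plane → F :=
  fun t X => ε⁻¹ • w ((√μ)⁻¹ * t) ((√μ)⁻¹ • X)

end

/-! Everything reduces to ε = μ = 1. The change of variables turns data of size M for (ε, μ, μ₂)
into data of size Mε/√μ for (1, 1, μ₂/μ). This size is of order √ε M when μ ∼ ε, hence small for
small ε whatever M is, with a bound C that does not see M. Parts 2 and 4 thus follow from part 3,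
whose constants are uniform as long as μ₂/μ is bounded below.

For ε = μ = 1 the equality b = d makes the system Hamiltonian: with J = 1 - bΔ it reads ∂ₜ(ζ, v) =
-J⁻¹(∇·δH/δv, ∇δH/δζ), where H = ½∫(ζ al(D)ζ + v·be(D)v) - (1/2γ)∫ζ|v|². The symbol al is comparable
with 1 + |ξ|² because c < 0. The symbol be is (1/γ)(1 - x + x² - a|ξ|²) with x = |ξ| coth(√μ₂|ξ|)/γ
≥ |ξ|; since 1 - x + x² ≥ (1 + x²)/2, it is comparable with 1 + |ξ|² too, uniformly for μ₂ ≥ m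
(`beSymbol_mem`). So the quadratic part of H is equivalent to the square of the H¹ norm, and the
cubic part is controlled by the two-dimensional estimate H¹ · H¹ ⊂ L²
(`eLpNorm_mul_besselFourier_le`). Conservation of H (`HamiltonianData.energy_eq`) then keeps small
solutions small by a continuity argument (`HamiltonianData.exists_global_solution`).

The state Z is √al, respectively √be, times the inverse Fourier transform of ζ, respectively v_j. In
these coordinates the quadratic energy is ‖Z‖²/2 on L², and the linear part A is multiplication by a
skew-adjoint matrix, so it generates a group of isometries S. Since J⁻¹∇ maps L² to H¹, the
nonlinearity N is a bounded quadratic map, and W(t) = S(-t)U(t) solves an ordinary differential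
equation with locally Lipschitz field. The domain of A never appears: with R the multiplication by ρ
= (1 + |ξ|²)^(-1/2), the operator K = A R is bounded, and the equation is written as (R U)' = K U +
R N(U).

Uniqueness holds among all distributional solutions in C([0,∞); H¹). Test functions separate states,
so such a solution satisfies the equation for R U; injectivity of R turns it into a mild solution,
and Grönwall applies. Complex states are allowed throughout; the solution represents real functions
because the equation commutes with Z ↦ conj Z(-·), and uniqueness makes U invariant when its data
are. -/

/-! ### Semilinear Hamiltonian equations in a Hilbert space -/

section Abstract

open scoped NNReal RealInnerProductSpace

variable {E : Type*} [NormedAddCommGroup E] [InnerProductSpace ℝ E]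

/-- The data of the equation `U' = A U + A R G(U, U)` in a Hilbert space, where `A` generates the
group of isometries `S`, `K = A R` is bounded, and `x ↦ R G(x, x)` is the gradient of the cubic
functional `x ↦ ⟪R x, G x x⟫ / 3`. -/
structure HamiltonianData (E : Type*) [NormedAddCommGroup E] [InnerProductSpace ℝ E] where
  S : ℝ → E →L[ℝ] E
  R : E →L[ℝ] E
  K : E →L[ℝ] E
  G : E →L[ℝ] E →L[ℝ] E
  S_zero : ∀ x, S 0 x = x
  S_add : ∀ s t x, S (s + t) x = S s (S t x)
  norm_S : ∀ t x, ‖S t x‖ = ‖x‖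
  continuous_S : ∀ x, Continuous fun t => S t x
  hasDerivAt_S : ∀ x, HasDerivAt (fun t => S t (R x)) (K x) 0
  S_R : ∀ t x, S t (R x) = R (S t x)
  S_K : ∀ t x, S t (K x) = K (S t x)
  R_K : ∀ x, R (K x) = K (R x)
  R_injective : Function.Injective R
  R_symm : ∀ x y, ⟪R x, y⟫ = ⟪x, R y⟫
  K_skew : ∀ x y, ⟪K x, y⟫ = -⟪x, K y⟫
  G_comm : ∀ x y, G x y = G y x
  R_G_symm : ∀ x y z, ⟪R x, G y z⟫ = ⟪R y, G x z⟫

lemma exists_primitive [CompleteSpace E] {f : ℝ → E} (hf : ContinuousOn f (Ici 0)) :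
    ∃ F : ℝ → E, F 0 = 0 ∧ ∀ t, 0 ≤ t → HasDerivWithinAt F (f t) (Ici 0) t := by
  have hc : Continuous fun x => f (max 0 x) :=
    hf.comp_continuous (by fun_prop) fun x => mem_Ici.2 (le_max_left _ _)
  refine ⟨fun u => ∫ x in (0 : ℝ)..u, f (max 0 x), by simp, fun t ht => ?_⟩
  have := (hc.integral_hasStrictDerivAt 0 t).hasDerivAt.hasDerivWithinAt (s := Ici 0)
  simpa [max_eq_right ht] using this

namespace HamiltonianData

variable (H : HamiltonianData E)

lemma S_S_neg (t : ℝ) (x : E) : H.S t (H.S (-t) x) = x := by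
  rw [← H.S_add, add_neg_cancel, H.S_zero]

lemma inner_S (t : ℝ) (x y : E) : ⟪H.S t x, H.S t y⟫ = ⟪x, y⟫ :=
  LinearIsometry.inner_map_map (⟨(H.S t).toLinearMap, H.norm_S t⟩ : E →ₗᵢ[ℝ] E) x y

lemma inner_S_neg (t : ℝ) (x y : E) : ⟪x, H.S (-t) y⟫ = ⟪H.S t x, y⟫ := by
  rw [← H.inner_S t x, H.S_S_neg]

lemma tendsto_S {X : Type*} {l : Filter X} {φ : X → ℝ} {w : X → E} {t : ℝ} {x : E}
    (hφ : Tendsto φ l (𝓝 t)) (hw : Tendsto w l (𝓝 x)) :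
    Tendsto (fun a => H.S (φ a) (w a)) l (𝓝 (H.S t x)) := by
  have h1 : Tendsto (fun a => H.S (φ a) x) l (𝓝 (H.S t x)) :=
    ((H.continuous_S x).tendsto t).comp hφ
  have h2 : Tendsto (fun a => H.S (φ a) (w a - x)) l (𝓝 0) := by
    rw [tendsto_zero_iff_norm_tendsto_zero]
    simp only [H.norm_S]
    rw [← tendsto_zero_iff_norm_tendsto_zero]
    simpa using hw.sub_const x
  simpa using h1.add h2

lemma hasDerivAt_S_R (t : ℝ) (x : E) :
    HasDerivAt (fun s => H.S s (H.R x)) (H.S t (H.K x)) t := by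
  have h := (H.S t).hasFDerivAt.comp_hasDerivAt (t - t)
    (f := fun s => H.S s (H.R x)) (by simpa using H.hasDerivAt_S x)
  have h2 := h.comp_sub_const t t
  refine h2.congr_of_eventuallyEq (Eventually.of_forall fun s => ?_)
  simp [← H.S_add]

lemma hasDerivAt_S_neg_R (t : ℝ) (x : E) :
    HasDerivAt (fun s => H.S (-s) (H.R x)) (-H.S (-t) (H.K x)) t := by
  simpa [Function.comp_def] using (H.hasDerivAt_S_R (-t) x).scomp t (hasDerivAt_neg t)

/-- A product rule for a group that is only strongly continuous. The increment of `w` is carried by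
isometries, so its remainder stays small, and strong continuity at the single vector `w'` suffices.
-/
lemma hasDerivWithinAt_S_apply {w : ℝ → E} {w' d : E} {s : Set ℝ} {t : ℝ} {φ : ℝ → ℝ}
    (hφ : Continuous φ) (hw : HasDerivWithinAt w w' s t)
    (hS : HasDerivWithinAt (fun τ => H.S (φ τ) (w t)) d s t) :
    HasDerivWithinAt (fun τ => H.S (φ τ) (w τ)) (d + H.S (φ t) w') s t := by
  have key : HasDerivWithinAt (fun τ => H.S (φ τ) (w τ - w t)) (H.S (φ t) w') s t := by
    rw [hasDerivWithinAt_iff_isLittleO] at hw ⊢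
    have e : (fun τ => H.S (φ τ) (w τ - w t) - H.S (φ t) (w t - w t) - (τ - t) • H.S (φ t) w')
        = fun τ => H.S (φ τ) (w τ - w t - (τ - t) • w')
          + (τ - t) • (H.S (φ τ) w' - H.S (φ t) w') := by
      ext τ; simp only [map_sub, map_smul, smul_sub, sub_self, map_zero]; abel
    rw [e]
    refine Asymptotics.IsLittleO.add ?_ ?_
    · refine Asymptotics.IsLittleO.of_norm_left ?_
      simp only [H.norm_S]
      exact hw.norm_left
    · have h3 : (fun τ => H.S (φ τ) w' - H.S (φ t) w') =o[𝓝[s] t] fun _ => (1 : ℝ) := by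
        rw [Asymptotics.isLittleO_one_iff]
        simpa using ((((H.continuous_S w').comp hφ).tendsto t).mono_left
          nhdsWithin_le_nhds).sub_const (H.S (φ t) w')
      simpa using (Asymptotics.isBigO_refl (fun τ : ℝ => τ - t) (𝓝[s] t)).smul_isLittleO h3
  have := hS.add key
  refine this.congr_of_eventuallyEq (Eventually.of_forall fun s => ?_) ?_
  · simp
  · simp

/-- The nonlinear term `K G(x, x)`. -/
noncomputable def N (x : E) : E := H.K (H.G x x)

/-- The Hamiltonian. -/
noncomputable def energy (x : E) : ℝ := ‖x‖ ^ 2 / 2 + ⟪H.R x, H.G x x⟫ / 3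

lemma hasDerivWithinAt_R_S {w : ℝ → E} {w' : E} {s : Set ℝ} {t : ℝ}
    (hw : HasDerivWithinAt w w' s t) :
    HasDerivWithinAt (fun τ => H.R (H.S τ (w τ))) (H.K (H.S t (w t)) + H.R (H.S t w')) s t := by
  have h := H.hasDerivWithinAt_S_apply continuous_id
    (H.R.hasFDerivAt.comp_hasDerivWithinAt t hw)
    (H.hasDerivAt_S_R t (w t)).hasDerivWithinAt
  simp only [H.S_R, H.S_K, Function.comp, id] at h
  exact h

end HamiltonianData

/-- `B` need only be continuous, because the factor multiplying it vanishes at the base point. This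
matters since the curve `U` is continuous while only `R U` is differentiable. -/
lemma hasDerivWithinAt_inner_sub {A B : ℝ → E} {A' : E} {s : Set ℝ} {t : ℝ}
    (hA : HasDerivWithinAt A A' s t) (hB : ContinuousWithinAt B s t) :
    HasDerivWithinAt (fun τ => ⟪A τ - A t, B τ⟫) ⟪A', B t⟫ s t := by
  have h1 : HasDerivWithinAt (fun τ => ⟪A τ - A t, B t⟫) ⟪A', B t⟫ s t := by
    simpa using (hA.sub_const (A t)).inner ℝ (hasDerivWithinAt_const t s (B t))
  have h2 : HasDerivWithinAt (fun τ => ⟪A τ - A t, B τ - B t⟫) 0 s t := by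
    rw [hasDerivWithinAt_iff_isLittleO]
    simp only [sub_self, inner_zero_left, smul_zero, sub_zero]
    have hO : (fun τ => A τ - A t) =O[𝓝[s] t] fun τ => τ - t := hA.hasFDerivWithinAt.isBigO_sub
    have ho : (fun τ => B τ - B t) =o[𝓝[s] t] fun _ => (1 : ℝ) := by
      rw [Asymptotics.isLittleO_one_iff]
      simpa using hB.tendsto.sub_const (B t)
    have := hO.norm_left.mul_isLittleO ho.norm_left
    simp only [mul_one] at this
    refine Asymptotics.IsBigO.trans_isLittleO (g := fun τ => ‖A τ - A t‖ * ‖B τ - B t‖) ?_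
      this
    refine Asymptotics.IsBigO.of_bound 1 (Eventually.of_forall fun τ => ?_)
    simpa using norm_inner_le_norm (𝕜 := ℝ) (A τ - A t) (B τ - B t)
  have := h1.add h2
  rw [add_zero] at this
  refine this.congr_of_eventuallyEq (Eventually.of_forall fun τ => ?_) ?_
  · simp [inner_sub_right]
  · simp [inner_sub_right]

namespace HamiltonianData

variable (H : HamiltonianData E)

/-- The full symmetry of the trilinear form ⟪R x, G y z⟫ moves the whole increment onto the slot of
`R`, the only slot where a differentiable quantity is available. -/
lemma cubic_sub (x y : E) : ⟪H.R y, H.G y y⟫ - ⟪H.R x, H.G x x⟫ =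
    ⟪H.R y - H.R x, H.G y y + H.G x y + H.G x x⟫ := by
  have h1 := H.R_G_symm x y y
  have h2 := H.R_G_symm x y x
  rw [H.G_comm y x] at h2
  simp only [inner_sub_left, inner_add_right]
  linarith

lemma hasDerivWithinAt_cubic {U : ℝ → E} {V : E} {s : Set ℝ} {t : ℝ}
    (hU : ContinuousWithinAt U s t) (hR : HasDerivWithinAt (fun τ => H.R (U τ)) V s t) :
    HasDerivWithinAt (fun τ => ⟪H.R (U τ), H.G (U τ) (U τ)⟫ / 3) ⟪V, H.G (U t) (U t)⟫ s t := by
  have hB : ContinuousWithinAt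
      (fun τ => H.G (U τ) (U τ) + H.G (U t) (U τ) + H.G (U t) (U t)) s t := by
    have h1 : ContinuousWithinAt (fun τ => H.G (U τ)) s t :=
      H.G.continuous.continuousAt.comp_continuousWithinAt hU
    have h2 : ContinuousWithinAt (fun τ => H.G (U t) (U τ)) s t :=
      (H.G (U t)).continuous.continuousAt.comp_continuousWithinAt hU
    exact ((h1.clm_apply hU).add h2).add continuousWithinAt_const
  have h := ((hasDerivWithinAt_inner_sub hR hB).add_const ⟪H.R (U t), H.G (U t) (U t)⟫).div_const 3
  have e : ⟪V, H.G (U t) (U t) + H.G (U t) (U t) + H.G (U t) (U t)⟫ / 3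
      = ⟪V, H.G (U t) (U t)⟫ := by
    simp only [inner_add_right]; ring
  rw [e] at h
  refine h.congr_of_eventuallyEq (Eventually.of_forall fun τ => ?_) ?_
  · simp [← H.cubic_sub]
  · simp

/-- Conservation of the Hamiltonian along mild solutions. -/
lemma energy_eq {W : ℝ → E} {T : ℝ} (hc : ContinuousOn W (Icc 0 T))
    (hW : ∀ t ∈ Ico 0 T, HasDerivWithinAt W (H.S (-t) (H.N (H.S t (W t)))) (Ici t) t)
    {t : ℝ} (ht : t ∈ Icc 0 T) : H.energy (H.S t (W t)) = H.energy (W 0) := by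
  have hU : ContinuousOn (fun τ => H.S τ (W τ)) (Icc 0 T) := fun τ hτ =>
    H.tendsto_S (tendsto_id.mono_left nhdsWithin_le_nhds) (hc τ hτ)
  have hG : ∀ {U : ℝ → E}, ContinuousOn U (Icc 0 T) →
      ContinuousOn (fun τ => H.energy (U τ)) (Icc 0 T) := by
    intro U hU
    have h1 : ContinuousOn (fun τ => H.G (U τ)) (Icc 0 T) := H.G.continuous.comp_continuousOn hU
    have h2 : ContinuousOn (fun τ => H.R (U τ)) (Icc 0 T) := H.R.continuous.comp_continuousOn hU
    exact ((hU.norm.pow 2).div_const 2).add ((h2.inner (h1.clm_apply hU)).div_const 3)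
  have := constant_of_has_deriv_right_zero (hG hU) (fun τ hτ => ?_) t ht
  · simpa [H.S_zero] using this
  have hWτ := hW τ hτ
  have hUτ : ContinuousWithinAt (fun τ => H.S τ (W τ)) (Ici τ) τ :=
    H.tendsto_S (tendsto_id.mono_left nhdsWithin_le_nhds) hWτ.continuousWithinAt
  set U := H.S τ (W τ) with hUdef
  -- `S τ (W τ)` need not be differentiable, but its norm is that of `W τ`, which is.
  have h1 : HasDerivWithinAt (fun τ => ‖H.S τ (W τ)‖ ^ 2 / 2) ⟪U, H.N U⟫ (Ici τ) τ := by
    have := (hWτ.norm_sq).div_const 2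
    simp only [H.norm_S]
    refine this.congr_deriv ?_
    rw [H.inner_S_neg]; ring
  have h2 := H.hasDerivWithinAt_cubic hUτ (H.hasDerivWithinAt_R_S hWτ)
  have h3 := h1.add h2
  refine h3.congr_deriv ?_
  simp only [H.S_S_neg, ← hUdef, N, inner_add_left]
  -- The terms ⟪U, K G⟫ and ⟪K U, G⟫ cancel by skewness of `K`. The remaining ⟪R K G, G⟫ equals its
  -- own negative, since `R` is symmetric and commutes with the skew `K`.
  have e1 := H.K_skew U (H.G U U)
  have e2 := H.K_skew (H.G U U) (H.R (H.G U U))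
  rw [← H.R_symm, ← H.R_K, real_inner_comm] at e2
  rw [e1, real_inner_comm (H.G U U) (H.R _)]
  linarith

/-! #### The truncated equation -/

/-- A Lipschitz retraction onto the ball of radius `ρ`. -/
noncomputable def ballRetract (ρ : ℝ) (x : E) : E := (max 1 (‖x‖ / ρ))⁻¹ • x

lemma norm_ballRetract_le {ρ : ℝ} (hρ : 0 < ρ) (x : E) : ‖ballRetract ρ x‖ ≤ ρ := by
  have h0 : 0 < max 1 (‖x‖ / ρ) := lt_of_lt_of_le one_pos (le_max_left _ _)
  rw [ballRetract, norm_smul, norm_inv, Real.norm_of_nonneg h0.le, inv_mul_le_iff₀ h0]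
  calc ‖x‖ = ‖x‖ / ρ * ρ := by field_simp
    _ ≤ _ := by gcongr; exact le_max_right _ _

lemma ballRetract_of_norm_le {ρ : ℝ} (hρ : 0 < ρ) {x : E} (hx : ‖x‖ ≤ ρ) :
    ballRetract ρ x = x := by
  rw [ballRetract, max_eq_left ((div_le_one hρ).2 hx)]; simp

lemma norm_ballRetract_sub_le {ρ : ℝ} (hρ : 0 < ρ) (x y : E) :
    ‖ballRetract ρ x - ballRetract ρ y‖ ≤ 2 * ‖x - y‖ := by
  set m := max 1 (‖x‖ / ρ) with hm
  set n := max 1 (‖y‖ / ρ) with hn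
  have hm1 : 1 ≤ m := le_max_left _ _
  have hn1 : 1 ≤ n := le_max_left _ _
  have hmn : |n - m| ≤ ‖x - y‖ / ρ := by
    have h1 : |n - m| ≤ |‖y‖ / ρ - ‖x‖ / ρ| := by
      simpa [hm, hn, max_comm] using abs_max_sub_max_le_abs (‖y‖ / ρ) (‖x‖ / ρ) 1
    refine h1.trans ?_
    rw [← sub_div, abs_div, abs_of_pos hρ, norm_sub_rev]
    gcongr
    exact abs_norm_sub_norm_le y x
  -- The first term contributes ‖x - y‖, and the second contributes |n - m| ρ ≤ ‖x - y‖; hence the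
  -- Lipschitz constant 2.
  have e : ballRetract ρ x - ballRetract ρ y
      = m⁻¹ • (x - y) + ((n - m) * m⁻¹) • ballRetract ρ y := by
    simp only [ballRetract, ← hm, ← hn, smul_sub, smul_smul]
    rw [sub_add, ← sub_smul]
    congr 2
    field_simp
    ring
  rw [e]
  have hmi : m⁻¹ ≤ 1 := inv_le_one_of_one_le₀ hm1
  have hmi0 : 0 ≤ m⁻¹ := by positivity
  calc _ ≤ m⁻¹ * ‖x - y‖ + (|n - m| * m⁻¹) * ‖ballRetract ρ y‖ := by
        refine (norm_add_le _ _).trans ?_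
        rw [norm_smul, norm_smul, norm_mul, Real.norm_of_nonneg hmi0, Real.norm_eq_abs]
    _ ≤ 1 * ‖x - y‖ + (‖x - y‖ / ρ * 1) * ρ := by
        gcongr
        exact norm_ballRetract_le hρ y
    _ = _ := by field_simp; ring

lemma continuous_ballRetract {ρ : ℝ} (hρ : 0 < ρ) : Continuous (ballRetract ρ : E → E) :=
  (LipschitzWith.of_dist_le_mul (K := 2) fun x y => by
    simpa [dist_eq_norm] using norm_ballRetract_sub_le hρ x y).continuous

/-- The vector field of the equation for `W t = S (-t) (U t)`. -/
noncomputable def field (t : ℝ) (x : E) : E := H.S (-t) (H.N (H.S t x))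

/-- The vector field with truncated nonlinearity. -/
noncomputable def truncField (ρ t : ℝ) (x : E) : E := H.S (-t) (H.N (ballRetract ρ (H.S t x)))

lemma continuous_N : Continuous H.N := by
  have : Continuous fun x => H.G x x := H.G.continuous.clm_apply continuous_id
  exact H.K.continuous.comp this

lemma norm_N_sub_le {B : ℝ} {x y : E} (hx : ‖x‖ ≤ B) (hy : ‖y‖ ≤ B) :
    ‖H.N x - H.N y‖ ≤ 2 * ‖H.K‖ * ‖H.G‖ * B * ‖x - y‖ := by
  have e : H.N x - H.N y = H.K (H.G (x - y) x + H.G y (x - y)) := by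
    simp only [N, ← map_sub]; congr 1
    simp
  rw [e]
  refine (H.K.le_opNorm _).trans ?_
  have h1 := H.G.le_opNorm₂ (x - y) x
  have h2 := H.G.le_opNorm₂ y (x - y)
  have hB : 0 ≤ B := (norm_nonneg _).trans hx
  calc _ ≤ ‖H.K‖ * (‖H.G‖ * ‖x - y‖ * B + ‖H.G‖ * B * ‖x - y‖) := by
        gcongr
        refine (norm_add_le _ _).trans (add_le_add (h1.trans ?_) (h2.trans ?_)) <;> gcongr
    _ = _ := by ring

lemma norm_N_le (x : E) : ‖H.N x‖ ≤ ‖H.K‖ * ‖H.G‖ * ‖x‖ ^ 2 := by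
  refine (H.K.le_opNorm _).trans ?_
  have := H.G.le_opNorm₂ x x
  calc _ ≤ ‖H.K‖ * (‖H.G‖ * ‖x‖ * ‖x‖) := by gcongr
    _ = _ := by ring

lemma lipschitzOnWith_field (t : ℝ) (B : ℝ≥0) :
    LipschitzOnWith (2 * ‖H.K‖₊ * ‖H.G‖₊ * B) (H.field t) (Metric.closedBall 0 B) := by
  refine LipschitzOnWith.of_dist_le_mul fun x hx y hy => ?_
  rw [dist_eq_norm, dist_eq_norm, field, field, ← map_sub, H.norm_S, ← H.norm_S t (x - y), map_sub]
  exact H.norm_N_sub_le (B := B) (by simpa [H.norm_S] using hx) (by simpa [H.norm_S] using hy)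

lemma lipschitzWith_truncField {ρ : ℝ≥0} (hρ : 0 < ρ) (t : ℝ) :
    LipschitzWith (4 * ‖H.K‖₊ * ‖H.G‖₊ * ρ) (H.truncField ρ t) := by
  have hρ' : (0 : ℝ) < ρ := hρ
  refine LipschitzWith.of_dist_le_mul fun x y => ?_
  rw [dist_eq_norm, dist_eq_norm, truncField, truncField, ← map_sub, H.norm_S]
  refine (H.norm_N_sub_le (norm_ballRetract_le hρ' _) (norm_ballRetract_le hρ' _)).trans ?_
  have := norm_ballRetract_sub_le hρ' (H.S t x) (H.S t y)
  rw [← map_sub, H.norm_S] at this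
  calc _ ≤ 2 * ‖H.K‖ * ‖H.G‖ * ρ * (2 * ‖x - y‖) := by gcongr
    _ = _ := by push_cast; ring

/-- Truncation makes the field bounded and globally Lipschitz, uniformly in time, so Picard–Lindelöf
applies on every [0, T] without a smallness condition, and uniqueness glues the pieces. -/
lemma exists_truncated_solution [CompleteSpace E] {ρ : ℝ≥0} (hρ : 0 < ρ) (x₀ : E) :
    ∃ W : ℝ → E, W 0 = x₀ ∧
      ∀ t, 0 ≤ t → HasDerivWithinAt W (H.truncField ρ t (W t)) (Ici 0) t := by
  have hρ' : (0 : ℝ) < ρ := hρ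
  have hloc : ∀ T : ℝ, 0 ≤ T → ∃ W : ℝ → E, W 0 = x₀ ∧
      ∀ t ∈ Icc 0 T, HasDerivWithinAt W (H.truncField ρ t (W t)) (Icc 0 T) t := by
    intro T hT
    let L : ℝ≥0 := ‖H.K‖₊ * ‖H.G‖₊ * ρ ^ 2
    -- The field is bounded by `L` on the whole space, so the ball of radius `L * T` meets the
    -- Picard–Lindelöf condition with equality.
    have hPL : IsPicardLindelof (H.truncField ρ) (tmin := 0) (tmax := T) ⟨0, by simp [hT]⟩ x₀
        (L * ⟨T, hT⟩) 0 L (4 * ‖H.K‖₊ * ‖H.G‖₊ * ρ) := by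
      refine ⟨fun t _ => (H.lipschitzWith_truncField hρ t).lipschitzOnWith, fun x _ => ?_,
        fun t _ x _ => ?_, ?_⟩
      · refine Continuous.continuousOn (continuous_iff_continuousAt.2 fun t => ?_)
        refine H.tendsto_S (continuous_neg.tendsto t) ?_
        exact (H.continuous_N.comp ((continuous_ballRetract hρ').comp
          (H.continuous_S x))).tendsto t
      · rw [truncField, H.norm_S]
        refine (H.norm_N_le _).trans ?_
        have := norm_ballRetract_le hρ' (H.S t x)
        calc _ ≤ ‖H.K‖ * ‖H.G‖ * (ρ : ℝ) ^ 2 := by gcongr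
          _ = _ := by simp [L]
      · simp only [sub_zero, max_eq_left hT, NNReal.coe_zero]; exact le_rfl
    exact hPL.exists_eq_forall_mem_Icc_hasDerivWithinAt₀
  choose! α hα0 hα using hloc
  have hIci : ∀ {T t : ℝ}, t ∈ Ico 0 T →
      HasDerivWithinAt (α T) (H.truncField ρ t (α T t)) (Ici t) t := fun {T t} ht => by
    have h := hα T (ht.1.trans ht.2.le) t ⟨ht.1, ht.2.le⟩
    refine HasDerivWithinAt.mono_of_mem_nhdsWithin h ?_
    filter_upwards [self_mem_nhdsWithin, mem_nhdsWithin_of_mem_nhds (Iio_mem_nhds ht.2)]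
      with s hs hs' using ⟨ht.1.trans hs, le_of_lt hs'⟩
  have hcont : ∀ {T : ℝ}, 0 ≤ T → ContinuousOn (α T) (Icc 0 T) :=
    fun hT t ht => (hα _ hT t ht).continuousWithinAt
  have huniq : ∀ {T T' : ℝ}, 0 ≤ T → T ≤ T' → EqOn (α T) (α T') (Icc 0 T) := by
    intro T T' hT hTT'
    refine ODE_solution_unique (H.lipschitzWith_truncField hρ) (hcont hT) (fun t ht => hIci ht)
      ((hcont (hT.trans hTT')).mono (Icc_subset_Icc_right hTT')) (fun t ht => hIci
        ⟨ht.1, ht.2.trans_le hTT'⟩) ?_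
    rw [hα0 T hT, hα0 T' (hT.trans hTT')]
  -- The value at `t` is read from the solution on [0, t + 1]. Near `t` all these solutions agree
  -- with the one on [0, t + 2], which is the curve that gets differentiated.
  refine ⟨fun t => α (t + 1) t, by simpa using hα0 1 zero_le_one, fun t ht => ?_⟩
  have heq : ∀ s ∈ Icc 0 (t + 1), α (s + 1) s = α (t + 2) s := fun s hs =>
    huniq (by linarith [hs.1]) (by linarith [hs.2]) ⟨hs.1, by linarith⟩
  have h := hα (t + 2) (by linarith) t ⟨ht, by linarith⟩
  show HasDerivWithinAt _ (H.truncField ρ t (α (t + 1) t)) _ _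
  rw [heq t ⟨ht, by linarith⟩]
  have h' : HasDerivWithinAt (α (t + 2)) (H.truncField ρ t (α (t + 2) t)) (Ici 0) t := by
    refine h.mono_of_mem_nhdsWithin ?_
    filter_upwards [self_mem_nhdsWithin, mem_nhdsWithin_of_mem_nhds
      (Iio_mem_nhds (show t < t + 2 by linarith))] with s hs hs' using ⟨hs, le_of_lt hs'⟩
  refine h'.congr_of_eventuallyEq ?_ (heq t ⟨ht, by linarith⟩)
  filter_upwards [self_mem_nhdsWithin, mem_nhdsWithin_of_mem_nhds
      (Iio_mem_nhds (show t < t + 1 by linarith))] with s hs hs' using heq s ⟨hs, le_of_lt hs'⟩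

/-! #### Global solutions with small data -/

/-- In the ball of radius 1/(2g) the cubic term of the energy is at most ‖z‖²/6, so the energy lies
between ‖z‖²/3 and 2‖z‖²/3. -/
lemma norm_sq_le_of_energy_le {g : ℝ} (hg : 0 < g)
    (hG : ∀ x y, ‖H.G x y‖ ≤ g * ‖x‖ * ‖y‖) (hR : ∀ x, ‖H.R x‖ ≤ ‖x‖) {x y : E}
    (hx : ‖x‖ ≤ 1 / (2 * g)) (hy : ‖y‖ ≤ 1 / (2 * g)) (h : H.energy x = H.energy y) :
    ‖x‖ ^ 2 ≤ 2 * ‖y‖ ^ 2 := by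
  have key : ∀ z : E, ‖z‖ ≤ 1 / (2 * g) → |⟪H.R z, H.G z z⟫| ≤ ‖z‖ ^ 2 / 2 := by
    intro z hz
    have hz' : g * ‖z‖ ≤ 1 / 2 := by
      calc g * ‖z‖ ≤ g * (1 / (2 * g)) := by gcongr
        _ = 1 / 2 := by field_simp
    calc _ ≤ ‖H.R z‖ * ‖H.G z z‖ := abs_real_inner_le_norm _ _
      _ ≤ ‖z‖ * (g * ‖z‖ * ‖z‖) := by gcongr; exacts [hR z, hG z z]
      _ = (g * ‖z‖) * ‖z‖ ^ 2 := by ring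
      _ ≤ 1 / 2 * ‖z‖ ^ 2 := by gcongr
      _ = _ := by ring
  have h1 := abs_le.1 (key x hx)
  have h2 := abs_le.1 (key y hy)
  simp only [energy] at h
  nlinarith [h1.1, h2.2]

/-- A continuity argument on the truncated solution: while its norm is at most ρ the truncation is
inactive, the energy is conserved, and the norm is in fact at most √2 ‖x₀‖, well below ρ. The
truncation therefore never acts. -/
theorem exists_global_solution [CompleteSpace E] {g : ℝ} (hg : 0 < g)
    (hG : ∀ x y, ‖H.G x y‖ ≤ g * ‖x‖ * ‖y‖) (hR : ∀ x, ‖H.R x‖ ≤ ‖x‖) {x₀ : E}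
    (hx₀ : ‖x₀‖ ≤ 1 / (8 * g)) :
    ∃ U : ℝ → E, U 0 = x₀ ∧ ContinuousOn U (Ici 0) ∧ (∀ t, 0 ≤ t → ‖U t‖ ≤ 2 * ‖x₀‖) ∧
      ∀ t, 0 ≤ t → HasDerivWithinAt (fun s => H.R (U s)) (H.K (U t) + H.R (H.N (U t)))
        (Ici 0) t := by
  -- The radius in which energy controls the norm. The data lie in the ball of radius ρ/4, so the
  -- final bound 2‖x₀‖ is at most ρ/2.
  set ρ : ℝ≥0 := ⟨1 / (2 * g), by positivity⟩ with hρdef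
  have hρ : 0 < ρ := by
    rw [← NNReal.coe_pos]; show 0 < 1 / (2 * g); positivity
  have hρ' : (0 : ℝ) < ρ := hρ
  have hρe : (ρ : ℝ) = 1 / (2 * g) := rfl
  obtain ⟨W, hW0, hW⟩ := H.exists_truncated_solution hρ x₀
  have hcont : ContinuousOn W (Ici 0) := fun t ht => (hW t ht).continuousWithinAt
  have h4 : 1 / (8 * g) = ρ / 4 := by rw [hρe]; field_simp; norm_num
  rw [h4] at hx₀
  have hfield : ∀ {t}, ‖W t‖ ≤ ρ → H.truncField ρ t (W t) = H.field t (W t) := by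
    intro t ht
    rw [truncField, field, ballRetract_of_norm_le hρ' (by rwa [H.norm_S])]
  have hder : ∀ {t}, 0 ≤ t → ‖W t‖ ≤ ρ →
      HasDerivWithinAt W (H.field t (W t)) (Ici 0) t := fun h0 ht => hfield ht ▸ hW _ h0
  have hbound : ∀ {T}, 0 ≤ T → (∀ t ∈ Icc 0 T, ‖W t‖ ≤ ρ) → ‖W T‖ ≤ 2 * ‖x₀‖ := by
    intro T hT hle
    have he := H.energy_eq (hcont.mono Icc_subset_Ici_self)
      (fun t ht => (hder ht.1 (hle t ⟨ht.1, ht.2.le⟩)).mono (Ici_subset_Ici.2 ht.1))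
      (right_mem_Icc.2 hT)
    have := H.norm_sq_le_of_energy_le hg hG hR (by rw [H.norm_S]; exact hle T ⟨hT, le_rfl⟩)
      (hle 0 ⟨le_rfl, hT⟩) he
    rw [H.norm_S, hW0] at this
    nlinarith [norm_nonneg (W T), norm_nonneg x₀]
  have hlt : ∀ t, 0 ≤ t → ‖W t‖ < ρ := by
    intro t ht
    by_contra! hcon
    -- The contradiction is found at the first time `t₁` at which the norm is at least ρ: `hbound`
    -- applies up to `t₁` and gives at most ρ/2 there.
    have hne : (Icc 0 t ∩ {s | (ρ : ℝ) ≤ ‖W s‖}).Nonempty := ⟨t, ⟨ht, le_rfl⟩, hcon⟩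
    have hclosed : IsClosed (Icc 0 t ∩ {s | (ρ : ℝ) ≤ ‖W s‖}) :=
      (hcont.mono Icc_subset_Ici_self).norm.preimage_isClosed_of_isClosed isClosed_Icc isClosed_Ici
    have hcomp : IsCompact (Icc 0 t ∩ {s | (ρ : ℝ) ≤ ‖W s‖}) :=
      isCompact_Icc.of_isClosed_subset hclosed inter_subset_left
    obtain ⟨t₁, ⟨⟨ht1, ht1t⟩, hge⟩, hmin⟩ := hcomp.exists_isLeast hne
    have hbefore : ∀ s ∈ Ico 0 t₁, ‖W s‖ ≤ ρ := by
      intro s hs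
      by_contra! hcon
      exact absurd (hmin ⟨⟨hs.1, hs.2.le.trans ht1t⟩, hcon.le⟩) (not_le.2 hs.2)
    have hpos : 0 < t₁ := by
      rcases ht1.eq_or_lt with h | h
      · rw [← h, mem_ofPred_eq, hW0] at hge; linarith
      · exact h
    have hle : ‖W t₁‖ ≤ ρ := by
      have hc : ContinuousWithinAt (fun s => ‖W s‖) (Ico 0 t₁) t₁ :=
        ((hcont t₁ ht1).norm).mono (Ico_subset_Icc_self.trans Icc_subset_Ici_self)
      have hcl : t₁ ∈ closure (Ico 0 t₁) := by
        rw [closure_Ico hpos.ne]; exact right_mem_Icc.2 ht1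
      have := hc.mem_closure (t := Iic (ρ : ℝ)) hcl (fun s hs => hbefore s hs)
      simpa using this
    have := hbound ht1 (fun s hs => by
      rcases hs.2.eq_or_lt with h | h
      · rw [h]; exact hle
      · exact hbefore s ⟨hs.1, h⟩)
    rw [mem_ofPred_eq] at hge
    linarith
  refine ⟨fun t => H.S t (W t), by simp [H.S_zero, hW0], fun t ht =>
    H.tendsto_S (tendsto_id.mono_left nhdsWithin_le_nhds) (hcont t ht), fun t ht => ?_,
    fun t ht => ?_⟩
  · simpa [H.norm_S] using hbound ht fun s hs => (hlt s hs.1).le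
  · have := H.hasDerivWithinAt_R_S (hder ht (hlt t ht).le)
    simpa [field, H.S_S_neg] using this

/-- A solution in the weak sense is a mild solution. -/
lemma hasDerivWithinAt_of_weak [CompleteSpace E] {V : ℝ → E} (hc : ContinuousOn V (Ici 0))
    (hV : ∀ t, 0 ≤ t → HasDerivWithinAt (fun s => H.R (V s)) (H.K (V t) + H.R (H.N (V t)))
        (Ici 0) t) {t : ℝ} (ht : 0 ≤ t) :
    HasDerivWithinAt (fun s => H.S (-s) (V s)) (H.S (-t) (H.N (V t))) (Ici 0) t := by
  have hfc : ContinuousOn (fun s => H.S (-s) (H.N (V s))) (Ici 0) := fun s hs =>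
    H.tendsto_S ((continuous_neg.tendsto s).mono_left nhdsWithin_le_nhds)
      ((H.continuous_N.tendsto _).comp (hc s hs))
  obtain ⟨F, hF0, hF⟩ := exists_primitive hfc
  -- The term K V from the equation cancels the derivative of the group, leaving only the bounded
  -- nonlinearity.
  have hR : ∀ s, 0 ≤ s → HasDerivWithinAt (fun τ => H.R (H.S (-τ) (V τ)))
      (H.R (H.S (-s) (H.N (V s)))) (Ici 0) s := by
    intro s hs
    have h := H.hasDerivWithinAt_S_apply continuous_neg (hV s hs)
      (H.hasDerivAt_S_neg_R s (V s)).hasDerivWithinAt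
    simpa only [H.S_R, map_add, neg_add_cancel_left] using h
  -- Both sides agree after applying `R`, having the same derivative and initial value; injectivity
  -- of `R` removes it, and the right side is differentiable without any `R`.
  have hconst : ∀ s, 0 ≤ s → H.S (-s) (V s) = V 0 + F s := by
    intro s hs
    have hd : ∀ τ, 0 ≤ τ → HasDerivWithinAt (fun τ => H.R (H.S (-τ) (V τ)) - H.R (F τ)) 0
        (Ici 0) τ := fun τ hτ => by
      have h := (hR τ hτ).sub (H.R.hasFDerivAt.comp_hasDerivWithinAt τ (hF τ hτ))
      rwa [sub_self] at h
    have := constant_of_has_deriv_right_zero (a := 0) (b := s)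
      (fun τ hτ => (hd τ hτ.1).continuousWithinAt.mono Icc_subset_Ici_self)
      (fun τ hτ => (hd τ hτ.1).mono (Ici_subset_Ici.2 hτ.1)) s (right_mem_Icc.2 hs)
    simp only [← map_sub, hF0, neg_zero, H.S_zero, sub_zero] at this
    rw [← H.R_injective this]; simp
  exact ((hF t ht).const_add (V 0)).congr (fun s hs => hconst s hs) (hconst t ht)

/-- Both curves become mild solutions of the equation for S(-t)U(t). On [0, t] they stay in a common
ball by compactness, and there the field is Lipschitz. No smallness is required. -/
theorem global_solution_unique [CompleteSpace E] {U V : ℝ → E}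
    (hUc : ContinuousOn U (Ici 0)) (hVc : ContinuousOn V (Ici 0))
    (hU : ∀ t, 0 ≤ t → HasDerivWithinAt (fun s => H.R (U s)) (H.K (U t) + H.R (H.N (U t)))
        (Ici 0) t)
    (hV : ∀ t, 0 ≤ t → HasDerivWithinAt (fun s => H.R (V s)) (H.K (V t) + H.R (H.N (V t)))
        (Ici 0) t) (h0 : U 0 = V 0) {t : ℝ} (ht : 0 ≤ t) : U t = V t := by
  have hmild : ∀ {X : ℝ → E}, ContinuousOn X (Ici 0) → ContinuousOn (fun s => H.S (-s) (X s))
      (Icc 0 t) := fun hX s hs =>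
    H.tendsto_S ((continuous_neg.tendsto s).mono_left nhdsWithin_le_nhds)
      ((hX s hs.1).mono Icc_subset_Ici_self)
  obtain ⟨B₁, hB₁⟩ := isCompact_Icc.exists_bound_of_continuousOn (hmild hUc)
  obtain ⟨B₂, hB₂⟩ := isCompact_Icc.exists_bound_of_continuousOn (hmild hVc)
  set B : ℝ≥0 := Real.toNNReal (max B₁ B₂)
  have hd : ∀ {X : ℝ → E}, ContinuousOn X (Ici 0) → (∀ t, 0 ≤ t → HasDerivWithinAt
      (fun s => H.R (X s)) (H.K (X t) + H.R (H.N (X t))) (Ici 0) t) → ∀ s ∈ Ico 0 t,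
      HasDerivWithinAt (fun s => H.S (-s) (X s)) (H.field s (H.S (-s) (X s))) (Ici s) s := by
    intro X hX hX' s hs
    have := (H.hasDerivWithinAt_of_weak hX hX' hs.1).mono (Ici_subset_Ici.2 hs.1)
    simpa [field, H.S_S_neg] using this
  have := ODE_solution_unique_of_mem_Icc_right (v := H.field) (s := fun _ => Metric.closedBall 0 B)
    (fun s _ => H.lipschitzOnWith_field s B) (hmild hUc) (hd hUc hU)
    (fun s hs => by
      simp only [mem_closedBall_zero_iff]
      exact (hB₁ s ⟨hs.1, hs.2.le⟩).trans ((le_max_left _ _).trans (Real.le_coe_toNNReal _)))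
    (hmild hVc) (hd hVc hV)
    (fun s hs => by
      simp only [mem_closedBall_zero_iff]
      exact (hB₂ s ⟨hs.1, hs.2.le⟩).trans ((le_max_right _ _).trans (Real.le_coe_toNNReal _)))
    (by simp [h0]) (right_mem_Icc.2 ht)
  have h := congrArg (H.S t) this
  simpa [H.S_S_neg] using h

end HamiltonianData
end Abstract

/-! ### Multiplication by bounded operator-valued functions -/

section Symbols

open scoped RealInnerProductSpace

lemma L2Space.integrable_norm_sq {F : Type*} [NormedAddCommGroup F]
    (f : Lp F 2 (volume : Measure Plane)) : Integrable fun ξ => ‖f ξ‖ ^ 2 :=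
  (memLp_two_iff_integrable_sq_norm (Lp.memLp f).1).1 (Lp.memLp f)

variable {F G F' : Type*} [NormedAddCommGroup F] [InnerProductSpace ℂ F]
  [NormedAddCommGroup G] [InnerProductSpace ℂ G] [NormedAddCommGroup F'] [InnerProductSpace ℂ F']

/-- Square integrable functions on the plane. -/
abbrev L2Space (F : Type*) [NormedAddCommGroup F] : Type _ := Lp F 2 (volume : Measure Plane)

/-- A bounded measurable function with values in `F →L[ℂ] G`. -/
structure Symb (F G : Type*) [NormedAddCommGroup F] [InnerProductSpace ℂ F]
    [NormedAddCommGroup G] [InnerProductSpace ℂ G] where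
  toFun : Plane → F →L[ℂ] G
  meas : StronglyMeasurable toFun
  bdd : ∃ C, ∀ ξ, ‖toFun ξ‖ ≤ C

namespace Symb

instance : CoeFun (Symb F G) fun _ => Plane → F →L[ℂ] G := ⟨Symb.toFun⟩

lemma aestronglyMeasurable_apply (A : Symb F G) {f : Plane → F}
    (hf : AEStronglyMeasurable f volume) :
    AEStronglyMeasurable (fun ξ => A ξ (f ξ)) volume :=
  ContinuousLinearMap.aestronglyMeasurable_comp₂ (ContinuousLinearMap.id ℂ (F →L[ℂ] G))
    A.meas.aestronglyMeasurable hf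

lemma memLp_apply (A : Symb F G) (f : L2Space F) : MemLp (fun ξ => A ξ (f ξ)) 2 volume := by
  obtain ⟨C, hC⟩ := A.bdd
  exact (Lp.memLp f).of_le_mul (c := C) (A.aestronglyMeasurable_apply (Lp.memLp f).1)
    (Eventually.of_forall fun ξ => (A ξ).le_of_opNorm_le (hC ξ) _)

/-- The multiplication operator on `L²`. -/
noncomputable def op (A : Symb F G) : L2Space F →L[ℂ] L2Space G :=
  LinearMap.mkContinuousOfExistsBound
    { toFun := fun f => (A.memLp_apply f).toLp
      map_add' := fun f g => by
        rw [← MemLp.toLp_add, MemLp.toLp_eq_toLp_iff]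
        filter_upwards [Lp.coeFn_add f g] with ξ h
        rw [h]
        simp
      map_smul' := fun c f => by
        rw [RingHom.id_apply, ← MemLp.toLp_const_smul, MemLp.toLp_eq_toLp_iff]
        filter_upwards [Lp.coeFn_smul c f] with ξ h
        rw [h]
        simp } <| by
    obtain ⟨C, hC⟩ := A.bdd
    refine ⟨C, fun f => Lp.norm_le_mul_norm_of_ae_le_mul ?_⟩
    filter_upwards [(A.memLp_apply f).coeFn_toLp] with ξ h
    exact h ▸ (A ξ).le_of_opNorm_le (hC ξ) _

lemma op_ae (A : Symb F G) (f : L2Space F) : A.op f =ᵐ[volume] fun ξ => A ξ (f ξ) :=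
  (A.memLp_apply f).coeFn_toLp

lemma op_norm_le (A : Symb F G) {C : ℝ} (hC : ∀ ξ, ‖A ξ‖ ≤ C) (f : L2Space F) :
    ‖A.op f‖ ≤ C * ‖f‖ := by
  refine Lp.norm_le_mul_norm_of_ae_le_mul ?_
  filter_upwards [A.op_ae f] with ξ h
  exact h ▸ (A ξ).le_of_opNorm_le (hC ξ) _

lemma op_eq_iff {A : Symb F G} {f : L2Space F} {g : L2Space G} :
    A.op f = g ↔ ∀ᵐ ξ, A ξ (f ξ) = g ξ := by
  rw [Lp.ext_iff]
  exact ⟨fun h => by filter_upwards [A.op_ae f, h] with ξ h1 h2 using h1 ▸ h2,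
    fun h => by filter_upwards [A.op_ae f, h] with ξ h1 h2 using h1.trans h2⟩

lemma op_op (A : Symb G F') (B : Symb F G) (C : Symb F F') (h : ∀ ξ x, A ξ (B ξ x) = C ξ x)
    (f : L2Space F) : A.op (B.op f) = C.op f := by
  rw [op_eq_iff]
  filter_upwards [B.op_ae f, C.op_ae f] with ξ h1 h2
  rw [h1, h2, h]

lemma op_comm {G' : Type*} [NormedAddCommGroup G'] [InnerProductSpace ℂ G']
    (A : Symb G F') (B : Symb F G) (A' : Symb F G') (B' : Symb G' F')
    (h : ∀ ξ x, A ξ (B ξ x) = B' ξ (A' ξ x))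
    (f : L2Space F) : A.op (B.op f) = B'.op (A'.op f) := by
  rw [op_eq_iff]
  filter_upwards [B.op_ae f, A'.op_ae f, B'.op_ae (A'.op f)] with ξ h1 h2 h3
  rw [h1, h3, h2, h]

end Symb

lemma L2Space.norm_sq_eq (f : L2Space F) : ‖f‖ ^ 2 = ∫ ξ, ‖f ξ‖ ^ 2 := by
  have h := L2.inner_def (𝕜 := ℂ) f f
  rw [inner_self_eq_norm_sq_to_K] at h
  have h2 : ∫ ξ, inner ℂ (f ξ) (f ξ) = ((∫ ξ, ‖f ξ‖ ^ 2 : ℝ) : ℂ) := by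
    rw [← integral_complex_ofReal]
    refine integral_congr_ae (Eventually.of_forall fun ξ => ?_)
    simp [inner_self_eq_norm_sq_to_K]
  rw [h2] at h
  simpa [← Complex.ofReal_pow] using congrArg Complex.re h

/-- Strong convergence of multiplication operators from pointwise convergence of the symbols. -/
lemma Symb.tendsto_op {X : Type*} {l : Filter X} [l.IsCountablyGenerated] {A : X → Symb F G}
    {A₀ : Symb F G} {C : ℝ} (hC : ∀ a ξ, ‖A a ξ‖ ≤ C)
    (h : ∀ ξ x, Tendsto (fun a => A a ξ x) l (𝓝 (A₀ ξ x))) (f : L2Space F) :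
    Tendsto (fun a => (A a).op f) l (𝓝 (A₀.op f)) := by
  rcases l.eq_or_neBot with rfl | hl
  · simp
  have hC0 : ∀ ξ x, ‖A₀ ξ x‖ ≤ C * ‖x‖ := fun ξ x =>
    le_of_tendsto (h ξ x).norm (Eventually.of_forall fun a => (A a ξ).le_of_opNorm_le (hC a ξ) x)
  rw [tendsto_iff_norm_sub_tendsto_zero]
  have key : Tendsto (fun a => ‖(A a).op f - A₀.op f‖ ^ 2) l (𝓝 0) := by
    have e : ∀ a, ‖(A a).op f - A₀.op f‖ ^ 2 = ∫ ξ, ‖A a ξ (f ξ) - A₀ ξ (f ξ)‖ ^ 2 := by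
      intro a
      rw [L2Space.norm_sq_eq]
      refine integral_congr_ae ?_
      filter_upwards [Lp.coeFn_sub ((A a).op f) (A₀.op f), (A a).op_ae f, A₀.op_ae f]
        with ξ h1 h2 h3
      rw [h1, Pi.sub_apply, h2, h3]
    simp only [e]
    have := tendsto_integral_filter_of_dominated_convergence (l := l)
      (F := fun a ξ => ‖A a ξ (f ξ) - A₀ ξ (f ξ)‖ ^ 2) (f := fun _ => (0 : ℝ))
      (μ := (volume : Measure Plane)) (fun ξ => (2 * C) ^ 2 * ‖f ξ‖ ^ 2) ?_ ?_ ?_ ?_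
    · simpa using this
    · exact Eventually.of_forall fun a => (((A a).aestronglyMeasurable_apply (Lp.memLp f).1).sub
        (A₀.aestronglyMeasurable_apply (Lp.memLp f).1)).norm.pow 2
    · refine Eventually.of_forall fun a => Eventually.of_forall fun ξ => ?_
      have h1 := (A a ξ).le_of_opNorm_le (hC a ξ) (f ξ)
      have h2 := hC0 ξ (f ξ)
      rw [Real.norm_of_nonneg (by positivity), ← mul_pow]
      gcongr
      exact (norm_sub_le _ _).trans (by linarith)
    · exact (L2Space.integrable_norm_sq f).const_mul _
    · refine Eventually.of_forall fun ξ => ?_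
      have := ((h ξ (f ξ)).sub_const (A₀ ξ (f ξ))).norm.pow 2
      simpa using this
  have := key.sqrt
  simpa using this

/-- Multiplication by a bounded function. -/
noncomputable def Symb.scalar (F : Type*) [NormedAddCommGroup F] [InnerProductSpace ℂ F]
    (m : Plane → ℂ) (hm : Measurable m) (hb : ∃ C, ∀ ξ, ‖m ξ‖ ≤ C) : Symb F F where
  toFun ξ := m ξ • ContinuousLinearMap.id ℂ F
  meas := hm.stronglyMeasurable.smul_const _
  bdd := by
    obtain ⟨C, hC⟩ := hb
    refine ⟨C, fun ξ => ContinuousLinearMap.opNorm_le_bound _ ((norm_nonneg _).trans (hC ξ))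
      fun x => ?_⟩
    simp only [smul_apply, ContinuousLinearMap.id_apply, norm_smul]
    gcongr
    exact hC ξ

@[simp] lemma Symb.scalar_apply {m : Plane → ℂ} {hm : Measurable m} {hb : ∃ C, ∀ ξ, ‖m ξ‖ ≤ C}
    (ξ : Plane) (x : F) : Symb.scalar F m hm hb ξ x = m ξ • x := by
  simp [Symb.scalar]

/-! #### Groups generated by skew-adjoint multiplication operators -/

section Group

variable [FiniteDimensional ℂ F]

/-- An unbounded skew-adjoint symbol. -/
structure SkewSymb (F : Type*) [NormedAddCommGroup F] [InnerProductSpace ℂ F]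
    [FiniteDimensional ℂ F] where
  toFun : Plane → F →L[ℂ] F
  meas : StronglyMeasurable toFun
  skew : ∀ ξ x y, inner ℂ (toFun ξ x) y = -inner ℂ x (toFun ξ y)

variable (M : SkewSymb F)

namespace SkewSymb

instance : CompleteSpace F := FiniteDimensional.complete ℂ F

lemma hasDerivAt_exp_apply (t : ℝ) (ξ : Plane) (x : F) :
    HasDerivAt (fun s : ℝ => NormedSpace.exp ((s : ℂ) • M.toFun ξ) x)
      (NormedSpace.exp ((t : ℂ) • M.toFun ξ) (M.toFun ξ x)) t := by
  have h := hasDerivAt_exp_smul_const (𝕂 := ℂ) (M.toFun ξ) (t : ℂ)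
  have h2 := (ContinuousLinearMap.apply ℂ F x).hasFDerivAt.comp_hasDerivAt (t : ℂ) h
  have h3 := h2.scomp t (Complex.ofRealCLM.hasDerivAt (x := t))
  simpa [Function.comp_def] using h3

lemma exp_apply_comm (t : ℝ) (ξ : Plane) {T : F →L[ℂ] F} (hT : Commute T (M.toFun ξ)) (x : F) :
    NormedSpace.exp ((t : ℂ) • M.toFun ξ) (T x) = T (NormedSpace.exp ((t : ℂ) • M.toFun ξ) x) := by
  have h : Commute T (NormedSpace.exp ((t : ℂ) • M.toFun ξ)) := (hT.smul_right (t : ℂ)).exp_right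
  exact (DFunLike.congr_fun h.eq x).symm

/-- The squared norm along the flow has derivative zero by skewness, since the exponential commutes
with its generator. -/
lemma norm_exp_apply (t : ℝ) (ξ : Plane) (x : F) :
    ‖NormedSpace.exp ((t : ℂ) • M.toFun ξ) x‖ = ‖x‖ := by
  have hd : ∀ s : ℝ, HasDerivAt
      (fun s : ℝ => inner ℂ (NormedSpace.exp ((s : ℂ) • M.toFun ξ) x)
        (NormedSpace.exp ((s : ℂ) • M.toFun ξ) x)) 0 s := by
    intro s
    let : NormedSpace ℝ F := NormedSpace.restrictScalars ℝ ℂ F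
    have h := M.hasDerivAt_exp_apply s ξ x
    refine (h.inner ℂ h).congr_deriv ?_
    rw [M.exp_apply_comm s ξ (Commute.refl _), M.skew]
    simp
  have hc := is_const_of_deriv_eq_zero (fun s => (hd s).differentiableAt) (fun s => (hd s).deriv)
    t 0
  simp only [Complex.ofReal_zero, zero_smul, NormedSpace.exp_zero, one_apply_eq_self,
    inner_self_eq_norm_sq_to_K] at hc
  have h2 : ‖NormedSpace.exp ((t : ℂ) • M.toFun ξ) x‖ ^ 2 = ‖x‖ ^ 2 :=
    Complex.ofReal_injective (by exact_mod_cast hc)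
  exact (sq_eq_sq₀ (norm_nonneg _) (norm_nonneg _)).1 h2

lemma norm_exp_sub_le (t : ℝ) (ξ : Plane) (x : F) :
    ‖NormedSpace.exp ((t : ℂ) • M.toFun ξ) x - x‖ ≤ ‖M.toFun ξ x‖ * |t| := by
  have := Convex.norm_image_sub_le_of_norm_hasDerivWithin_le (s := univ) (x := (0 : ℝ)) (y := t)
    (fun s _ => (M.hasDerivAt_exp_apply s ξ x).hasDerivWithinAt)
    (fun s _ => (M.norm_exp_apply s ξ _).le) convex_univ (mem_univ _) (mem_univ _)
  simpa using this

/-- The symbol of the group. -/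
noncomputable def expSymb (t : ℝ) : Symb F F where
  toFun ξ := NormedSpace.exp ((t : ℂ) • M.toFun ξ)
  meas := by
    let +nondep : NormedAlgebra ℚ (F →L[ℂ] F) := .restrictScalars ℚ ℂ _
    exact NormedSpace.exp_continuous.comp_stronglyMeasurable (M.meas.const_smul (t : ℂ))
  bdd := ⟨1, fun ξ => ContinuousLinearMap.opNorm_le_bound _ zero_le_one fun x => by
    rw [M.norm_exp_apply, one_mul]⟩

lemma expSymb_apply (t : ℝ) (ξ : Plane) (x : F) :
    M.expSymb t ξ x = NormedSpace.exp ((t : ℂ) • M.toFun ξ) x := rfl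

lemma expSymb_add (s t : ℝ) (f : L2Space F) :
    (M.expSymb (s + t)).op f = (M.expSymb s).op ((M.expSymb t).op f) := by
  refine (Symb.op_op _ _ _ (fun ξ x => ?_) f).symm
  let +nondep : NormedAlgebra ℚ (F →L[ℂ] F) := .restrictScalars ℚ ℂ _
  simp only [expSymb_apply]
  rw [Complex.ofReal_add, add_smul, NormedSpace.exp_add_of_commute]
  · rfl
  · exact ((Commute.refl _).smul_left _).smul_right _

lemma expSymb_zero (f : L2Space F) : (M.expSymb 0).op f = f := by
  rw [Symb.op_eq_iff]
  exact Eventually.of_forall fun ξ => by simp [expSymb_apply]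

lemma norm_expSymb_op (t : ℝ) (f : L2Space F) : ‖(M.expSymb t).op f‖ = ‖f‖ := by
  have key : ∀ᵐ ξ, ‖(M.expSymb t).op f ξ‖ = ‖f ξ‖ := by
    filter_upwards [(M.expSymb t).op_ae f] with ξ h
    rw [h, expSymb_apply, M.norm_exp_apply]
  exact le_antisymm (Lp.norm_le_norm_of_ae_le (key.mono fun _ h => h.le))
    (Lp.norm_le_norm_of_ae_le (key.mono fun _ h => h.ge))

lemma continuous_expSymb_op (f : L2Space F) : Continuous fun t => (M.expSymb t).op f := by
  refine continuous_iff_continuousAt.2 fun t => Symb.tendsto_op (C := 1) (fun s ξ => ?_) ?_ f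
  · exact ContinuousLinearMap.opNorm_le_bound _ zero_le_one fun x => by
      rw [expSymb_apply, M.norm_exp_apply, one_mul]
  · exact fun ξ x => (M.hasDerivAt_exp_apply t ξ x).continuousAt.tendsto

/-- The generator may be unbounded, but on the range of `R` it is the bounded symbol `K`. By the
mean value inequality the symbols of the difference quotients are bounded by that of `K`, so
pointwise convergence in ξ upgrades to L² convergence. -/
lemma hasDerivAt_expSymb_op (R K : Symb F F) (hK : ∀ ξ x, M.toFun ξ (R ξ x) = K ξ x)
    (f : L2Space F) : HasDerivAt (fun t => (M.expSymb t).op (R.op f)) (K.op f) 0 := by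
  obtain ⟨C, hC⟩ := K.bdd
  rw [hasDerivAt_iff_tendsto_slope]
  let A : ℝ → Symb F F := fun t =>
    { toFun := fun ξ => t⁻¹ • ((M.expSymb t ξ).comp (R ξ) - R ξ)
      meas := by
        refine (continuous_const_smul t⁻¹).comp_stronglyMeasurable
          (f := fun ξ => (M.expSymb t ξ).comp (R ξ) - R ξ) (StronglyMeasurable.sub ?_ R.meas)
        exact (ContinuousLinearMap.compL ℂ F F F).continuous₂.comp_stronglyMeasurable
          ((M.expSymb t).meas.prodMk R.meas)
      bdd := by
        obtain ⟨B, hB⟩ := ((M.expSymb t)).bdd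
        obtain ⟨B', hB'⟩ := R.bdd
        refine ⟨‖t⁻¹‖ * (B * B' + B'), fun ξ => ?_⟩
        rw [norm_smul]
        have hB0 := (norm_nonneg _).trans (hB ξ)
        gcongr
        refine (norm_sub_le _ _).trans (add_le_add ?_ (hB' ξ))
        refine (ContinuousLinearMap.opNorm_comp_le _ _).trans ?_
        gcongr
        exacts [hB ξ, hB' ξ] }
  have hA : ∀ t ξ x, A t ξ x = t⁻¹ • (NormedSpace.exp ((t : ℂ) • M.toFun ξ) (R ξ x) - R ξ x) :=
    fun t ξ x => rfl
  have hlim := Symb.tendsto_op (l := 𝓝[≠] (0 : ℝ)) (A := A) (A₀ := K) (C := C) ?_ ?_ f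
  · refine hlim.congr fun t => ?_
    rw [Symb.op_eq_iff]
    have e : slope (fun t => (M.expSymb t).op (R.op f)) 0 t
        = t⁻¹ • ((M.expSymb t).op (R.op f) - R.op f) := by
      simp [slope, M.expSymb_zero]
    rw [e]
    filter_upwards [Lp.coeFn_smul t⁻¹ ((M.expSymb t).op (R.op f) - R.op f),
      Lp.coeFn_sub ((M.expSymb t).op (R.op f)) (R.op f), (M.expSymb t).op_ae (R.op f),
      R.op_ae f] with ξ h1 h2 h3 h4
    rw [h1, Pi.smul_apply, h2, Pi.sub_apply, h3, h4, hA, expSymb_apply]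
  · intro t ξ
    refine ContinuousLinearMap.opNorm_le_bound _ ((norm_nonneg _).trans (hC ξ)) fun x => ?_
    rw [hA, norm_smul, norm_inv, Real.norm_eq_abs]
    have h1 := M.norm_exp_sub_le t ξ (R ξ x)
    rw [hK] at h1
    have h2 := (K ξ).le_of_opNorm_le (hC ξ) x
    rcases eq_or_ne t 0 with rfl | ht
    · simpa using (norm_nonneg _).trans h2
    · rw [inv_mul_le_iff₀ (abs_pos.2 ht), mul_comm]
      exact h1.trans (by gcongr)
  · intro ξ x
    have := (M.hasDerivAt_exp_apply 0 ξ (R ξ x)).tendsto_slope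
    simp only [Complex.ofReal_zero, zero_smul, NormedSpace.exp_zero, one_apply_eq_self, hK] at this
    refine this.congr fun t => ?_
    rw [hA]
    simp [slope]

end SkewSymb
end Group
end Symbols

/-! ### The Fourier transform on `L²` -/

section FourierL2

/-- The bilinear pairing `∫ f g` on `L²`. -/
noncomputable def pairL2 : L2Space ℂ →L[ℂ] L2Space ℂ →L[ℂ] ℂ :=
  ContinuousLinearMap.lpPairing volume 2 2 (ContinuousLinearMap.mul ℂ ℂ)

lemma pairL2_apply (f g : L2Space ℂ) : pairL2 f g = ∫ x, f x * g x := by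
  rw [pairL2, ContinuousLinearMap.lpPairing_eq_integral]
  rfl

lemma denseRange_schwartz :
    DenseRange (fun φ : 𝓢(Plane, ℂ) => (φ.toLp 2 : L2Space ℂ)) :=
  SchwartzMap.denseRange_toLpCLM (E := Plane) (F := ℂ) (p := 2) (μ := volume) (by simp)

lemma pairL2_toLp_toLp (φ ψ : 𝓢(Plane, ℂ)) :
    pairL2 (φ.toLp 2) (ψ.toLp 2) = ∫ x, φ x * ψ x := by
  rw [pairL2_apply]
  refine integral_congr_ae ?_
  filter_upwards [φ.coeFn_toLp 2, ψ.coeFn_toLp 2] with x h1 h2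
  rw [h1, h2]

lemma continuous_fourierL2 : Continuous fun f : L2Space ℂ => 𝓕 f :=
  (Lp.fourierTransformₗᵢ Plane ℂ).continuous

lemma continuous_fourierInvL2 : Continuous fun f : L2Space ℂ => 𝓕⁻ f :=
  (Lp.fourierTransformₗᵢ Plane ℂ).symm.continuous

lemma norm_fourierInvL2 (f : L2Space ℂ) : ‖𝓕⁻ f‖ = ‖f‖ :=
  (Lp.fourierTransformₗᵢ Plane ℂ).symm.norm_map f

/-- The pairing is bilinear, without conjugation, to match the weak formulation. The identity is
classical for Schwartz functions and extends by density in one argument after the other. -/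
lemma pairL2_fourier (f g : L2Space ℂ) : pairL2 (𝓕 f) g = pairL2 f (𝓕 g) := by
  have hc : ∀ h : L2Space ℂ, Continuous fun f : L2Space ℂ => pairL2 f h := fun h =>
    (pairL2.flip h).continuous
  have hc1 : ∀ h : L2Space ℂ, Continuous fun f : L2Space ℂ => pairL2 (𝓕 f) h := fun h =>
    (hc h).comp continuous_fourierL2
  have hc2 : ∀ h : L2Space ℂ, Continuous fun f : L2Space ℂ => pairL2 h (𝓕 f) := fun h =>
    (pairL2 h).continuous.comp continuous_fourierL2
  have h1 : ∀ (φ : 𝓢(Plane, ℂ)) (g : L2Space ℂ),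
      pairL2 (𝓕 (φ.toLp 2 : L2Space ℂ)) g = pairL2 (φ.toLp 2) (𝓕 g) := by
    intro φ g
    refine congrFun (denseRange_schwartz.equalizer (pairL2 _).continuous (hc2 _) ?_) g
    funext ψ
    simp only [Function.comp_apply]
    rw [SchwartzMap.toLp_fourier_eq, SchwartzMap.toLp_fourier_eq, pairL2_toLp_toLp, pairL2_toLp_toLp,
      SchwartzMap.integral_fourier_mul_eq]
  refine congrFun (denseRange_schwartz.equalizer (hc1 g) (hc _) ?_) f
  funext φ
  exact h1 φ g

lemma pairL2_fourierInv_fourier (f g : L2Space ℂ) : pairL2 (𝓕⁻ f) (𝓕 g) = pairL2 f g := by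
  rw [← pairL2_fourier, FourierTransform.fourier_fourierInv_eq]

lemma pairL2_fourierInv (f g : L2Space ℂ) : pairL2 (𝓕⁻ f) g = pairL2 f (𝓕⁻ g) := by
  rw [← pairL2_fourierInv_fourier f, FourierTransform.fourier_fourierInv_eq]

lemma ae_eq_zero_of_forall_schwartz {f : Plane → ℂ} (hf : LocallyIntegrable f volume)
    (h : ∀ φ : 𝓢(Plane, ℂ), ∫ x, f x * φ x = 0) : f =ᵐ[volume] 0 := by
  refine ae_eq_zero_of_integral_contDiff_smul_eq_zero hf fun g hg hgc => ?_
  have hg' : ContDiff ℝ ((⊤ : ℕ∞) : WithTop ℕ∞) fun x => (g x : ℂ) :=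
    Complex.ofRealCLM.contDiff.comp hg
  have hgc' : HasCompactSupport fun x => (g x : ℂ) := hgc.comp_left (g := Complex.ofReal) rfl
  have := h (hgc'.toSchwartzMap hg')
  rw [← this]
  refine integral_congr_ae (Eventually.of_forall fun x => ?_)
  change g x • f x = f x * (g x : ℂ)
  rw [Complex.real_smul, mul_comm]

lemma integral_fourierInv_mul_schwartz {g : Plane → ℂ} (hg : Integrable g volume)
    (φ : 𝓢(Plane, ℂ)) : ∫ x, 𝓕⁻ g x * φ x = ∫ x, g x * 𝓕⁻ φ x := by
  have h := VectorFourier.integral_fourierIntegral_smul_eq_flip (L := innerₗ Plane)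
    (f := g) (g := fun x => φ (-x)) Real.continuous_fourierChar continuous_inner hg
    (φ.integrable.comp_neg (μ := volume))
  have e1 : ∫ x, 𝓕⁻ g x * φ x = ∫ x, 𝓕 g x • φ (-x) := by
    rw [← integral_neg_eq_self]
    refine integral_congr_ae (Eventually.of_forall fun x => ?_)
    simp [Real.fourierInv_eq_fourier_neg]
  have e2 : ∫ x, g x * 𝓕⁻ φ x = ∫ x, g x • 𝓕 (fun x => φ (-x)) x := by
    refine integral_congr_ae (Eventually.of_forall fun x => ?_)
    simp only [smul_eq_mul]
    rw [SchwartzMap.fourierInv_coe, Real.fourierInv_eq_fourier_comp_neg]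
  rw [e1, e2]
  simpa [flip_innerₗ] using! h

/-- The operator `multiplier` is defined by integrals while the states live in L²; this reconciles
the two transforms on L¹ ∩ L², by testing against Schwartz functions. -/
lemma fourierInv_toLp_ae {g : Plane → ℂ} (hg : Integrable g volume) (hg2 : MemLp g 2 volume) :
    (𝓕⁻ (hg2.toLp g : L2Space ℂ) : L2Space ℂ) =ᵐ[volume] 𝓕⁻ g := by
  have hc : Continuous (𝓕⁻ g) := by
    rw [Real.fourierInv_eq_fourier_comp_neg]
    exact VectorFourier.fourierIntegral_continuous Real.continuous_fourierChar
      (by exact continuous_inner) hg.comp_neg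
  have h1 : LocallyIntegrable (𝓕⁻ (hg2.toLp g : L2Space ℂ) : L2Space ℂ) volume :=
    (Lp.memLp _).locallyIntegrable (by norm_num)
  have h2 := ae_eq_zero_of_forall_schwartz (h1.sub hc.locallyIntegrable) fun φ => ?_
  · filter_upwards [h2] with x hx
    simpa [sub_eq_zero] using hx
  · have hφ : MemLp φ 2 (volume : Measure Plane) := φ.memLp 2
    have i1 : Integrable (fun x => (𝓕⁻ (hg2.toLp g : L2Space ℂ) : L2Space ℂ) x * φ x) volume :=
      (Lp.memLp _).integrable_mul hφ
    have i2 : Integrable (fun x => 𝓕⁻ g x * φ x) volume := by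
      refine φ.integrable.bdd_mul (c := ∫ x, ‖g x‖) hc.aestronglyMeasurable
        (Eventually.of_forall fun x => ?_)
      rw [Real.fourierInv_eq]
      exact (norm_integral_le_integral_norm _).trans_eq (by simp)
    simp only [Pi.sub_apply, sub_mul]
    rw [integral_sub i1 i2, integral_fourierInv_mul_schwartz hg, sub_eq_zero]
    have h3 := pairL2_fourierInv (hg2.toLp g) (φ.toLp 2)
    rw [SchwartzMap.toLp_fourierInv_eq, pairL2_apply, pairL2_apply] at h3
    refine Eq.trans (integral_congr_ae ?_) (h3.trans (integral_congr_ae ?_))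
    · filter_upwards [φ.coeFn_toLp 2] with x h
      rw [h]
    · filter_upwards [(𝓕⁻ φ).coeFn_toLp 2, hg2.coeFn_toLp] with x h h'
      rw [h, h']

end FourierL2

/-! ### Products of functions in `H¹(ℝ²)` -/

section Product

/-- The symbol of `(1 - Δ)^{-1/2}`, up to normalization. -/
noncomputable def besselWeight (ξ : Plane) : ℝ := (1 + ‖ξ‖ ^ 2) ^ (-1 / 2 : ℝ)

lemma besselWeight_pos (ξ : Plane) : 0 < besselWeight ξ := by
  unfold besselWeight; positivity

lemma besselWeight_sq (ξ : Plane) : besselWeight ξ ^ 2 = (1 + ‖ξ‖ ^ 2)⁻¹ := by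
  have h : (0 : ℝ) ≤ 1 + ‖ξ‖ ^ 2 := by positivity
  rw [besselWeight, ← Real.rpow_natCast, ← Real.rpow_mul h, ← Real.rpow_neg_one]
  norm_num

lemma besselWeight_le_one (ξ : Plane) : besselWeight ξ ≤ 1 := by
  have h : besselWeight ξ ^ 2 ≤ 1 := by
    rw [besselWeight_sq]
    exact inv_le_one_of_one_le₀ (by nlinarith [sq_nonneg ‖ξ‖])
  nlinarith [besselWeight_pos ξ]

lemma hasTemperateGrowth_besselWeight : besselWeight.HasTemperateGrowth :=
  Function.hasTemperateGrowth_one_add_norm_sq_rpow Plane _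

lemma measurable_besselWeight : Measurable besselWeight :=
  hasTemperateGrowth_besselWeight.1.continuous.measurable

lemma lintegral_besselWeight_lt_top :
    ∫⁻ ξ, ENNReal.ofReal (besselWeight ξ) ^ 4 < ⊤ := by
  have h := integrable_rpow_neg_one_add_norm_sq (E := Plane) (μ := volume) (r := 4) (by simp; norm_num)
  have e : ∀ ξ, ENNReal.ofReal (besselWeight ξ) ^ 4
      = ENNReal.ofReal ((1 + ‖ξ‖ ^ 2) ^ (-4 / 2 : ℝ)) := fun ξ => by
    rw [← ENNReal.ofReal_pow (besselWeight_pos ξ).le]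
    congr 1
    rw [besselWeight, ← Real.rpow_natCast, ← Real.rpow_mul (by positivity)]
    norm_num
  simp only [e]
  exact h.lintegral_lt_top

lemma sq_lintegral_mul_le {α : Type*} [MeasurableSpace α] {μ : Measure α} {f g : α → ℝ≥0∞}
    (hf : AEMeasurable f μ) (hg : AEMeasurable g μ) :
    (∫⁻ a, f a * g a ∂μ) ^ 2 ≤ (∫⁻ a, f a ^ 2 ∂μ) * ∫⁻ a, g a ^ 2 ∂μ := by
  have h := ENNReal.lintegral_mul_le_Lp_mul_Lq μ (p := 2) (q := 2)
    (Real.HolderConjugate.two_two) hf hg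
  simp only [Pi.mul_apply, ENNReal.rpow_two] at h
  calc _ ≤ ((∫⁻ a, f a ^ 2 ∂μ) ^ (1 / 2 : ℝ) * (∫⁻ a, g a ^ 2 ∂μ) ^ (1 / 2 : ℝ)) ^ 2 := by
        gcongr
    _ = _ := by
        rw [mul_pow]
        simp only [← ENNReal.rpow_natCast, ← ENNReal.rpow_mul]
        norm_num

/-- Cauchy–Schwarz in η separates the weights r(η)r(ξ-η) from f(η)g(ξ-η). A second Cauchy–Schwarz
bounds the weight integral by ∫ r⁴ uniformly in ξ, and Tonelli treats the rest. -/
lemma lintegral_convolution_sq_le {r f g : Plane → ℝ≥0∞} (hr : Measurable r)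
    (hf : Measurable f) (hg : Measurable g) :
    ∫⁻ ξ, (∫⁻ η, (r η * f η) * (r (ξ - η) * g (ξ - η))) ^ 2 ≤
      (∫⁻ ξ, r ξ ^ 4) * ((∫⁻ ξ, f ξ ^ 2) * ∫⁻ ξ, g ξ ^ 2) := by
  have h1 : ∀ ξ, ∫⁻ η, (r η * r (ξ - η)) ^ 2 ≤ ∫⁻ η, r η ^ 4 := by
    intro ξ
    have h2 := sq_lintegral_mul_le (μ := (volume : Measure Plane)) (f := fun η => r η ^ 2)
      (g := fun η => r (ξ - η) ^ 2) (by fun_prop) (by fun_prop)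
    rw [lintegral_sub_left_eq_self (fun η => (r η ^ 2) ^ 2) ξ, ← sq] at h2
    simp only [mul_pow]
    refine (ENNReal.pow_le_pow_left_iff (n := 2) (by norm_num)).1 (h2.trans_eq ?_)
    simp only [← pow_mul]
  calc _ ≤ ∫⁻ ξ, (∫⁻ η, r η ^ 4) * ∫⁻ η, (f η * g (ξ - η)) ^ 2 := by
        refine lintegral_mono fun ξ => ?_
        calc _ = (∫⁻ η, (r η * r (ξ - η)) * (f η * g (ξ - η))) ^ 2 := by
              congr 1; refine lintegral_congr fun η => by ring
          _ ≤ _ := sq_lintegral_mul_le (by fun_prop) (by fun_prop)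
          _ ≤ _ := mul_le_mul' (h1 ξ) le_rfl
    _ = (∫⁻ η, r η ^ 4) * ∫⁻ ξ, ∫⁻ η, (f η * g (ξ - η)) ^ 2 := by
        rw [lintegral_const_mul]
        have : Measurable fun p : Plane × Plane => (f p.2 * g (p.1 - p.2)) ^ 2 := by fun_prop
        exact this.lintegral_prod_right'
    _ = _ := by
        congr 1
        rw [lintegral_lintegral_swap (by fun_prop)]
        simp only [mul_pow]
        have : ∀ η, ∫⁻ ξ, f η ^ 2 * g (ξ - η) ^ 2 = f η ^ 2 * ∫⁻ ξ, g ξ ^ 2 := fun η => by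
          rw [lintegral_const_mul _ (by fun_prop),
            lintegral_sub_right_eq_self (fun ξ => g ξ ^ 2) η]
        simp only [this]
        rw [lintegral_mul_const _ (by fun_prop)]

lemma eLpNorm_two_sq {α F : Type*} [MeasurableSpace α] {μ : Measure α} [NormedAddCommGroup F]
    (f : α → F) : eLpNorm f 2 μ ^ 2 = ∫⁻ x, ‖f x‖ₑ ^ 2 ∂μ := by
  rw [eLpNorm_eq_lintegral_rpow_enorm_toReal (by norm_num) (by norm_num), ← ENNReal.rpow_natCast,
    ← ENNReal.rpow_mul]
  simp

/-- The Schwartz function `ρ f`, where `ρ` is the Bessel weight. -/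
noncomputable def besselSchwartz (f : 𝓢(Plane, ℂ)) : 𝓢(Plane, ℂ) :=
  SchwartzMap.smulLeftCLM ℂ (fun ξ => (besselWeight ξ : ℂ)) f

lemma besselSchwartz_apply (f : 𝓢(Plane, ℂ)) (ξ : Plane) :
    besselSchwartz f ξ = besselWeight ξ * f ξ := by
  rw [besselSchwartz, SchwartzMap.smulLeftCLM_apply_apply, smul_eq_mul]
  exact Function.HasTemperateGrowth.comp Function.Complex.hasTemperateGrowth_ofReal
    hasTemperateGrowth_besselWeight

lemma eLpNorm_fourier_schwartz (f : 𝓢(Plane, ℂ)) :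
    eLpNorm (𝓕 f : 𝓢(Plane, ℂ)) 2 (volume : Measure Plane) = eLpNorm f 2 (volume : Measure Plane) := by
  have h := SchwartzMap.norm_fourier_toL2_eq f
  rw [SchwartzMap.norm_toLp, SchwartzMap.norm_toLp] at h
  exact (ENNReal.toReal_eq_toReal_iff' (SchwartzMap.memLp _ 2 volume).2.ne
    (SchwartzMap.memLp _ 2 volume).2.ne).1 h

/-- A product of Fourier transforms is the transform of a convolution, so Plancherel reduces the
claim to the convolution estimate. Its constant is finite because ρ⁴ = (1 + |ξ|²)⁻² is integrable on
the plane. -/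
lemma eLpNorm_mul_schwartz_le (f g : 𝓢(Plane, ℂ)) :
    eLpNorm (fun x => 𝓕 (besselSchwartz f) x * 𝓕 (besselSchwartz g) x) 2 volume ^ 2 ≤
      (∫⁻ ξ, ENNReal.ofReal (besselWeight ξ) ^ 4) *
        (eLpNorm f 2 volume ^ 2 * eLpNorm g 2 volume ^ 2) := by
  set a := besselSchwartz f with ha
  set b := besselSchwartz g with hb
  have h1 : (fun x => 𝓕 a x * 𝓕 b x)
      = 𝓕 (SchwartzMap.convolution (ContinuousLinearMap.mul ℂ ℂ) a b) := by
    rw [SchwartzMap.fourier_convolution]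
    rfl
  rw [h1]
  have h2 := eLpNorm_fourier_schwartz (SchwartzMap.convolution (ContinuousLinearMap.mul ℂ ℂ) a b)
  rw [h2, eLpNorm_two_sq, eLpNorm_two_sq, eLpNorm_two_sq]
  refine le_trans (lintegral_mono fun ξ => ?_) (lintegral_convolution_sq_le
    (r := fun ξ => ENNReal.ofReal (besselWeight ξ)) (f := fun ξ => ‖f ξ‖ₑ) (g := fun ξ => ‖g ξ‖ₑ)
    measurable_besselWeight.ennreal_ofReal f.continuous.measurable.enorm
    g.continuous.measurable.enorm)
  gcongr
  rw [SchwartzMap.convolution_apply, convolution_def]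
  refine (enorm_integral_le_lintegral_enorm _).trans (lintegral_mono fun η => ?_)
  simp only [ContinuousLinearMap.mul_apply', enorm_mul, ha, hb, besselSchwartz_apply]
  have e : ∀ η, ‖(besselWeight η : ℂ)‖ₑ = ENNReal.ofReal (besselWeight η) := fun η => by
    rw [← ofReal_norm, Complex.norm_real, Real.norm_of_nonneg (besselWeight_pos η).le]
  rw [e, e]

/-- Multiplication by the Bessel weight. -/
noncomputable def besselSymb (F : Type*) [NormedAddCommGroup F] [InnerProductSpace ℂ F] :
    Symb F F :=
  Symb.scalar F (fun ξ => (besselWeight ξ : ℂ))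
    (Complex.measurable_ofReal.comp measurable_besselWeight)
    ⟨1, fun ξ => by
      rw [Complex.norm_real, Real.norm_of_nonneg (besselWeight_pos ξ).le]
      exact besselWeight_le_one ξ⟩

/-- The map `f ↦ 𝓕 (ρ f)` from `L²` onto `H¹`. -/
noncomputable def besselFourier : L2Space ℂ →L[ℂ] L2Space ℂ :=
  ((Lp.fourierTransformₗᵢ Plane ℂ).toContinuousLinearEquiv : L2Space ℂ →L[ℂ] L2Space ℂ).comp
    (besselSymb ℂ).op

lemma besselFourier_apply (f : L2Space ℂ) : besselFourier f = 𝓕 ((besselSymb ℂ).op f) := rfl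

lemma besselFourier_toLp (f : 𝓢(Plane, ℂ)) :
    besselFourier (f.toLp 2) = (𝓕 (besselSchwartz f)).toLp 2 := by
  rw [besselFourier_apply, ← SchwartzMap.toLp_fourier_eq]
  congr 1
  rw [Symb.op_eq_iff]
  filter_upwards [f.coeFn_toLp 2, (besselSchwartz f).coeFn_toLp 2] with ξ h1 h2
  rw [h1, h2, besselSchwartz_apply]
  simp [besselSymb]

/-- The constant in the product estimate. -/
noncomputable def productConst : ℝ :=
  √(∫⁻ ξ, ENNReal.ofReal (besselWeight ξ) ^ 4).toReal

lemma productConst_nonneg : 0 ≤ productConst := Real.sqrt_nonneg _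

lemma eLpNorm_mul_besselFourier_toLp_le (f g : 𝓢(Plane, ℂ)) :
    eLpNorm (fun x => besselFourier (f.toLp 2) x * besselFourier (g.toLp 2) x) 2 volume ≤
      ENNReal.ofReal (productConst * ‖f.toLp 2 (volume : Measure Plane)‖
        * ‖g.toLp 2 (volume : Measure Plane)‖) := by
  have e : (fun x => besselFourier (f.toLp 2) x * besselFourier (g.toLp 2) x)
      =ᵐ[volume] fun x => 𝓕 (besselSchwartz f) x * 𝓕 (besselSchwartz g) x := by
    rw [besselFourier_toLp, besselFourier_toLp]
    filter_upwards [(𝓕 (besselSchwartz f)).coeFn_toLp 2, (𝓕 (besselSchwartz g)).coeFn_toLp 2]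
      with x h1 h2
    rw [h1, h2]
  rw [eLpNorm_congr_ae e, ← ENNReal.pow_le_pow_left_iff (n := 2) (by norm_num)]
  refine (eLpNorm_mul_schwartz_le f g).trans_eq ?_
  rw [SchwartzMap.norm_toLp, SchwartzMap.norm_toLp, productConst,
    ENNReal.ofReal_mul (by positivity), ENNReal.ofReal_mul (by positivity),
    ENNReal.ofReal_toReal (f.memLp 2 volume).2.ne, ENNReal.ofReal_toReal (g.memLp 2 volume).2.ne, mul_pow,
    mul_pow, ← ENNReal.ofReal_pow (Real.sqrt_nonneg _), Real.sq_sqrt ENNReal.toReal_nonneg,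
    ENNReal.ofReal_toReal lintegral_besselWeight_lt_top.ne, mul_assoc]

/-- Fatou's lemma along a subsequence on which both factors converge almost everywhere; convergence
of the products in L² is not needed. -/
lemma eLpNorm_mul_le_of_tendsto {F G : ℕ → L2Space ℂ} {f g : L2Space ℂ} {c : ℕ → ℝ≥0∞}
    {c₀ : ℝ≥0∞} (hF : Tendsto F atTop (𝓝 f)) (hG : Tendsto G atTop (𝓝 g))
    (hc : Tendsto c atTop (𝓝 c₀)) (h : ∀ n, eLpNorm (fun x => F n x * G n x) 2 volume ≤ c n) :
    eLpNorm (fun x => f x * g x) 2 volume ≤ c₀ := by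
  -- Two successive extractions: the second, for `G`, is taken inside the one for `F`.
  obtain ⟨ns, hns, hF'⟩ := (tendstoInMeasure_of_tendsto_Lp hF).exists_seq_tendsto_ae
  obtain ⟨ms, hms, hG'⟩ := (tendstoInMeasure_of_tendsto_Lp
    (hG.comp hns.tendsto_atTop)).exists_seq_tendsto_ae
  have hN : Tendsto (fun n => ns (ms n)) atTop atTop := hns.tendsto_atTop.comp hms.tendsto_atTop
  have h1 := Lp.eLpNorm_lim_le_liminf_eLpNorm (p := 2) (μ := (volume : Measure Plane))
    (f := fun n x => F (ns (ms n)) x * G (ns (ms n)) x)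
    (fun n => (Lp.memLp _).1.mul (Lp.memLp _).1) (fun x => f x * g x) (by
      filter_upwards [hF', hG'] with x h1 h2
      exact (h1.comp hms.tendsto_atTop).mul h2)
  rw [← (hc.comp hN).liminf_eq]
  exact h1.trans (liminf_le_liminf (Eventually.of_forall fun n => h _))

lemma exists_schwartz_tendsto (f : L2Space ℂ) : ∃ φ : ℕ → 𝓢(Plane, ℂ),
    Tendsto (fun n => ((φ n).toLp 2 : L2Space ℂ)) atTop (𝓝 f) := by
  obtain ⟨x, hx, hlim⟩ := mem_closure_iff_seq_limit.1 (denseRange_schwartz f)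
  choose φ hφ using hx
  exact ⟨φ, hlim.congr fun n => (hφ n).symm⟩

/-- The product estimate `H¹ · H¹ ⊂ L²`. -/
theorem eLpNorm_mul_besselFourier_le (f g : L2Space ℂ) :
    eLpNorm (fun x => besselFourier f x * besselFourier g x) 2 volume ≤
      ENNReal.ofReal (productConst * ‖f‖ * ‖g‖) := by
  obtain ⟨φ, hφ⟩ := exists_schwartz_tendsto f
  obtain ⟨ψ, hψ⟩ := exists_schwartz_tendsto g
  exact eLpNorm_mul_le_of_tendsto ((besselFourier.continuous.tendsto f).comp hφ)
    ((besselFourier.continuous.tendsto g).comp hψ)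
    (ENNReal.tendsto_ofReal ((hφ.norm.const_mul productConst).mul hψ.norm))
    fun n => eLpNorm_mul_besselFourier_toLp_le _ _

end Product

/-! ### The Hamiltonian structure of the system -/

section Products

open scoped RealInnerProductSpace

/-- The product of the real parts of `𝓕 (ρ f)` and `𝓕 (ρ g)`. -/
noncomputable def reMul (f g : L2Space ℂ) (x : Plane) : ℂ :=
  (((besselFourier f x).re * (besselFourier g x).re : ℝ) : ℂ)

lemma norm_reMul_le (f g : L2Space ℂ) (x : Plane) :
    ‖reMul f g x‖ ≤ ‖besselFourier f x * besselFourier g x‖ := by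
  rw [reMul, Complex.norm_real, norm_mul, norm_mul]
  gcongr
  exacts [Complex.abs_re_le_norm _, Complex.abs_re_le_norm _]

lemma memLp_reMul (f g : L2Space ℂ) : MemLp (reMul f g) 2 volume := by
  have hf := (Complex.continuous_re.comp_aestronglyMeasurable (Lp.memLp (besselFourier f)).1)
  have hg := (Complex.continuous_re.comp_aestronglyMeasurable (Lp.memLp (besselFourier g)).1)
  refine ⟨Complex.continuous_ofReal.comp_aestronglyMeasurable (hf.mul hg), ?_⟩
  exact (eLpNorm_mono (norm_reMul_le f g)).trans_lt
    ((eLpNorm_mul_besselFourier_le f g).trans_lt ENNReal.ofReal_lt_top)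

lemma reMul_comm (f g : L2Space ℂ) : reMul f g = reMul g f := by
  funext x; rw [reMul, reMul, mul_comm]

lemma reMul_add_left (f f' g : L2Space ℂ) :
    reMul (f + f') g =ᵐ[volume] fun x => reMul f g x + reMul f' g x := by
  filter_upwards [Lp.coeFn_add (besselFourier f) (besselFourier f')] with x h
  rw [reMul, map_add, h, Pi.add_apply, Complex.add_re, add_mul, Complex.ofReal_add, reMul, reMul]

lemma reMul_smul_left (c : ℝ) (f g : L2Space ℂ) :
    reMul (c • f) g =ᵐ[volume] fun x => (c : ℂ) * reMul f g x := by
  have e : besselFourier (c • f) = c • besselFourier f :=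
    map_smul (besselFourier.restrictScalars ℝ) c f
  filter_upwards [Lp.coeFn_smul c (besselFourier f)] with x h
  rw [reMul, e, h, Pi.smul_apply, Complex.smul_re, smul_eq_mul, mul_assoc, Complex.ofReal_mul,
    reMul]

/-- The product of real parts as an element of `L²`. -/
noncomputable def reProdFun (f g : L2Space ℂ) : L2Space ℂ := (memLp_reMul f g).toLp (reMul f g)

lemma reProdFun_ae (f g : L2Space ℂ) : reProdFun f g =ᵐ[volume] reMul f g :=
  (memLp_reMul f g).coeFn_toLp

lemma reProdFun_comm (f g : L2Space ℂ) : reProdFun f g = reProdFun g f := by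
  rw [reProdFun, reProdFun, MemLp.toLp_eq_toLp_iff, reMul_comm]

lemma reProdFun_add_left (f f' g : L2Space ℂ) :
    reProdFun (f + f') g = reProdFun f g + reProdFun f' g := by
  rw [reProdFun, reProdFun, reProdFun, ← MemLp.toLp_add, MemLp.toLp_eq_toLp_iff]
  exact reMul_add_left f f' g

lemma reProdFun_smul_left (c : ℝ) (f g : L2Space ℂ) :
    reProdFun (c • f) g = c • reProdFun f g := by
  rw [reProdFun, reProdFun, ← MemLp.toLp_const_smul, MemLp.toLp_eq_toLp_iff]
  filter_upwards [reMul_smul_left c f g] with x h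
  rw [h, Pi.smul_apply, Complex.real_smul]

lemma norm_reProdFun_le (f g : L2Space ℂ) : ‖reProdFun f g‖ ≤ productConst * ‖f‖ * ‖g‖ := by
  rw [reProdFun, Lp.norm_toLp]
  refine ENNReal.toReal_le_of_le_ofReal (by have := productConst_nonneg; positivity) ?_
  exact (eLpNorm_mono (norm_reMul_le f g)).trans (eLpNorm_mul_besselFourier_le f g)

/-- The product of real parts as a bounded bilinear map. -/
noncomputable def reProd : L2Space ℂ →L[ℝ] L2Space ℂ →L[ℝ] L2Space ℂ :=
  LinearMap.mkContinuous₂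
    (LinearMap.mk₂ ℝ reProdFun reProdFun_add_left reProdFun_smul_left
      (fun f g g' => by rw [reProdFun_comm, reProdFun_add_left, reProdFun_comm g,
        reProdFun_comm g'])
      (fun c f g => by rw [reProdFun_comm, reProdFun_smul_left, reProdFun_comm g]))
    productConst norm_reProdFun_le

lemma reProd_ae (f g : L2Space ℂ) : reProd f g =ᵐ[volume] reMul f g := reProdFun_ae f g

lemma norm_reProd_le (f g : L2Space ℂ) : ‖reProd f g‖ ≤ productConst * ‖f‖ * ‖g‖ :=
  norm_reProdFun_le f g

lemma reProd_comm (f g : L2Space ℂ) : reProd f g = reProd g f := reProdFun_comm f g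

lemma inner_real_L2_eq (f g : L2Space ℂ) : ⟪f, g⟫ = (inner ℂ f g).re := by
  rw [L2.inner_def, L2.inner_def, ← RCLike.re_eq_complex_re, ← integral_re]
  · rfl
  · exact L2.integrable_inner f g

/-- The symmetric trilinear form `∫ u v w`. -/
noncomputable def triForm (f g h : L2Space ℂ) : ℝ := ⟪besselFourier f, reProd g h⟫

lemma triForm_eq (f g h : L2Space ℂ) : triForm f g h =
    ∫ x, (besselFourier f x).re * ((besselFourier g x).re * (besselFourier h x).re) := by
  rw [triForm, L2.inner_def]
  refine integral_congr_ae ?_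
  filter_upwards [reProd_ae g h] with x hx
  rw [hx, reMul, Complex.inner]
  simp [-Complex.ofReal_mul]
  ring

/-- This is the reason for multiplying real parts: with complex products the real inner product
would conjugate one factor, and the form would not be symmetric. On real functions nothing changes.
-/
lemma triForm_comm_left (f g h : L2Space ℂ) : triForm f g h = triForm g f h := by
  simp only [triForm_eq]
  congr 1; ext x; ring

end Products

/-! ### States in Fourier variables and the symbols of the linear part. -/

section State

open scoped RealInnerProductSpace

/-- The space of values of the state: one component for `ζ` and two for `v`. -/
abbrev StateVal : Type := EuclideanSpace ℂ (Option (Fin 2))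

/-- The space of states. -/
abbrev State : Type := L2Space StateVal

lemma inner_real_State_eq (f g : State) : ⟪f, g⟫ = (inner ℂ f g).re := by
  rw [L2.inner_def, L2.inner_def, ← RCLike.re_eq_complex_re, ← integral_re]
  · refine integral_congr_ae (Eventually.of_forall fun x => ?_)
    simp only [PiLp.inner_apply, map_sum]
    rfl
  · exact L2.integrable_inner f g

lemma Symb.inner_op {F G : Type*} [NormedAddCommGroup F] [InnerProductSpace ℂ F]
    [NormedAddCommGroup G] [InnerProductSpace ℂ G] (A : Symb F G) (B : Symb G F)
    (h : ∀ ξ x y, inner ℂ (A ξ x) y = inner ℂ x (B ξ y)) (f : L2Space F) (g : L2Space G) :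
    inner ℂ (A.op f) g = inner ℂ f (B.op g) := by
  rw [L2.inner_def, L2.inner_def]
  refine integral_congr_ae ?_
  filter_upwards [A.op_ae f, B.op_ae g] with x h1 h2
  rw [h1, h2, h]

/-- The projection to the `i`-th component. -/
noncomputable def projC (i : Option (Fin 2)) : StateVal →L[ℂ] ℂ := EuclideanSpace.proj i

/-- The inclusion of the `i`-th component. -/
noncomputable def injC (i : Option (Fin 2)) : ℂ →L[ℂ] StateVal :=
  (ContinuousLinearMap.id ℂ ℂ).smulRight (EuclideanSpace.single i (1 : ℂ))

lemma projC_apply (i : Option (Fin 2)) (z : StateVal) : projC i z = z i := rfl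

lemma injC_apply (i j : Option (Fin 2)) (a : ℂ) : injC i a j = if j = i then a else 0 := by
  simp [injC]

lemma norm_projC_le (i : Option (Fin 2)) : ‖projC i‖ ≤ 1 :=
  ContinuousLinearMap.opNorm_le_bound _ zero_le_one fun z => by
    rw [one_mul]; exact PiLp.norm_apply_le z i

lemma norm_injC_le (i : Option (Fin 2)) : ‖injC i‖ ≤ 1 :=
  ContinuousLinearMap.opNorm_le_bound _ zero_le_one fun a => by
    simp [injC, norm_smul]

lemma inner_projC (i : Option (Fin 2)) (z : StateVal) (a : ℂ) :
    inner ℂ (projC i z) a = inner ℂ z (injC i a) := by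
  simp [projC_apply, PiLp.inner_apply, injC_apply, apply_ite]

/-- Multiplication by `m` followed by a fixed operator. -/
noncomputable def Symb.smul {F G : Type*} [NormedAddCommGroup F] [InnerProductSpace ℂ F]
    [NormedAddCommGroup G] [InnerProductSpace ℂ G] (m : Plane → ℝ) (hm : Measurable m)
    (hb : ∃ C, ∀ ξ, |m ξ| ≤ C) (T : F →L[ℂ] G) : Symb F G where
  toFun ξ := (m ξ : ℂ) • T
  meas := (Complex.measurable_ofReal.comp hm).stronglyMeasurable.smul_const T
  bdd := by
    obtain ⟨C, hC⟩ := hb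
    refine ⟨C * ‖T‖, fun ξ => ?_⟩
    rw [norm_smul, Complex.norm_real, Real.norm_eq_abs]
    gcongr
    exact hC ξ

/-- The operator coupling the component `ζ` and the component `v_j`. -/
noncomputable def swapC (j : Fin 2) : StateVal →L[ℂ] StateVal :=
  (injC none).comp (projC (some j)) + (injC (some j)).comp (projC none)

lemma inner_swapC (j : Fin 2) (x y : StateVal) :
    inner ℂ (swapC j x) y = inner ℂ x (swapC j y) := by
  simp [swapC, PiLp.inner_apply, injC_apply, projC_apply, apply_ite, add_comm]

lemma swapC_none (j : Fin 2) (z : StateVal) : swapC j z none = z (some j) := by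
  simp [swapC, injC_apply, projC_apply]

lemma swapC_some (j i : Fin 2) (z : StateVal) :
    swapC j z (some i) = if i = j then z none else 0 := by
  simp [swapC, injC_apply, projC_apply]

/-- The symbols of the system for `ε = μ = 1`: `al` and `be` are those of the quadratic part of the
Hamiltonian, `J` is the symbol of `1 - bΔ`. All of them are comparable with `1 + |ξ|²`. -/
structure Weights where
  γ : ℝ
  γ_pos : 0 < γ
  al : Plane → ℝ
  be : Plane → ℝ
  J : Plane → ℝ
  measurable_al : Measurable al
  measurable_be : Measurable be
  measurable_J : Measurable J
  -- The bounds are carried as data, so that constants depending only on them and on γ are uniform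
  -- in μ₂.
  lo : ℝ
  hi : ℝ
  lo_pos : 0 < lo
  al_mem : ∀ ξ, al ξ ∈ Icc (lo * (1 + ‖ξ‖ ^ 2)) (hi * (1 + ‖ξ‖ ^ 2))
  be_mem : ∀ ξ, be ξ ∈ Icc (lo * (1 + ‖ξ‖ ^ 2)) (hi * (1 + ‖ξ‖ ^ 2))
  J_mem : ∀ ξ, J ξ ∈ Icc (lo * (1 + ‖ξ‖ ^ 2)) (hi * (1 + ‖ξ‖ ^ 2))
  even_al : ∀ ξ, al (-ξ) = al ξ
  even_be : ∀ ξ, be (-ξ) = be ξ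
  even_J : ∀ ξ, J (-ξ) = J ξ

namespace Weights

variable (P : Weights)

/-- The quadratic weight of the component `i`. -/
noncomputable def wt (i : Option (Fin 2)) : Plane → ℝ := i.elim P.al fun _ => P.be

lemma measurable_wt (i : Option (Fin 2)) : Measurable (P.wt i) := by
  cases i
  exacts [P.measurable_al, P.measurable_be]

lemma wt_mem (i : Option (Fin 2)) (ξ : Plane) :
    P.wt i ξ ∈ Icc (P.lo * (1 + ‖ξ‖ ^ 2)) (P.hi * (1 + ‖ξ‖ ^ 2)) := by
  cases i
  exacts [P.al_mem ξ, P.be_mem ξ]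

lemma wt_pos (i : Option (Fin 2)) (ξ : Plane) : 0 < P.wt i ξ :=
  lt_of_lt_of_le (mul_pos P.lo_pos (by positivity)) (P.wt_mem i ξ).1

lemma J_pos (ξ : Plane) : 0 < P.J ξ :=
  lt_of_lt_of_le (mul_pos P.lo_pos (by positivity)) (P.J_mem ξ).1

lemma hi_pos : 0 < P.hi := by
  have h := (P.al_mem 0).1.trans (P.al_mem 0).2
  have := P.lo_pos
  simp at h
  linarith

/-- The symbol `ρ √wt`. -/
noncomputable def fwd (i : Option (Fin 2)) (ξ : Plane) : ℝ := besselWeight ξ * √(P.wt i ξ)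

lemma fwd_pos (i : Option (Fin 2)) (ξ : Plane) : 0 < P.fwd i ξ :=
  mul_pos (besselWeight_pos ξ) (Real.sqrt_pos.2 (P.wt_pos i ξ))

/-- Two-sided bounds make the passage between energy coordinates and coordinates adapted to the H¹
norm bounded in both directions. -/
lemma fwd_sq_mem (i : Option (Fin 2)) (ξ : Plane) : P.fwd i ξ ^ 2 ∈ Icc P.lo P.hi := by
  rw [fwd, mul_pow, Real.sq_sqrt (P.wt_pos i ξ).le, besselWeight_sq]
  have h := P.wt_mem i ξ
  have h0 : (0 : ℝ) < 1 + ‖ξ‖ ^ 2 := by positivity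
  constructor
  · rw [le_inv_mul_iff₀ h0, mul_comm]; exact h.1
  · rw [inv_mul_le_iff₀ h0, mul_comm]; exact h.2

lemma fwd_le (i : Option (Fin 2)) (ξ : Plane) : P.fwd i ξ ≤ √P.hi :=
  Real.le_sqrt_of_sq_le (P.fwd_sq_mem i ξ).2

lemma inv_fwd_le (i : Option (Fin 2)) (ξ : Plane) : (P.fwd i ξ)⁻¹ ≤ (√P.lo)⁻¹ :=
  inv_anti₀ (Real.sqrt_pos.2 P.lo_pos)
    ((Real.sqrt_le_left (P.fwd_pos i ξ).le).2 (P.fwd_sq_mem i ξ).1)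

lemma measurable_fwd (i : Option (Fin 2)) : Measurable (P.fwd i) :=
  measurable_besselWeight.mul (P.measurable_wt i).sqrt

/-- From the state to the components in `L²`. -/
noncomputable def qSymb (i : Option (Fin 2)) : Symb StateVal ℂ :=
  Symb.smul (fun ξ => (P.fwd i ξ)⁻¹) (P.measurable_fwd i).inv
    ⟨(√P.lo)⁻¹, fun ξ => by
      rw [abs_of_pos (inv_pos.2 (P.fwd_pos i ξ))]; exact P.inv_fwd_le i ξ⟩ (projC i)

/-- The adjoint of `qSymb`. -/
noncomputable def qAdj (i : Option (Fin 2)) : Symb ℂ StateVal :=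
  Symb.smul (fun ξ => (P.fwd i ξ)⁻¹) (P.measurable_fwd i).inv
    ⟨(√P.lo)⁻¹, fun ξ => by
      rw [abs_of_pos (inv_pos.2 (P.fwd_pos i ξ))]; exact P.inv_fwd_le i ξ⟩ (injC i)

/-- From the components in `L²` to the state. -/
noncomputable def pSymb (i : Option (Fin 2)) : Symb ℂ StateVal :=
  Symb.smul (P.fwd i) (P.measurable_fwd i)
    ⟨√P.hi, fun ξ => by
      rw [abs_of_pos (P.fwd_pos i ξ)]; exact P.fwd_le i ξ⟩ (injC i)

lemma qSymb_apply (i : Option (Fin 2)) (ξ : Plane) (z : StateVal) :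
    P.qSymb i ξ z = (P.fwd i ξ : ℂ)⁻¹ * z i := by
  simp [qSymb, Symb.smul, projC_apply]

lemma qAdj_apply (i : Option (Fin 2)) (ξ : Plane) (a : ℂ) :
    P.qAdj i ξ a = (P.fwd i ξ : ℂ)⁻¹ • injC i a := by
  simp [qAdj, Symb.smul]

lemma pSymb_apply (i : Option (Fin 2)) (ξ : Plane) (a : ℂ) :
    P.pSymb i ξ a = (P.fwd i ξ : ℂ) • injC i a := by
  simp [pSymb, Symb.smul]

lemma norm_qSymb_le (i : Option (Fin 2)) (f : State) : ‖(P.qSymb i).op f‖ ≤ (√P.lo)⁻¹ * ‖f‖ := by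
  refine Symb.op_norm_le _ (fun ξ => ?_) f
  change ‖(((P.fwd i ξ)⁻¹ : ℝ) : ℂ) • projC i‖ ≤ _
  rw [norm_smul, Complex.norm_real, Real.norm_of_nonneg (inv_nonneg.2 (P.fwd_pos i ξ).le)]
  have := P.inv_fwd_le i ξ
  calc _ ≤ (√P.lo)⁻¹ * 1 := by gcongr; exact norm_projC_le i
    _ = _ := mul_one _

lemma norm_qAdj_le (i : Option (Fin 2)) (f : L2Space ℂ) :
    ‖(P.qAdj i).op f‖ ≤ (√P.lo)⁻¹ * ‖f‖ := by
  refine Symb.op_norm_le _ (fun ξ => ?_) f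
  change ‖(((P.fwd i ξ)⁻¹ : ℝ) : ℂ) • injC i‖ ≤ _
  rw [norm_smul, Complex.norm_real, Real.norm_of_nonneg (inv_nonneg.2 (P.fwd_pos i ξ).le)]
  have := P.inv_fwd_le i ξ
  calc _ ≤ (√P.lo)⁻¹ * 1 := by gcongr; exact norm_injC_le i
    _ = _ := mul_one _

lemma norm_pSymb_le (i : Option (Fin 2)) (f : L2Space ℂ) :
    ‖(P.pSymb i).op f‖ ≤ √P.hi * ‖f‖ := by
  refine Symb.op_norm_le _ (fun ξ => ?_) f
  change ‖((P.fwd i ξ : ℝ) : ℂ) • injC i‖ ≤ _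
  rw [norm_smul, Complex.norm_real, Real.norm_of_nonneg (P.fwd_pos i ξ).le]
  have := P.fwd_le i ξ
  calc _ ≤ √P.hi * 1 := by gcongr; exact norm_injC_le i
    _ = _ := mul_one _

lemma inner_qSymb (i : Option (Fin 2)) (f : State) (g : L2Space ℂ) :
    ⟪f, (P.qAdj i).op g⟫ = ⟪(P.qSymb i).op f, g⟫ := by
  rw [inner_real_State_eq, inner_real_L2_eq, Symb.inner_op _ (P.qAdj i)]
  intro ξ x y
  rw [qAdj_apply, inner_smul_right, ← inner_projC, qSymb_apply, projC_apply]
  rw [← smul_eq_mul, inner_smul_left, ← Complex.ofReal_inv, Complex.conj_ofReal]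

lemma qSymb_besselSymb (i : Option (Fin 2)) (f : State) :
    (P.qSymb i).op ((besselSymb StateVal).op f) = (besselSymb ℂ).op ((P.qSymb i).op f) := by
  refine Symb.op_comm _ _ _ _ (fun ξ x => ?_) f
  simp only [qSymb_apply, besselSymb, Symb.scalar_apply, PiLp.smul_apply, smul_eq_mul]
  ring

/-- The coefficient of the coupling between `ζ` and `v_j`. -/
noncomputable def coef (j : Fin 2) (ξ : Plane) : ℝ :=
  2 * Real.pi * ξ j * (√(P.al ξ) * √(P.be ξ) / P.J ξ)

lemma measurable_coef (j : Fin 2) : Measurable (P.coef j) := by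
  have h : Measurable fun ξ : Plane => ξ j := (EuclideanSpace.proj (𝕜 := ℝ) j).continuous.measurable
  exact (h.const_mul _).mul ((P.measurable_al.sqrt.mul P.measurable_be.sqrt).div P.measurable_J)

/-- Since √al √be / J is bounded, the coupling has order one, and ρ absorbs exactly the factor ξ_j.
This is the boundedness of K = A R. -/
lemma abs_coef_mul_besselWeight_le (j : Fin 2) (ξ : Plane) :
    |P.coef j ξ * besselWeight ξ| ≤ 2 * Real.pi * (P.hi / P.lo) := by
  have h1 : |ξ j * besselWeight ξ| ≤ 1 := by
    rw [← sq_le_one_iff_abs_le_one, mul_pow, besselWeight_sq, ← div_eq_mul_inv,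
      div_le_one (by positivity)]
    have := PiLp.norm_apply_le ξ j
    have h2 : ‖ξ j‖ ^ 2 ≤ ‖ξ‖ ^ 2 := by gcongr
    rw [Real.norm_eq_abs, sq_abs] at h2
    linarith
  have h2 : |√(P.al ξ) * √(P.be ξ) / P.J ξ| ≤ P.hi / P.lo := by
    have h0 : (0 : ℝ) < 1 + ‖ξ‖ ^ 2 := by positivity
    rw [abs_of_nonneg (div_nonneg (by positivity) (P.J_pos ξ).le),
      ← Real.sqrt_mul (show 0 ≤ P.al ξ from (P.wt_pos none ξ).le)]
    have ha := (P.al_mem ξ).2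
    have hb := (P.be_mem ξ).2
    have hb0 : 0 ≤ P.be ξ := (P.wt_pos (some 0) ξ).le
    have hJ := (P.J_mem ξ).1
    have hhi := P.hi_pos
    have hlo := P.lo_pos
    have h3 : √(P.al ξ * P.be ξ) ≤ P.hi * (1 + ‖ξ‖ ^ 2) := by
      rw [Real.sqrt_le_left (by positivity), sq]
      gcongr
    calc _ ≤ P.hi * (1 + ‖ξ‖ ^ 2) / (P.lo * (1 + ‖ξ‖ ^ 2)) := by gcongr
      _ = _ := by field_simp
  have e : P.coef j ξ * besselWeight ξ = 2 * Real.pi * ((ξ j * besselWeight ξ) *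
      (√(P.al ξ) * √(P.be ξ) / P.J ξ)) := by rw [coef]; ring
  rw [e, abs_mul (2 * Real.pi), abs_of_pos Real.two_pi_pos, abs_mul (ξ j * besselWeight ξ)]
  have : 0 ≤ P.hi / P.lo := (abs_nonneg _).trans h2
  calc _ ≤ 2 * Real.pi * (1 * (P.hi / P.lo)) := by gcongr
    _ = _ := by ring

/-- The symbol of the linear part. -/
noncomputable def linSymb : SkewSymb StateVal where
  toFun ξ := ∑ j, (Complex.I * P.coef j ξ) • swapC j
  meas := by
    refine Finset.stronglyMeasurable_fun_sum _ fun j _ => ?_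
    exact ((Complex.measurable_ofReal.comp (P.measurable_coef j)).const_mul
      Complex.I).stronglyMeasurable.smul_const _
  skew ξ x y := by
    simp [inner_swapC]
    ring

/-- The symbol `A R`, where `A` is the linear part and `R` the multiplication by `ρ`. -/
noncomputable def kSymb : Symb StateVal StateVal where
  toFun ξ := ∑ j, (Complex.I * (P.coef j ξ * besselWeight ξ : ℝ)) • swapC j
  meas := by
    refine Finset.stronglyMeasurable_fun_sum _ fun j _ => ?_
    exact ((Complex.measurable_ofReal.comp ((P.measurable_coef j).mul
      measurable_besselWeight)).const_mul Complex.I).stronglyMeasurable.smul_const _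
  bdd := by
    refine ⟨∑ j, 2 * Real.pi * (P.hi / P.lo) * ‖swapC j‖, fun ξ => ?_⟩
    refine (norm_sum_le _ _).trans (Finset.sum_le_sum fun j _ => ?_)
    rw [norm_smul, norm_mul, Complex.norm_I, one_mul, Complex.norm_real, Real.norm_eq_abs]
    gcongr
    exact P.abs_coef_mul_besselWeight_le j ξ

end Weights
end State

/-! ### The cubic part of the Hamiltonian and the resulting Hamiltonian data. -/

section Hamiltonian

open scoped RealInnerProductSpace

lemma inner_real_fourier_left (f g : L2Space ℂ) : ⟪𝓕 f, g⟫ = ⟪f, 𝓕⁻ g⟫ := by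
  rw [inner_real_L2_eq, inner_real_L2_eq]
  exact congrArg Complex.re ((Lp.fourierTransformₗᵢ Plane ℂ).inner_map_eq_flip f g)

/-- The inverse Fourier transform on `L²` as a real continuous linear map. -/
noncomputable def fourierInvCLM : L2Space ℂ →L[ℝ] L2Space ℂ :=
  ((Lp.fourierTransformₗᵢ Plane ℂ).symm.toContinuousLinearEquiv :
    L2Space ℂ →L[ℂ] L2Space ℂ).restrictScalars ℝ

namespace Weights

variable (P : Weights)

/-- The elementary quadratic interactions. -/
noncomputable def interaction (i j k : Option (Fin 2)) : State →L[ℝ] State →L[ℝ] State :=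
  (ContinuousLinearMap.compL ℝ State (L2Space ℂ) State
    (((P.qAdj i).op.restrictScalars ℝ).comp fourierInvCLM)).comp
    (reProd.bilinearComp ((P.qSymb j).op.restrictScalars ℝ) ((P.qSymb k).op.restrictScalars ℝ))

lemma interaction_apply (i j k : Option (Fin 2)) (Y Z : State) :
    P.interaction i j k Y Z
      = (P.qAdj i).op (𝓕⁻ (reProd ((P.qSymb j).op Y) ((P.qSymb k).op Z))) := rfl

lemma interaction_comm (i j k : Option (Fin 2)) (Y Z : State) :
    P.interaction i j k Y Z = P.interaction i k j Z Y := by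
  rw [interaction_apply, interaction_apply, reProd_comm]

lemma norm_interaction_le (i j k : Option (Fin 2)) (Y Z : State) :
    ‖P.interaction i j k Y Z‖ ≤ (√P.lo)⁻¹ ^ 3 * productConst * (‖Y‖ * ‖Z‖) := by
  have h1 := P.norm_qAdj_le i (𝓕⁻ (reProd ((P.qSymb j).op Y) ((P.qSymb k).op Z)))
  rw [norm_fourierInvL2] at h1
  have h2 := norm_reProd_le ((P.qSymb j).op Y) ((P.qSymb k).op Z)
  have hp := productConst_nonneg
  calc _ ≤ (√P.lo)⁻¹ * ‖reProd ((P.qSymb j).op Y) ((P.qSymb k).op Z)‖ := h1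
    _ ≤ (√P.lo)⁻¹ * (productConst * ((√P.lo)⁻¹ * ‖Y‖) * ((√P.lo)⁻¹ * ‖Z‖)) := by
        gcongr
        refine h2.trans ?_
        gcongr
        exacts [P.norm_qSymb_le j Y, P.norm_qSymb_le k Z]
    _ = _ := by ring

/-- An interaction preceded by `R` is the adjoint of the map from states to functions, applied to a
product. Pairing it with a state therefore gives the integral of three functions, which makes the
symmetry of the nonlinearity visible. -/
lemma inner_besselSymb_interaction (i j k : Option (Fin 2)) (X Y Z : State) :
    ⟪(besselSymb StateVal).op X, P.interaction i j k Y Z⟫ =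
      triForm ((P.qSymb i).op X) ((P.qSymb j).op Y) ((P.qSymb k).op Z) := by
  rw [interaction_apply, inner_qSymb, qSymb_besselSymb, ← inner_real_fourier_left, triForm,
    besselFourier_apply]

/-- The quadratic nonlinearity. -/
noncomputable def quad : State →L[ℝ] State →L[ℝ] State :=
  -- The three terms are the polarized derivatives of ∫ ζ v_j² in its three slots, so that ⟪R x, G x
  -- x⟫ / 3 is -(1/2γ) ∫ ζ|v|² for real functions.
  (-(1 / (2 * P.γ))) • ∑ j : Fin 2, (P.interaction none (some j) (some j) +
    P.interaction (some j) none (some j) + P.interaction (some j) (some j) none)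

lemma quad_apply (Y Z : State) : P.quad Y Z = (-(1 / (2 * P.γ))) • ∑ j : Fin 2,
    (P.interaction none (some j) (some j) Y Z +
    P.interaction (some j) none (some j) Y Z + P.interaction (some j) (some j) none Y Z) := by
  simp [quad]

lemma inner_besselSymb_quad (X Y Z : State) :
    ⟪(besselSymb StateVal).op X, P.quad Y Z⟫ = (-(1 / (2 * P.γ))) * ∑ j : Fin 2,
      (⟪(besselSymb StateVal).op X, P.interaction none (some j) (some j) Y Z⟫ +
      ⟪(besselSymb StateVal).op X, P.interaction (some j) none (some j) Y Z⟫ +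
      ⟪(besselSymb StateVal).op X, P.interaction (some j) (some j) none Y Z⟫) := by
  rw [quad_apply, inner_smul_right_eq_smul, smul_eq_mul, inner_sum]
  simp only [inner_add_right]

lemma quad_comm (Y Z : State) : P.quad Y Z = P.quad Z Y := by
  have h (j : Fin 2) : P.interaction none (some j) (some j) Y Z +
      P.interaction (some j) none (some j) Y Z + P.interaction (some j) (some j) none Y Z =
      P.interaction none (some j) (some j) Z Y +
      P.interaction (some j) none (some j) Z Y + P.interaction (some j) (some j) none Z Y := by
    rw [P.interaction_comm none (some j) (some j) Y, P.interaction_comm (some j) none (some j) Y,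
      P.interaction_comm (some j) (some j) none Y, add_right_comm]
  rw [quad_apply, quad_apply, Finset.sum_congr rfl fun j _ => h j]

/-- Exchanging X and Y permutes the three interactions among themselves, by the symmetry of
`triForm`. -/
lemma inner_besselSymb_quad_comm (X Y Z : State) :
    ⟪(besselSymb StateVal).op X, P.quad Y Z⟫ = ⟪(besselSymb StateVal).op Y, P.quad X Z⟫ := by
  simp only [inner_besselSymb_quad, inner_besselSymb_interaction]
  congr 1
  refine Finset.sum_congr rfl fun j _ => ?_
  rw [triForm_comm_left ((P.qSymb none).op Y),
    triForm_comm_left ((P.qSymb (some j)).op Y) ((P.qSymb none).op X),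
    triForm_comm_left ((P.qSymb (some j)).op Y) ((P.qSymb (some j)).op X)]
  ring

/-- A bound for the norm of the nonlinearity. -/
noncomputable def quadBound (γ lo : ℝ) : ℝ := 3 / γ * ((√lo)⁻¹ ^ 3 * (productConst + 1))

lemma quadBound_pos {γ lo : ℝ} (hγ : 0 < γ) (hlo : 0 < lo) : 0 < quadBound γ lo := by
  have := productConst_nonneg
  have := Real.sqrt_pos.2 hlo
  unfold quadBound
  positivity

lemma norm_quad_le (Y Z : State) : ‖P.quad Y Z‖ ≤ quadBound P.γ P.lo * ‖Y‖ * ‖Z‖ := by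
  have hγ := P.γ_pos
  have h : ∀ i j k, ‖P.interaction i j k Y Z‖ ≤
      (√P.lo)⁻¹ ^ 3 * (productConst + 1) * (‖Y‖ * ‖Z‖) := fun i j k =>
    (P.norm_interaction_le i j k Y Z).trans (by gcongr; linarith)
  rw [quad_apply, norm_smul, norm_neg, Real.norm_of_nonneg (by positivity)]
  have h2 : ‖∑ j : Fin 2, (P.interaction none (some j) (some j) Y Z +
    P.interaction (some j) none (some j) Y Z + P.interaction (some j) (some j) none Y Z)‖ ≤
      ∑ _j : Fin 2, 3 * ((√P.lo)⁻¹ ^ 3 * (productConst + 1) * (‖Y‖ * ‖Z‖)) := by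
    refine norm_sum_le_of_le _ fun j _ => ?_
    refine norm_add₃_le.trans ?_
    linarith [h none (some j) (some j), h (some j) none (some j), h (some j) (some j) none]
  calc _ ≤ 1 / (2 * P.γ) *
        ∑ _j : Fin 2, 3 * ((√P.lo)⁻¹ ^ 3 * (productConst + 1) * (‖Y‖ * ‖Z‖)) := by gcongr
    _ = _ := by
        simp only [Finset.sum_const, Finset.card_univ, Fintype.card_fin, quadBound]
        field_simp
        norm_num
        ring

lemma linSymb_apply (ξ : Plane) (z : StateVal) :
    P.linSymb.toFun ξ z = ∑ j, (Complex.I * P.coef j ξ) • swapC j z := by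
  simp [linSymb]

lemma kSymb_apply (ξ : Plane) (z : StateVal) :
    P.kSymb ξ z = ∑ j, (Complex.I * (P.coef j ξ * besselWeight ξ : ℝ)) • swapC j z := by
  simp [kSymb]

lemma besselSymb_apply {F : Type*} [NormedAddCommGroup F] [InnerProductSpace ℂ F] (ξ : Plane)
    (z : F) : besselSymb F ξ z = (besselWeight ξ : ℂ) • z := by
  simp [besselSymb]

lemma kSymb_eq (ξ : Plane) : P.kSymb ξ = (besselWeight ξ : ℂ) • P.linSymb.toFun ξ := by
  ext1 z
  rw [kSymb_apply, smul_apply, linSymb_apply, Finset.smul_sum]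
  refine Finset.sum_congr rfl fun j _ => ?_
  rw [smul_smul]
  congr 1
  push_cast
  ring

lemma besselSymb_op_injective (F : Type*) [NormedAddCommGroup F] [InnerProductSpace ℂ F] :
    Function.Injective (besselSymb F).op := by
  intro f g h
  rw [Lp.ext_iff]
  filter_upwards [(besselSymb F).op_ae f, (besselSymb F).op_ae g] with ξ h1 h2
  rw [h, h2, besselSymb_apply, besselSymb_apply] at h1
  exact (smul_right_injective F (Complex.ofReal_ne_zero.2 (besselWeight_pos ξ).ne') h1).symm

lemma norm_besselSymb_op_le {F : Type*} [NormedAddCommGroup F] [InnerProductSpace ℂ F]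
    (f : L2Space F) : ‖(besselSymb F).op f‖ ≤ ‖f‖ := by
  refine (Symb.op_norm_le _ (C := 1) (fun ξ => ?_) f).trans_eq (one_mul _)
  refine ContinuousLinearMap.opNorm_le_bound _ zero_le_one fun z => ?_
  rw [besselSymb_apply, norm_smul, Complex.norm_real, Real.norm_of_nonneg (besselWeight_pos ξ).le]
  gcongr
  exact besselWeight_le_one ξ

/-- The system as a Hamiltonian equation. -/
noncomputable def hamiltonian : HamiltonianData State where
  S t := (P.linSymb.expSymb t).op.restrictScalars ℝ
  R := (besselSymb StateVal).op.restrictScalars ℝ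
  K := P.kSymb.op.restrictScalars ℝ
  G := P.quad
  S_zero := P.linSymb.expSymb_zero
  S_add := P.linSymb.expSymb_add
  norm_S := P.linSymb.norm_expSymb_op
  continuous_S := P.linSymb.continuous_expSymb_op
  hasDerivAt_S f := P.linSymb.hasDerivAt_expSymb_op _ _ (fun ξ z => by
    rw [besselSymb_apply, kSymb_eq, map_smul]; rfl) f
  S_R t f := Symb.op_comm _ _ _ _ (fun ξ z => by
    rw [besselSymb_apply, besselSymb_apply, map_smul]) f
  S_K t f := Symb.op_comm _ _ _ _ (fun ξ z => by
    rw [P.linSymb.expSymb_apply, P.linSymb.expSymb_apply]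
    refine P.linSymb.exp_apply_comm t ξ ?_ z
    rw [kSymb_eq]
    exact (Commute.refl _).smul_left _) f
  R_K f := Symb.op_comm _ _ _ _ (fun ξ z => by
    rw [besselSymb_apply, besselSymb_apply, map_smul]) f
  R_injective := besselSymb_op_injective StateVal
  R_symm f g := by
    change ⟪(besselSymb StateVal).op f, g⟫ = ⟪f, (besselSymb StateVal).op g⟫
    rw [inner_real_State_eq, inner_real_State_eq, Symb.inner_op _ (besselSymb StateVal)]
    intro ξ x y
    rw [besselSymb_apply, besselSymb_apply, inner_smul_left, inner_smul_right,
      Complex.conj_ofReal]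
  K_skew f g := by
    change ⟪P.kSymb.op f, g⟫ = -⟪f, P.kSymb.op g⟫
    rw [inner_real_State_eq, inner_real_State_eq, L2.inner_def, L2.inner_def, ← Complex.neg_re,
      ← integral_neg]
    congr 1
    refine integral_congr_ae ?_
    filter_upwards [P.kSymb.op_ae f, P.kSymb.op_ae g] with ξ h1 h2
    rw [h1, h2, kSymb_eq]
    simp only [smul_apply, inner_smul_left, inner_smul_right,
      P.linSymb.skew, Complex.conj_ofReal, mul_neg]
  G_comm := P.quad_comm
  R_G_symm := P.inner_besselSymb_quad_comm

end Weights
end Hamiltonian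

/-! ### Reflection, conjugation and the Fourier transform on L². -/

section Reflection

lemma ae_comp_neg {p : Plane → Prop} (h : ∀ᵐ x, p x) : ∀ᵐ x, p (-x) :=
  (Measure.measurePreserving_neg (volume : Measure Plane)).quasiMeasurePreserving.ae h

/-- Reflection composed with a real-linear operator on values. -/
noncomputable def reflect {F : Type*} [NormedAddCommGroup F] [InnerProductSpace ℂ F]
    (c : F →L[ℝ] F) : L2Space F →L[ℝ] L2Space F :=
  (c.compLpL 2 volume).comp
    (Lp.compMeasurePreservingₗᵢ ℝ _ (Measure.measurePreserving_neg
      (volume : Measure Plane))).toContinuousLinearMap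

lemma reflect_ae {F : Type*} [NormedAddCommGroup F] [InnerProductSpace ℂ F]
    (c : F →L[ℝ] F) (f : L2Space F) : reflect c f =ᵐ[volume] fun ξ => c (f (-ξ)) := by
  have h1 := c.coeFn_compLpL (p := 2) (μ := (volume : Measure Plane))
    (Lp.compMeasurePreserving _ (Measure.measurePreserving_neg (volume : Measure Plane)) f)
  have h2 := Lp.coeFn_compMeasurePreserving f
    (Measure.measurePreserving_neg (volume : Measure Plane))
  filter_upwards [h1, h2] with ξ h1 h2
  refine h1.trans ?_
  rw [h2]
  rfl

lemma fourierInv_eq_reflect (f : L2Space ℂ) :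
    𝓕⁻ f = reflect (ContinuousLinearMap.id ℝ ℂ) (𝓕 f) := by
  refine congrFun (denseRange_schwartz.equalizer continuous_fourierInvL2
    ((reflect _).continuous.comp continuous_fourierL2) ?_) f
  funext φ
  simp only [Function.comp_apply]
  rw [SchwartzMap.toLp_fourier_eq, SchwartzMap.toLp_fourierInv_eq, Lp.ext_iff]
  have h := ae_comp_neg ((𝓕 φ).coeFn_toLp 2 volume)
  filter_upwards [(𝓕⁻ φ).coeFn_toLp 2, reflect_ae (ContinuousLinearMap.id ℝ ℂ) ((𝓕 φ).toLp 2), h]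
    with x h1 h2 h3
  rw [h1, h2, ContinuousLinearMap.id_apply, h3, SchwartzMap.fourierInv_coe,
    Real.fourierInv_eq_fourier_neg, SchwartzMap.fourier_coe]

/-- Pointwise conjugation in `L²`. -/
noncomputable def conjL2 : L2Space ℂ →L[ℝ] L2Space ℂ :=
  (Complex.conjCLE : ℂ →L[ℝ] ℂ).compLpL 2 volume

lemma conjL2_ae (f : L2Space ℂ) : conjL2 f =ᵐ[volume] fun x => starRingEnd ℂ (f x) :=
  (Complex.conjCLE : ℂ →L[ℝ] ℂ).coeFn_compLpL f

/-- The map `f ↦ conj (f (-·))`. -/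
noncomputable def sharp : L2Space ℂ →L[ℝ] L2Space ℂ := reflect (Complex.conjCLE : ℂ →L[ℝ] ℂ)

lemma sharp_ae (f : L2Space ℂ) : sharp f =ᵐ[volume] fun x => starRingEnd ℂ (f (-x)) :=
  reflect_ae _ f

/-- Real functions are thereby characterized on the Fourier side as the fixed points of `sharp`.
Density reduces the claim to Schwartz functions, where it is conjugation under the integral. -/
lemma fourierInv_conjL2 (f : L2Space ℂ) : 𝓕⁻ (conjL2 f) = sharp (𝓕⁻ f) := by
  refine congrFun (denseRange_schwartz.equalizer (continuous_fourierInvL2.comp conjL2.continuous)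
    (sharp.continuous.comp continuous_fourierInvL2) ?_) f
  funext φ
  simp only [Function.comp_apply]
  have hi : Integrable (fun x => starRingEnd ℂ (φ x)) volume :=
    (Complex.conjCLE : ℂ →L[ℝ] ℂ).integrable_comp φ.integrable
  have h2 : MemLp (fun x => starRingEnd ℂ (φ x)) 2 volume :=
    (Complex.conjCLE : ℂ →L[ℝ] ℂ).comp_memLp' (φ.memLp 2 volume)
  have e : conjL2 (φ.toLp 2) = h2.toLp _ := by
    rw [Lp.ext_iff]
    filter_upwards [conjL2_ae (φ.toLp 2), h2.coeFn_toLp, φ.coeFn_toLp 2] with x h1 h3 h4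
    rw [h1, h3, h4]
  rw [e, SchwartzMap.toLp_fourierInv_eq, Lp.ext_iff]
  have h := ae_comp_neg ((𝓕⁻ φ).coeFn_toLp 2 volume)
  filter_upwards [fourierInv_toLp_ae hi h2, sharp_ae ((𝓕⁻ φ).toLp 2), h] with x h1 h3 h4
  rw [h1, h3, h4, SchwartzMap.fourierInv_coe, Real.fourierInv_eq', Real.fourierInv_eq',
    ← integral_conj]
  refine integral_congr_ae (Eventually.of_forall fun y => ?_)
  simp only [smul_eq_mul, map_mul, ← Complex.exp_conj, Complex.conj_ofReal, Complex.conj_I,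
    inner_neg_right]
  congr 2
  push_cast
  ring

lemma fourier_sharp (f : L2Space ℂ) : 𝓕 (sharp f) = conjL2 (𝓕 f) := by
  have h := fourierInv_conjL2 (𝓕 f)
  rw [FourierTransform.fourierInv_fourier_eq] at h
  rw [← h, FourierTransform.fourier_fourierInv_eq]

lemma besselFourier_sharp (f : L2Space ℂ) : besselFourier (sharp f) = conjL2 (besselFourier f) := by
  rw [besselFourier_apply, besselFourier_apply, ← fourier_sharp]
  congr 1
  rw [Symb.op_eq_iff]
  have h := ae_comp_neg ((besselSymb ℂ).op_ae f)
  filter_upwards [sharp_ae f, sharp_ae ((besselSymb ℂ).op f), h] with x h1 h2 h3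
  rw [h1, h2, h3, Weights.besselSymb_apply, Weights.besselSymb_apply]
  simp [besselWeight]

end Reflection

/-! ### The H¹ norm in terms of the L² coordinates. -/

section Norms

/-- States use the inverse transform of a function and `xNorm` the direct one; they differ by a
reflection, which the even weight does not see. -/
lemma xNorm_sq {μ : ℝ} {u : Plane → ℝ} {F : L2Space ℂ}
    (h : (fun x => (u x : ℂ)) =ᵐ[volume] (𝓕 F : L2Space ℂ)) :
    xNorm μ u ^ 2 =
      ∫⁻ ξ, ENNReal.ofReal (1 + μ * (2 * Real.pi * ‖ξ‖) ^ 2) * ‖F ξ‖ₑ ^ 2 := by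
  have hu : MemLp (fun x => (u x : ℂ)) 2 volume := (memLp_congr_ae h).2 (Lp.memLp _)
  have e : hu.toLp _ = 𝓕 F := by
    rw [Lp.ext_iff]; exact hu.coeFn_toLp.trans h
  have e2 : F = reflect (ContinuousLinearMap.id ℝ ℂ) (𝓕 (hu.toLp _)) := by
    rw [← fourierInv_eq_reflect, e, FourierTransform.fourierInv_fourier_eq]
  rw [xNorm, dif_pos hu, ← ENNReal.rpow_natCast, ← ENNReal.rpow_mul]
  norm_num
  rw [← lintegral_neg_eq_self]
  refine lintegral_congr_ae ?_
  have h3 := reflect_ae (ContinuousLinearMap.id ℝ ℂ) (𝓕 (hu.toLp _))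
  rw [← e2] at h3
  filter_upwards [h3] with x hx
  rw [hx, norm_neg]
  rfl

lemma exists_of_xNorm_lt_top {μ : ℝ} {u : Plane → ℝ} (h : xNorm μ u < ⊤) :
    ∃ F : L2Space ℂ, (fun x => (u x : ℂ)) =ᵐ[volume] (𝓕 F : L2Space ℂ) := by
  have hu : MemLp (fun x => (u x : ℂ)) 2 volume := by
    by_contra hu
    rw [xNorm, dif_neg hu] at h
    exact lt_irrefl _ h
  refine ⟨𝓕⁻ (hu.toLp _), ?_⟩
  rw [FourierTransform.fourier_fourierInv_eq]
  exact hu.coeFn_toLp.symm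

lemma enorm_sq_L2 (f : L2Space ℂ) : ‖f‖ₑ ^ 2 = ∫⁻ ξ, ‖f ξ‖ₑ ^ 2 := by
  rw [Lp.enorm_def, eLpNorm_two_sq]

/-- The weights of the `H¹` norm are comparable with `ρ⁻²`. -/
lemma weight_mul_sq_mem (ξ : Plane) :
    (1 + 1 * (2 * Real.pi * ‖ξ‖) ^ 2) * besselWeight ξ ^ 2 ∈ Icc 1 ((2 * Real.pi) ^ 2) := by
  rw [besselWeight_sq, ← div_eq_mul_inv, mem_Icc, le_div_iff₀ (by positivity),
    div_le_iff₀ (by positivity)]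
  have : (1 : ℝ) ≤ (2 * Real.pi) ^ 2 := by nlinarith [Real.pi_gt_three]
  constructor <;> nlinarith [sq_nonneg ‖ξ‖]

lemma enorm_besselSymb_op_ae (f : L2Space ℂ) : ∀ᵐ ξ, ‖(besselSymb ℂ).op f ξ‖ₑ ^ 2
    = ENNReal.ofReal (besselWeight ξ ^ 2) * ‖f ξ‖ₑ ^ 2 := by
  filter_upwards [(besselSymb ℂ).op_ae f] with ξ h
  rw [h, Weights.besselSymb_apply, enorm_smul, mul_pow, ← ofReal_norm, Complex.norm_real,
    Real.norm_of_nonneg (besselWeight_pos ξ).le, ENNReal.ofReal_pow (besselWeight_pos ξ).le]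

lemma xNorm_sq_besselFourier {u : Plane → ℝ} {f : L2Space ℂ}
    (h : (fun x => (u x : ℂ)) =ᵐ[volume] besselFourier f) :
    xNorm 1 u ^ 2 = ∫⁻ ξ, ENNReal.ofReal
      ((1 + 1 * (2 * Real.pi * ‖ξ‖) ^ 2) * besselWeight ξ ^ 2) * ‖f ξ‖ₑ ^ 2 := by
  rw [besselFourier_apply] at h
  rw [xNorm_sq h]
  refine lintegral_congr_ae ?_
  filter_upwards [enorm_besselSymb_op_ae f] with ξ h
  rw [h, ENNReal.ofReal_mul (by positivity), ← mul_assoc]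

lemma enorm_le_xNorm {u : Plane → ℝ} {f : L2Space ℂ}
    (h : (fun x => (u x : ℂ)) =ᵐ[volume] besselFourier f) : ‖f‖ₑ ≤ xNorm 1 u := by
  rw [← ENNReal.pow_le_pow_left_iff (n := 2) (by norm_num), xNorm_sq_besselFourier h, enorm_sq_L2]
  refine lintegral_mono fun ξ => ?_
  calc _ = 1 * ‖f ξ‖ₑ ^ 2 := (one_mul _).symm
    _ ≤ _ := by
      gcongr
      rw [← ENNReal.ofReal_one]
      exact ENNReal.ofReal_le_ofReal (weight_mul_sq_mem ξ).1

lemma xNorm_le_enorm {u : Plane → ℝ} {f : L2Space ℂ}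
    (h : (fun x => (u x : ℂ)) =ᵐ[volume] besselFourier f) :
    xNorm 1 u ≤ ENNReal.ofReal (2 * Real.pi) * ‖f‖ₑ := by
  rw [← ENNReal.pow_le_pow_left_iff (n := 2) (by norm_num), xNorm_sq_besselFourier h, mul_pow,
    enorm_sq_L2, ← ENNReal.ofReal_pow (by positivity), ← lintegral_const_mul'  _ _
    ENNReal.ofReal_ne_top]
  refine lintegral_mono fun ξ => ?_
  gcongr
  exact (weight_mul_sq_mem ξ).2

/-- Dividing by ρ stays in L² because ρ⁻² is bounded by the weight of the H¹ norm. -/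
lemma exists_besselFourier_of_xNorm_lt_top {u : Plane → ℝ} (h : xNorm 1 u < ⊤) :
    ∃ f : L2Space ℂ, (fun x => (u x : ℂ)) =ᵐ[volume] besselFourier f := by
  obtain ⟨F, hF⟩ := exists_of_xNorm_lt_top h
  have hsq := xNorm_sq (μ := 1) hF
  have hm : MemLp (fun ξ => ((besselWeight ξ)⁻¹ : ℂ) * F ξ) 2 volume := by
    refine ⟨((Complex.measurable_ofReal.comp measurable_besselWeight).inv.aestronglyMeasurable).mul
      (Lp.memLp F).1, ?_⟩
    have h1 : eLpNorm (fun ξ => ((besselWeight ξ)⁻¹ : ℂ) * F ξ) 2 volume ^ 2 ≤ xNorm 1 u ^ 2 := by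
      rw [eLpNorm_two_sq, hsq]
      refine lintegral_mono fun ξ => ?_
      have hp := besselWeight_pos ξ
      rw [enorm_mul, mul_pow, ← Complex.ofReal_inv, ← ofReal_norm, Complex.norm_real,
        Real.norm_of_nonneg (inv_nonneg.2 hp.le), ← ENNReal.ofReal_pow (inv_nonneg.2 hp.le)]
      gcongr
      rw [inv_pow, inv_le_iff_one_le_mul₀ (by positivity)]
      exact (weight_mul_sq_mem ξ).1
    exact ((ENNReal.pow_le_pow_left_iff (by norm_num)).1 h1).trans_lt h
  refine ⟨hm.toLp _, hF.trans ?_⟩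
  rw [besselFourier_apply]
  have e : (besselSymb ℂ).op (hm.toLp _) = F := by
    rw [Symb.op_eq_iff]
    filter_upwards [hm.coeFn_toLp] with ξ h
    have := (besselWeight_pos ξ).ne'
    rw [h, Weights.besselSymb_apply, smul_eq_mul, mul_inv_cancel_left₀]
    exact_mod_cast this
  rw [e]

end Norms

/-! ### Real-valued functions represented by states. -/

section Reality

lemma op_reflect {F G : Type*} [NormedAddCommGroup F] [InnerProductSpace ℂ F]
    [NormedAddCommGroup G] [InnerProductSpace ℂ G] (A : Symb F G) (c : F →L[ℝ] F) (c' : G →L[ℝ] G)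
    (h : ∀ ξ x, A ξ (c x) = c' (A (-ξ) x)) (f : L2Space F) :
    A.op (reflect c f) = reflect c' (A.op f) := by
  rw [Symb.op_eq_iff]
  filter_upwards [reflect_ae c f, reflect_ae c' (A.op f), ae_comp_neg (A.op_ae f)] with ξ h1 h2 h3
  rw [h1, h2, h3, h]

/-- Conjugation of the components. -/
noncomputable def conjVal : StateVal →L[ℝ] StateVal :=
  (LinearIsometryEquiv.piLpCongrRight 2 (fun _ : Option (Fin 2) => Complex.conjLIE) :
    StateVal ≃ₗᵢ[ℝ] StateVal).toContinuousLinearEquiv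

lemma conjVal_apply (z : StateVal) (i : Option (Fin 2)) :
    conjVal z i = starRingEnd ℂ (z i) := rfl

/-- The map `Z ↦ conj (Z (-·))` on states. -/
noncomputable def sharpState : State →L[ℝ] State := reflect conjVal

lemma conjL2_reProd (f g : L2Space ℂ) : conjL2 (reProd f g) = reProd f g := by
  rw [Lp.ext_iff]
  filter_upwards [conjL2_ae (reProd f g), reProd_ae f g] with x h1 h2
  rw [h1, h2, reMul, Complex.conj_ofReal]

lemma reProd_sharp (f g : L2Space ℂ) : reProd (sharp f) (sharp g) = reProd f g := by
  rw [Lp.ext_iff]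
  filter_upwards [reProd_ae f g, reProd_ae (sharp f) (sharp g), conjL2_ae (besselFourier f),
    conjL2_ae (besselFourier g)] with x h1 h2 h3 h4
  rw [h1, h2, reMul, reMul, besselFourier_sharp, besselFourier_sharp, h3, h4, Complex.conj_re,
    Complex.conj_re]

lemma besselWeight_neg (ξ : Plane) : besselWeight (-ξ) = besselWeight ξ := by
  simp [besselWeight]

lemma besselSymb_sharpState (Z : State) :
    (besselSymb StateVal).op (sharpState Z) = sharpState ((besselSymb StateVal).op Z) := by
  refine op_reflect _ _ _ (fun ξ z => ?_) Z
  ext i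
  rw [Weights.besselSymb_apply, Weights.besselSymb_apply, besselWeight_neg]
  simp [conjVal_apply]

lemma besselFourier_injective : Function.Injective besselFourier := fun _ _ h =>
  Weights.besselSymb_op_injective ℂ ((Lp.fourierTransformₗᵢ Plane ℂ).injective h)

namespace Weights

variable (P : Weights)

lemma fwd_neg (i : Option (Fin 2)) (ξ : Plane) : P.fwd i (-ξ) = P.fwd i ξ := by
  rw [fwd, fwd, besselWeight_neg]
  cases i
  · simp [wt, P.even_al]
  · simp [wt, P.even_be]

lemma coef_neg (j : Fin 2) (ξ : Plane) : P.coef j (-ξ) = -P.coef j ξ := by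
  simp [coef, P.even_al, P.even_be, P.even_J]

lemma qSymb_sharp (i : Option (Fin 2)) (Z : State) :
    (P.qSymb i).op (sharpState Z) = sharp ((P.qSymb i).op Z) := by
  refine op_reflect _ _ _ (fun ξ z => ?_) Z
  rw [qSymb_apply, qSymb_apply, fwd_neg]
  simp [conjVal_apply]

lemma qAdj_sharp (i : Option (Fin 2)) (f : L2Space ℂ) :
    (P.qAdj i).op (sharp f) = sharpState ((P.qAdj i).op f) := by
  refine op_reflect _ _ _ (fun ξ z => ?_) f
  ext k
  rw [qAdj_apply, qAdj_apply, fwd_neg]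
  by_cases h : k = i <;> simp [conjVal_apply, injC_apply, h]

lemma swapC_conj (j : Fin 2) (z : StateVal) : swapC j (conjVal z) = conjVal (swapC j z) := by
  ext i
  cases i with
  | none => simp [swapC_none, conjVal_apply]
  | some i => by_cases h : i = j <;> simp [swapC_some, conjVal_apply, h]

lemma kSymb_sharp (Z : State) : P.kSymb.op (sharpState Z) = sharpState (P.kSymb.op Z) := by
  refine op_reflect _ _ _ (fun ξ z => ?_) Z
  ext i
  rw [kSymb_apply, kSymb_apply, map_sum]
  simp [swapC_conj, conjVal_apply, coef_neg, besselWeight_neg, add_comm]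

lemma interaction_sharp (i j k : Option (Fin 2)) (Y Z : State) :
    P.interaction i j k (sharpState Y) (sharpState Z) = sharpState (P.interaction i j k Y Z) := by
  rw [interaction_apply, interaction_apply, qSymb_sharp, qSymb_sharp, reProd_sharp, ← qAdj_sharp,
    ← fourierInv_conjL2, conjL2_reProd]

/-- Passing to conjugates does not change real parts, and the inverse transform of a real product is
fixed by `sharp`. Hence the symmetry of real data is preserved by the nonlinearity. -/
lemma quad_sharp (Y Z : State) :
    P.quad (sharpState Y) (sharpState Z) = sharpState (P.quad Y Z) := by
  rw [quad_apply, quad_apply, map_smul, map_sum]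
  simp only [interaction_sharp, map_add]

/-- The state `Z` consists of the components `ζ` and `v`. -/
structure Represents (Z : State) (ζ : Plane → ℝ) (v : Plane → Plane) : Prop where
  zeta : (fun x => (ζ x : ℂ)) =ᵐ[volume] besselFourier ((P.qSymb none).op Z)
  vec : ∀ j, (fun x => (v x j : ℂ)) =ᵐ[volume] besselFourier ((P.qSymb (some j)).op Z)

variable {P}

lemma qSymb_pSymb (i j : Option (Fin 2)) (f : L2Space ℂ) :
    (P.qSymb i).op ((P.pSymb j).op f) = if i = j then f else 0 := by
  have h0 : ∀ ξ, (P.fwd j ξ : ℂ) ≠ 0 := fun ξ => Complex.ofReal_ne_zero.2 (P.fwd_pos j ξ).ne'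
  rw [Symb.op_eq_iff]
  split_ifs with h
  · filter_upwards [(P.pSymb j).op_ae f] with ξ h1
    rw [h1, qSymb_apply, pSymb_apply, h]
    simp [injC_apply, h0]
  · filter_upwards [(P.pSymb j).op_ae f, Lp.coeFn_zero ℂ 2 (volume : Measure Plane)] with ξ h1 h2
    rw [h1, h2, qSymb_apply, pSymb_apply]
    simp [injC_apply, h]

lemma sum_pSymb_qSymb (Z : State) : ∑ i, (P.pSymb i).op ((P.qSymb i).op Z) = Z := by
  have h0 : ∀ j ξ, (P.fwd j ξ : ℂ) ≠ 0 := fun j ξ => Complex.ofReal_ne_zero.2 (P.fwd_pos j ξ).ne'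
  have h : ∀ᵐ ξ, ∀ i, (P.pSymb i).op ((P.qSymb i).op Z) ξ = injC i (Z ξ i) := by
    rw [ae_all_iff]
    intro i
    filter_upwards [(P.pSymb i).op_ae ((P.qSymb i).op Z), (P.qSymb i).op_ae Z] with ξ h1 h2
    rw [h1, h2, qSymb_apply, pSymb_apply, ← map_smul, smul_eq_mul, mul_inv_cancel_left₀ (h0 i ξ)]
  rw [Lp.ext_iff]
  filter_upwards [h, Lp.coeFn_finsetSum Finset.univ
    (fun i => (P.pSymb i).op ((P.qSymb i).op Z))] with ξ h1 h2
  rw [h2]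
  ext k
  rw [Finset.sum_apply, WithLp.ofLp_sum, Finset.sum_apply]
  simp only [h1, injC_apply, Finset.sum_ite_eq, Finset.mem_univ, if_true]

lemma ext_qSymb {Y Z : State} (h : ∀ i, (P.qSymb i).op Y = (P.qSymb i).op Z) : Y = Z := by
  rw [← sum_pSymb_qSymb (P := P) Y, ← sum_pSymb_qSymb (P := P) Z]
  simp only [h]

namespace Represents

variable {Z Z' : State} {ζ ζ' : Plane → ℝ} {v v' : Plane → Plane}

lemma unique (h : P.Represents Z ζ v) (h' : P.Represents Z' ζ v) : Z = Z' := by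
  refine ext_qSymb (P := P) fun i => besselFourier_injective ?_
  rw [Lp.ext_iff]
  cases i with
  | none => exact h.zeta.symm.trans h'.zeta
  | some j => exact (h.vec j).symm.trans (h'.vec j)

lemma congr (h : P.Represents Z ζ v) (hζ : ζ' =ᵐ[volume] ζ) (hv : v' =ᵐ[volume] v) :
    P.Represents Z ζ' v' := by
  constructor
  · filter_upwards [h.zeta, hζ] with x h1 h2
    rw [h2, h1]
  · intro j
    filter_upwards [h.vec j, hv] with x h1 h2
    rw [h2, h1]

lemma ae_eq (h : P.Represents Z ζ v) (h' : P.Represents Z ζ' v') :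
    ζ =ᵐ[volume] ζ' ∧ v =ᵐ[volume] v' := by
  constructor
  · filter_upwards [h.zeta, h'.zeta] with x h1 h2
    exact_mod_cast h1.trans h2.symm
  · filter_upwards [ae_all_iff.2 h.vec, ae_all_iff.2 h'.vec] with x h1 h2
    ext j
    exact_mod_cast (h1 j).trans (h2 j).symm

lemma sub (h : P.Represents Z ζ v) (h' : P.Represents Z' ζ' v') :
    P.Represents (Z - Z') (ζ - ζ') (v - v') := by
  constructor
  · rw [map_sub, map_sub]
    filter_upwards [h.zeta, h'.zeta, Lp.coeFn_sub (besselFourier ((P.qSymb none).op Z))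
      (besselFourier ((P.qSymb none).op Z'))] with x h1 h2 h3
    rw [h3, Pi.sub_apply, Pi.sub_apply, ← h1, ← h2, Complex.ofReal_sub]
  · intro j
    rw [map_sub, map_sub]
    filter_upwards [h.vec j, h'.vec j, Lp.coeFn_sub (besselFourier ((P.qSymb (some j)).op Z))
      (besselFourier ((P.qSymb (some j)).op Z'))] with x h1 h2 h3
    rw [h3, Pi.sub_apply, Pi.sub_apply, PiLp.sub_apply, ← h1, ← h2, Complex.ofReal_sub]

lemma conjL2_eq_of_ofReal {u : Plane → ℝ} {f : L2Space ℂ}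
    (h : (fun x => (u x : ℂ)) =ᵐ[volume] f) : conjL2 f = f := by
  rw [Lp.ext_iff]
  filter_upwards [conjL2_ae f, h] with x h1 h2
  rw [h1, ← h2, Complex.conj_ofReal]

lemma sharpState_eq (h : P.Represents Z ζ v) : sharpState Z = Z := by
  refine ext_qSymb (P := P) fun i => besselFourier_injective ?_
  rw [qSymb_sharp, besselFourier_sharp]
  cases i with
  | none => exact conjL2_eq_of_ofReal h.zeta
  | some j => exact conjL2_eq_of_ofReal (h.vec j)

end Represents

variable (P) in
/-- The first component of the function represented by a state. -/
noncomputable def zetaOf (Z : State) (x : Plane) : ℝ := (besselFourier ((P.qSymb none).op Z) x).re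

variable (P) in
/-- The vector field represented by a state. -/
noncomputable def vecOf (Z : State) (x : Plane) : Plane :=
  WithLp.toLp 2 fun j => (besselFourier ((P.qSymb (some j)).op Z) x).re

/-- For an invariant state every component equals its conjugate almost everywhere, so taking real
parts discards nothing. -/
lemma represents_of_sharpState_eq {Z : State} (h : sharpState Z = Z) :
    P.Represents Z (P.zetaOf Z) (P.vecOf Z) := by
  have key : ∀ i, ∀ᵐ x, ((besselFourier ((P.qSymb i).op Z) x).re : ℂ) =
      besselFourier ((P.qSymb i).op Z) x := by
    intro i
    have e : conjL2 (besselFourier ((P.qSymb i).op Z)) = besselFourier ((P.qSymb i).op Z) := by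
      rw [← besselFourier_sharp, ← qSymb_sharp, h]
    have h1 := conjL2_ae (besselFourier ((P.qSymb i).op Z))
    rw [e] at h1
    filter_upwards [h1] with x hx
    exact Complex.conj_eq_iff_re.1 hx.symm
  exact ⟨key none, fun j => key (some j)⟩

lemma xNorm_le_xNormVec (μ : ℝ) (v : Plane → Plane) (j : Fin 2) :
    xNorm μ (fun x => v x j) ≤ xNormVec μ v := by
  rw [← ENNReal.pow_le_pow_left_iff (n := 2) (by norm_num), xNormVec,
    ← ENNReal.rpow_natCast (_ ^ (1 / 2 : ℝ)), ← ENNReal.rpow_mul]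
  norm_num
  fin_cases j <;> simp

lemma xNormVec_le_sum (μ : ℝ) (v : Plane → Plane) :
    xNormVec μ v ≤ ∑ j, xNorm μ (fun x => v x j) := by
  rw [← ENNReal.pow_le_pow_left_iff (n := 2) (by norm_num), xNormVec,
    ← ENNReal.rpow_natCast (_ ^ (1 / 2 : ℝ)), ← ENNReal.rpow_mul]
  norm_num
  rw [add_sq]
  gcongr
  exact le_self_add

lemma exists_represents {ζ : Plane → ℝ} {v : Plane → Plane} (hζ : xNorm 1 ζ < ⊤)
    (hv : xNormVec 1 v < ⊤) : ∃ Z, P.Represents Z ζ v := by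
  obtain ⟨f, hf⟩ := exists_besselFourier_of_xNorm_lt_top hζ
  choose g hg using fun j => exists_besselFourier_of_xNorm_lt_top
    ((xNorm_le_xNormVec 1 v j).trans_lt hv)
  have e : ∀ k, (P.qSymb k).op (∑ i : Option (Fin 2), (P.pSymb i).op (i.elim f g)) = k.elim f g := by
    intro k
    rw [map_sum]
    simp only [qSymb_pSymb]
    rw [Finset.sum_ite_eq]
    simp
  refine ⟨∑ i : Option (Fin 2), (P.pSymb i).op (i.elim f g), ?_, fun j => ?_⟩
  · rw [e]; exact hf
  · rw [e]; exact hg j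

lemma Represents.xNorm_add_le {Z : State} {ζ : Plane → ℝ} {v : Plane → Plane}
    (h : P.Represents Z ζ v) :
    xNorm 1 ζ + xNormVec 1 v ≤ ENNReal.ofReal (6 * Real.pi * (√P.lo)⁻¹ * ‖Z‖) := by
  have h1 : ∀ (i : Option (Fin 2)) (u : Plane → ℝ),
      (fun x => (u x : ℂ)) =ᵐ[volume] besselFourier ((P.qSymb i).op Z) →
      xNorm 1 u ≤ ENNReal.ofReal (2 * Real.pi * ((√P.lo)⁻¹ * ‖Z‖)) := by
    intro i u hu
    refine (xNorm_le_enorm hu).trans ?_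
    rw [← ofReal_norm, ← ENNReal.ofReal_mul (by positivity)]
    refine ENNReal.ofReal_le_ofReal ?_
    gcongr
    exact P.norm_qSymb_le i Z
  have h2 := xNormVec_le_sum 1 v
  rw [Fin.sum_univ_two] at h2
  calc _ ≤ ENNReal.ofReal (2 * Real.pi * ((√P.lo)⁻¹ * ‖Z‖)) +
        (ENNReal.ofReal (2 * Real.pi * ((√P.lo)⁻¹ * ‖Z‖)) +
          ENNReal.ofReal (2 * Real.pi * ((√P.lo)⁻¹ * ‖Z‖))) :=
        add_le_add (h1 none ζ h.zeta) (h2.trans (add_le_add (h1 _ _ (h.vec 0)) (h1 _ _ (h.vec 1))))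
    _ = _ := by
        rw [← ENNReal.ofReal_add (by positivity) (by positivity),
          ← ENNReal.ofReal_add (by positivity) (by positivity)]
        congr 1
        ring

lemma Represents.enorm_le {Z : State} {ζ : Plane → ℝ} {v : Plane → Plane}
    (h : P.Represents Z ζ v) :
    ENNReal.ofReal ‖Z‖ ≤ ENNReal.ofReal (2 * √P.hi) * (xNorm 1 ζ + xNormVec 1 v) := by
  have h1 : ‖Z‖ ≤ √P.hi * (‖(P.qSymb none).op Z‖ + (‖(P.qSymb (some 0)).op Z‖ +
      ‖(P.qSymb (some 1)).op Z‖)) := by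
    conv_lhs => rw [← sum_pSymb_qSymb (P := P) Z]
    refine (norm_sum_le _ _).trans ?_
    rw [Fintype.sum_option, Fin.sum_univ_two, mul_add, mul_add]
    exact add_le_add (P.norm_pSymb_le _ _) (add_le_add (P.norm_pSymb_le _ _) (P.norm_pSymb_le _ _))
  have h2 := enorm_le_xNorm h.zeta
  have h3 := (enorm_le_xNorm (h.vec 0)).trans (xNorm_le_xNormVec 1 v 0)
  have h4 := (enorm_le_xNorm (h.vec 1)).trans (xNorm_le_xNormVec 1 v 1)
  calc _ ≤ ENNReal.ofReal (√P.hi * (‖(P.qSymb none).op Z‖ + (‖(P.qSymb (some 0)).op Z‖ +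
      ‖(P.qSymb (some 1)).op Z‖))) := ENNReal.ofReal_le_ofReal h1
    _ = ENNReal.ofReal √P.hi * (‖(P.qSymb none).op Z‖ₑ + (‖(P.qSymb (some 0)).op Z‖ₑ +
      ‖(P.qSymb (some 1)).op Z‖ₑ)) := by
        rw [ENNReal.ofReal_mul (by positivity), ENNReal.ofReal_add (by positivity) (by positivity),
          ENNReal.ofReal_add (by positivity) (by positivity), ofReal_norm, ofReal_norm, ofReal_norm]
    -- Each of the two components of v is bounded by the norm of v, hence the factor 2 below.
    _ ≤ ENNReal.ofReal √P.hi * (xNorm 1 ζ + (xNormVec 1 v + xNormVec 1 v)) := by gcongr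
    _ ≤ ENNReal.ofReal √P.hi * (2 * (xNorm 1 ζ + xNormVec 1 v)) := by
        gcongr
        rw [mul_add, two_mul, two_mul]
        gcongr
        exact le_self_add
    _ = _ := by
        rw [mul_comm 2 √P.hi, ENNReal.ofReal_mul (by positivity), ENNReal.ofReal_ofNat, mul_assoc]

end Weights
end Reality

/-! ### The equation for states tested in Fourier variables. -/

section Testing

lemma integrable_L2_mul (f g : L2Space ℂ) : Integrable (fun x => f x * g x) volume :=
  (Lp.memLp f).integrable_mul (Lp.memLp g)

namespace Weights

variable (P : Weights)

/-- A function `h` in Fourier variables such that its products with the symbols of the system are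
square integrable. -/
structure Test where
  h : Plane → ℂ
  hJ : L2Space ℂ
  hD : Fin 2 → L2Space ℂ
  hA : Fin 2 → L2Space ℂ
  hB : Fin 2 → L2Space ℂ
  hJ_ae : hJ =ᵐ[volume] fun ξ => P.J ξ * h ξ
  hD_ae : ∀ j, hD j =ᵐ[volume] fun ξ => Complex.I * (2 * Real.pi * ξ j : ℝ) * h ξ
  hA_ae : ∀ j, hA j =ᵐ[volume] fun ξ => P.be ξ * (Complex.I * (2 * Real.pi * ξ j : ℝ) * h ξ)
  hB_ae : ∀ j, hB j =ᵐ[volume] fun ξ => P.al ξ * (Complex.I * (2 * Real.pi * ξ j : ℝ) * h ξ)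

variable {P}

/-- Undoes the symmetrization: multiplied by J and returned to the original unknowns, the coupling
√al √be / J becomes be in the ζ equation. The next identity similarly yields al in the v equation.
-/
lemma inv_fwd_mul_coef_none (j : Fin 2) (ξ : Plane) :
    (P.fwd none ξ)⁻¹ * (P.coef j ξ * besselWeight ξ) * P.J ξ =
      2 * Real.pi * ξ j * (P.be ξ * (besselWeight ξ * (P.fwd (some j) ξ)⁻¹)) := by
  have h1 := besselWeight_pos ξ
  have h2 : 0 < P.al ξ := P.wt_pos none ξ
  have h3 : 0 < P.be ξ := P.wt_pos (some j) ξ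
  have h4 := P.J_pos ξ
  have h5 := Real.sqrt_pos.2 h2
  have h6 := Real.sqrt_pos.2 h3
  have h7 : √(P.be ξ) ^ 2 = P.be ξ := Real.sq_sqrt h3.le
  simp only [fwd, wt, coef, Option.elim]
  field_simp
  rw [h7]

lemma inv_fwd_mul_coef_some (j : Fin 2) (ξ : Plane) :
    (P.fwd (some j) ξ)⁻¹ * (P.coef j ξ * besselWeight ξ) * P.J ξ =
      2 * Real.pi * ξ j * (P.al ξ * (besselWeight ξ * (P.fwd none ξ)⁻¹)) := by
  have h1 := besselWeight_pos ξ
  have h2 : 0 < P.al ξ := P.wt_pos none ξ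
  have h3 : 0 < P.be ξ := P.wt_pos (some j) ξ
  have h4 := P.J_pos ξ
  have h5 := Real.sqrt_pos.2 h2
  have h6 := Real.sqrt_pos.2 h3
  have h7 : √(P.al ξ) ^ 2 = P.al ξ := Real.sq_sqrt h2.le
  simp only [fwd, wt, coef, Option.elim]
  field_simp
  rw [h7]

/-- Here ρ/fwd = 1/√be. In the nonlinear term this factor occurs twice, once from the gradient and
once from the return to physical unknowns, and the two cancel be. -/
lemma be_mul_sq (j : Fin 2) (ξ : Plane) :
    P.be ξ * (besselWeight ξ * (P.fwd (some j) ξ)⁻¹) * (besselWeight ξ * (P.fwd (some j) ξ)⁻¹)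
      = 1 := by
  have h1 := besselWeight_pos ξ
  have h3 : 0 < P.be ξ := P.wt_pos (some j) ξ
  have h6 := Real.sqrt_pos.2 h3
  have h7 : √(P.be ξ) ^ 2 = P.be ξ := Real.sq_sqrt h3.le
  simp only [fwd, wt, Option.elim]
  field_simp
  rw [h7]

lemma al_mul_sq (ξ : Plane) :
    P.al ξ * (besselWeight ξ * (P.fwd none ξ)⁻¹) * (besselWeight ξ * (P.fwd none ξ)⁻¹) = 1 := by
  have h1 := besselWeight_pos ξ
  have h3 : 0 < P.al ξ := P.wt_pos none ξ
  have h6 := Real.sqrt_pos.2 h3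
  have h7 : √(P.al ξ) ^ 2 = P.al ξ := Real.sq_sqrt h3.le
  simp only [fwd, wt, Option.elim]
  field_simp
  rw [h7]

lemma qSymb_kSymb_none (W : State) : (P.qSymb none).op (P.kSymb.op W) =ᵐ[volume] fun ξ =>
    ∑ j, Complex.I * (((P.fwd none ξ)⁻¹ * (P.coef j ξ * besselWeight ξ) : ℝ) : ℂ) *
      W ξ (some j) := by
  filter_upwards [(P.qSymb none).op_ae (P.kSymb.op W), P.kSymb.op_ae W] with ξ h1 h2
  rw [h1, h2, qSymb_apply, kSymb_apply]
  simp only [Fin.sum_univ_two, PiLp.add_apply, PiLp.smul_apply, swapC_none, smul_eq_mul]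
  push_cast
  ring

lemma qSymb_kSymb_some (j : Fin 2) (W : State) :
    (P.qSymb (some j)).op (P.kSymb.op W) =ᵐ[volume] fun ξ =>
      Complex.I * (((P.fwd (some j) ξ)⁻¹ * (P.coef j ξ * besselWeight ξ) : ℝ) : ℂ) *
        W ξ none := by
  filter_upwards [(P.qSymb (some j)).op_ae (P.kSymb.op W), P.kSymb.op_ae W] with ξ h1 h2
  rw [h1, h2, qSymb_apply, kSymb_apply]
  fin_cases j <;>
    simp [Fin.sum_univ_two, swapC_some] <;> ring

lemma besselSymb_qSymb_ae (i : Option (Fin 2)) (W : State) :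
    (besselSymb ℂ).op ((P.qSymb i).op W) =ᵐ[volume] fun ξ =>
      ((besselWeight ξ * (P.fwd i ξ)⁻¹ : ℝ) : ℂ) * W ξ i := by
  filter_upwards [(besselSymb ℂ).op_ae ((P.qSymb i).op W), (P.qSymb i).op_ae W] with ξ h1 h2
  rw [h1, h2, qSymb_apply, besselSymb_apply]
  push_cast
  rw [smul_eq_mul, mul_assoc]

lemma besselSymb_qAdj_ae (i : Option (Fin 2)) (g : L2Space ℂ) (k : Option (Fin 2)) :
    ∀ᵐ ξ, (besselSymb StateVal).op ((P.qAdj i).op g) ξ k =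
      if k = i then ((besselWeight ξ * (P.fwd i ξ)⁻¹ : ℝ) : ℂ) * g ξ else 0 := by
  filter_upwards [(besselSymb StateVal).op_ae ((P.qAdj i).op g), (P.qAdj i).op_ae g] with ξ h1 h2
  rw [h1, h2, qAdj_apply, besselSymb_apply, PiLp.smul_apply, PiLp.smul_apply, injC_apply]
  split_ifs
  · push_cast
    rw [smul_eq_mul, smul_eq_mul, mul_assoc]
  · simp

namespace Test

variable (T : P.Test)

lemma pair_none (W : State) : pairL2 ((P.qSymb none).op (P.kSymb.op W)) T.hJ =
    ∑ j, pairL2 ((besselSymb ℂ).op ((P.qSymb (some j)).op W)) (T.hA j) := by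
  simp only [pairL2_apply]
  rw [← integral_finsetSum _ fun j _ => integrable_L2_mul _ _]
  refine integral_congr_ae ?_
  filter_upwards [qSymb_kSymb_none W, T.hJ_ae, ae_all_iff.2 T.hA_ae,
    ae_all_iff.2 fun j => besselSymb_qSymb_ae (P := P) (some j) W] with ξ h1 h2 h3 h4
  rw [h1, h2, Finset.sum_mul]
  refine Finset.sum_congr rfl fun j _ => ?_
  rw [h3, h4]
  have e := congrArg (Complex.ofReal) (inv_fwd_mul_coef_none (P := P) j ξ)
  push_cast at e ⊢
  linear_combination (Complex.I * W ξ (some j) * T.h ξ) * e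

lemma pair_some (j : Fin 2) (W : State) :
    pairL2 ((P.qSymb (some j)).op (P.kSymb.op W)) T.hJ =
      pairL2 ((besselSymb ℂ).op ((P.qSymb none).op W)) (T.hB j) := by
  simp only [pairL2_apply]
  refine integral_congr_ae ?_
  filter_upwards [qSymb_kSymb_some j W, T.hJ_ae, T.hB_ae j,
    besselSymb_qSymb_ae (P := P) none W] with ξ h1 h2 h3 h4
  rw [h1, h2, h3, h4]
  have e := congrArg (Complex.ofReal) (inv_fwd_mul_coef_some (P := P) j ξ)
  push_cast at e ⊢
  linear_combination (Complex.I * W ξ none * T.h ξ) * e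

/-- The Poisson operator couples ζ only with v, so the gradient in ζ does not enter the ζ equation.
-/
lemma pair_none_qAdj_none (g : L2Space ℂ) : pairL2 ((P.qSymb none).op
    (P.kSymb.op ((besselSymb StateVal).op ((P.qAdj none).op g)))) T.hJ = 0 := by
  rw [pairL2_apply]
  refine integral_eq_zero_of_ae ?_
  filter_upwards [qSymb_kSymb_none (P := P) ((besselSymb StateVal).op ((P.qAdj none).op g)),
    ae_all_iff.2 fun k => besselSymb_qAdj_ae (P := P) none g k] with ξ h1 h2
  rw [h1]
  simp [h2]

lemma pair_none_qAdj_some (j : Fin 2) (g : L2Space ℂ) : pairL2 ((P.qSymb none).op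
    (P.kSymb.op ((besselSymb StateVal).op ((P.qAdj (some j)).op g)))) T.hJ =
      pairL2 g (T.hD j) := by
  rw [pairL2_apply, pairL2_apply]
  refine integral_congr_ae ?_
  filter_upwards [qSymb_kSymb_none (P := P) ((besselSymb StateVal).op ((P.qAdj (some j)).op g)),
    ae_all_iff.2 fun k => besselSymb_qAdj_ae (P := P) (some j) g k, T.hJ_ae, T.hD_ae j]
    with ξ h1 h2 h3 h4
  rw [h1, h3, h4]
  simp only [h2, Option.some_inj, mul_ite, mul_zero, Finset.sum_ite_eq', Finset.mem_univ, if_true]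
  have e := congrArg (Complex.ofReal) (inv_fwd_mul_coef_none (P := P) j ξ)
  have e' := congrArg (Complex.ofReal) (be_mul_sq (P := P) j ξ)
  push_cast at e e' ⊢
  linear_combination (Complex.I * g ξ * T.h ξ * (besselWeight ξ * (P.fwd (some j) ξ : ℂ)⁻¹)) * e +
    (Complex.I * g ξ * T.h ξ * (2 * Real.pi * ξ j)) * e'

lemma pair_some_qAdj_some (i j : Fin 2) (g : L2Space ℂ) : pairL2 ((P.qSymb (some i)).op
    (P.kSymb.op ((besselSymb StateVal).op ((P.qAdj (some j)).op g)))) T.hJ = 0 := by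
  rw [pairL2_apply]
  refine integral_eq_zero_of_ae ?_
  filter_upwards [qSymb_kSymb_some (P := P) i ((besselSymb StateVal).op ((P.qAdj (some j)).op g)),
    ae_all_iff.2 fun k => besselSymb_qAdj_ae (P := P) (some j) g k] with ξ h1 h2
  rw [h1]
  simp [h2]

lemma pair_some_qAdj_none (j : Fin 2) (g : L2Space ℂ) : pairL2 ((P.qSymb (some j)).op
    (P.kSymb.op ((besselSymb StateVal).op ((P.qAdj none).op g)))) T.hJ =
      pairL2 g (T.hD j) := by
  rw [pairL2_apply, pairL2_apply]
  refine integral_congr_ae ?_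
  filter_upwards [qSymb_kSymb_some (P := P) j ((besselSymb StateVal).op ((P.qAdj none).op g)),
    ae_all_iff.2 fun k => besselSymb_qAdj_ae (P := P) none g k, T.hJ_ae, T.hD_ae j]
    with ξ h1 h2 h3 h4
  rw [h1, h3, h4]
  simp only [h2, if_true]
  have e := congrArg (Complex.ofReal) (inv_fwd_mul_coef_some (P := P) j ξ)
  have e' := congrArg (Complex.ofReal) (al_mul_sq (P := P) ξ)
  push_cast at e e' ⊢
  linear_combination (Complex.I * g ξ * T.h ξ * (besselWeight ξ * (P.fwd none ξ : ℂ)⁻¹)) * e +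
    (Complex.I * g ξ * T.h ξ * (2 * Real.pi * ξ j)) * e'

/-- The functional obtained by testing the component `i`. -/
noncomputable def functional (i : Option (Fin 2)) : State →L[ℝ] ℂ :=
  ((pairL2.flip T.hJ).comp (P.qSymb i).op).restrictScalars ℝ

lemma functional_apply (i : Option (Fin 2)) (Y : State) :
    T.functional i Y = pairL2 ((P.qSymb i).op Y) T.hJ := rfl

lemma functional_interaction_none_none (j k : Option (Fin 2)) (Z : State) :
    T.functional none (P.kSymb.op ((besselSymb StateVal).op (P.interaction none j k Z Z))) = 0 :=
  T.pair_none_qAdj_none _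

lemma functional_interaction_none_some (i : Fin 2) (j k : Option (Fin 2)) (Z : State) :
    T.functional none (P.kSymb.op ((besselSymb StateVal).op (P.interaction (some i) j k Z Z))) =
      pairL2 (𝓕⁻ (reProd ((P.qSymb j).op Z) ((P.qSymb k).op Z))) (T.hD i) :=
  T.pair_none_qAdj_some i _

lemma functional_interaction_some_some (l i : Fin 2) (j k : Option (Fin 2)) (Z : State) :
    T.functional (some l)
      (P.kSymb.op ((besselSymb StateVal).op (P.interaction (some i) j k Z Z))) = 0 :=
  T.pair_some_qAdj_some l i _

lemma functional_interaction_some_none (i : Fin 2) (j k : Option (Fin 2)) (Z : State) :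
    T.functional (some i) (P.kSymb.op ((besselSymb StateVal).op (P.interaction none j k Z Z))) =
      pairL2 (𝓕⁻ (reProd ((P.qSymb j).op Z) ((P.qSymb k).op Z))) (T.hD i) :=
  T.pair_some_qAdj_none i _

lemma functional_quad (i : Option (Fin 2)) (Z : State) :
    T.functional i (P.kSymb.op ((besselSymb StateVal).op (P.quad Z Z))) =
      (-(1 / (2 * P.γ))) • ∑ j : Fin 2,
        (T.functional i (P.kSymb.op ((besselSymb StateVal).op
            (P.interaction none (some j) (some j) Z Z))) +
          T.functional i (P.kSymb.op ((besselSymb StateVal).op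
            (P.interaction (some j) none (some j) Z Z))) +
          T.functional i (P.kSymb.op ((besselSymb StateVal).op
            (P.interaction (some j) (some j) none Z Z)))) := by
  have e : ∀ W, T.functional i (P.kSymb.op ((besselSymb StateVal).op W)) =
    ((T.functional i).comp ((P.kSymb.op.comp (besselSymb StateVal).op).restrictScalars ℝ)) W :=
    fun _ => rfl
  simp only [e]
  rw [quad_apply, map_smul, map_sum]
  simp only [map_add]

lemma functional_rhs (i : Option (Fin 2)) (Z : State) :
    T.functional i (P.hamiltonian.K Z + P.hamiltonian.R (P.hamiltonian.N Z)) =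
      T.functional i (P.kSymb.op Z) +
        T.functional i (P.kSymb.op ((besselSymb StateVal).op (P.quad Z Z))) := by
  rw [HamiltonianData.N, P.hamiltonian.R_K, map_add]
  rfl

/-- Only the gradient in v contributes. Two of the three interactions survive and coincide, turning
1/(2γ) into the coefficient 1/γ of ∇·(ζv). -/
lemma functional_rhs_none (Z : State) :
    T.functional none (P.hamiltonian.K Z + P.hamiltonian.R (P.hamiltonian.N Z)) =
      ∑ j, (pairL2 ((besselSymb ℂ).op ((P.qSymb (some j)).op Z)) (T.hA j) -
        (1 / P.γ : ℝ) * pairL2 (𝓕⁻ (reProd ((P.qSymb none).op Z) ((P.qSymb (some j)).op Z)))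
          (T.hD j)) := by
  have := P.γ_pos.ne'
  rw [functional_rhs, functional_quad, functional_apply, pair_none, Finset.sum_sub_distrib,
    ← Finset.mul_sum, sub_eq_add_neg]
  congr 1
  simp only [functional_interaction_none_none, functional_interaction_none_some]
  simp only [reProd_comm ((P.qSymb (some _)).op Z) ((P.qSymb none).op Z), zero_add, ← two_mul,
    ← Finset.mul_sum]
  rw [Complex.real_smul, ← mul_assoc, ← neg_mul]
  congr 1
  push_cast
  have : (P.γ : ℂ) ≠ 0 := by exact_mod_cast this
  field_simp

/-- Only the gradient in ζ contributes. A single interaction survives, which leaves 1/(2γ) in front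
of ∇|v|². -/
lemma functional_rhs_some (j : Fin 2) (Z : State) :
    T.functional (some j) (P.hamiltonian.K Z + P.hamiltonian.R (P.hamiltonian.N Z)) =
      pairL2 ((besselSymb ℂ).op ((P.qSymb none).op Z)) (T.hB j) -
        (1 / (2 * P.γ) : ℝ) * ∑ k, pairL2 (𝓕⁻ (reProd ((P.qSymb (some k)).op Z)
          ((P.qSymb (some k)).op Z))) (T.hD j) := by
  rw [functional_rhs, functional_quad, functional_apply, pair_some, sub_eq_add_neg]
  congr 1
  simp only [functional_interaction_some_none, functional_interaction_some_some, add_zero]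
  rw [Complex.real_smul, Complex.ofReal_neg, neg_mul]

end Test
end Weights
end Testing

/-! ### The distributional equations as functionals of states. -/

section Weak

lemma fourier_lineDeriv_apply (φ : 𝓢(Plane, ℂ)) (j : Fin 2) (ξ : Plane) :
    (𝓕 (∂_{basisVec j} φ : 𝓢(Plane, ℂ)) : 𝓢(Plane, ℂ)) ξ =
      Complex.I * (2 * Real.pi * ξ j : ℝ) * (𝓕 φ : 𝓢(Plane, ℂ)) ξ := by
  have h : (fun ξ : Plane => inner ℝ ξ (basisVec j)).HasTemperateGrowth :=
    ((innerSL ℝ).flip (basisVec j)).hasTemperateGrowth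
  rw [SchwartzMap.fourier_lineDerivOp_eq, smul_apply,
    SchwartzMap.smulLeftCLM_apply_apply h]
  have e : inner ℝ ξ (basisVec j) = ξ j := by
    simp [basisVec, EuclideanSpace.inner_single_right]
  rw [e, Complex.real_smul, smul_eq_mul]
  push_cast
  ring

lemma fourier_laplacian_apply (φ : 𝓢(Plane, ℂ)) (ξ : Plane) :
    (𝓕 (Δ φ : 𝓢(Plane, ℂ)) : 𝓢(Plane, ℂ)) ξ =
      -((2 * Real.pi * ‖ξ‖) ^ 2 : ℝ) * (𝓕 φ : 𝓢(Plane, ℂ)) ξ := by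
  have e : (Δ φ : 𝓢(Plane, ℂ)) = ∑ j : Fin 2, ∂_{basisVec j} (∂_{basisVec j} φ : 𝓢(Plane, ℂ)) := by
    rw [SchwartzMap.laplacian_eq_sum (EuclideanSpace.basisFun (Fin 2) ℝ)]
    simp [basisVec]
  have e2 : (𝓕 (Δ φ : 𝓢(Plane, ℂ)) : 𝓢(Plane, ℂ)) =
      𝓕 (∂_{basisVec 0} (∂_{basisVec 0} φ : 𝓢(Plane, ℂ)) : 𝓢(Plane, ℂ)) +
      𝓕 (∂_{basisVec 1} (∂_{basisVec 1} φ : 𝓢(Plane, ℂ)) : 𝓢(Plane, ℂ)) := by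
    rw [e, Fin.sum_univ_two, FourierTransform.fourier_add]
  rw [e2, add_apply, fourier_lineDeriv_apply, fourier_lineDeriv_apply,
    fourier_lineDeriv_apply, fourier_lineDeriv_apply, mul_pow, EuclideanSpace.norm_sq_eq,
    Fin.sum_univ_two, Real.norm_eq_abs, Real.norm_eq_abs, sq_abs, sq_abs]
  push_cast
  linear_combination (4 * Real.pi ^ 2 * ((ξ 0) ^ 2 + (ξ 1) ^ 2) * (𝓕 φ : 𝓢(Plane, ℂ)) ξ)
    * Complex.I_sq

lemma memLp_mul_schwartz {m : Plane → ℝ} (hm : Measurable m) {C : ℝ}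
    (hC : ∀ ξ, |m ξ| ≤ C * (1 + ‖ξ‖ ^ 2)) (ψ : 𝓢(Plane, ℂ)) (p : ℝ≥0∞) :
    MemLp (fun ξ => (m ξ : ℂ) * ψ ξ) p volume := by
  have hg : (fun ξ : Plane => 1 + ‖ξ‖ ^ 2).HasTemperateGrowth := by
    have := Function.hasTemperateGrowth_one_add_norm_sq_rpow Plane 1
    simpa using this
  refine ((SchwartzMap.smulLeftCLM ℂ (fun ξ : Plane => 1 + ‖ξ‖ ^ 2) ψ).memLp p volume).of_le_mul
    (c := C) ((Complex.measurable_ofReal.comp hm).aestronglyMeasurable.mul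
      ψ.continuous.aestronglyMeasurable) (Eventually.of_forall fun ξ => ?_)
  rw [SchwartzMap.smulLeftCLM_apply_apply hg, norm_mul, norm_smul, Complex.norm_real,
    Real.norm_eq_abs, Real.norm_of_nonneg (by positivity), ← mul_assoc]
  gcongr
  exact hC ξ

lemma integral_eq_pairL2 {u : Plane → ℝ} {f χ : L2Space ℂ} {χ' : Plane → ℂ}
    (hu : (fun x => (u x : ℂ)) =ᵐ[volume] besselFourier f) (hχ : χ' =ᵐ[volume] χ) :
    ∫ x, (u x : ℂ) * χ' x = pairL2 ((besselSymb ℂ).op f) (𝓕 χ) := by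
  rw [← pairL2_fourier, pairL2_apply]
  refine integral_congr_ae ?_
  filter_upwards [hu, hχ] with x h1 h2
  rw [h1, h2, besselFourier_apply]

lemma fourier_toLp_ae (φ : 𝓢(Plane, ℂ)) :
    (𝓕 (φ.toLp 2 : L2Space ℂ) : L2Space ℂ) =ᵐ[volume] (𝓕 φ : 𝓢(Plane, ℂ)) := by
  rw [SchwartzMap.toLp_fourier_eq]
  exact (𝓕 φ).coeFn_toLp 2

namespace Weights

/-- The symbols are those of the system with `ε = μ = 1`. -/
structure Models (P : Weights) (γ a b c μ₂ : ℝ) : Prop where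
  γ_eq : P.γ = γ
  al_eq : ∀ ξ, P.al ξ = (1 - γ) * (1 - c * (2 * Real.pi * ‖ξ‖) ^ 2)
  be_eq : ∀ ξ, P.be ξ = 1 / γ + dispSymbol γ a 1 μ₂ ((2 * Real.pi) • ξ)
  J_eq : ∀ ξ, P.J ξ = 1 + b * (2 * Real.pi * ‖ξ‖) ^ 2

namespace Models

variable {P : Weights} {γ a b c μ₂ : ℝ} (M : P.Models γ a b c μ₂)

include M in
-- Quadratic growth of the symbol is enough against a Schwartz function, so no smoothness of the
-- symbol is needed. Both p = 1 and p = 2 are used, to identify the integral and the L² transforms.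
lemma memLp_disp (ψ : 𝓢(Plane, ℂ)) (p : ℝ≥0∞) :
    MemLp (fun ξ => (dispSymbol γ a 1 μ₂ ((2 * Real.pi) • ξ) : ℂ) * ψ ξ) p volume := by
  have e : ∀ ξ, dispSymbol γ a 1 μ₂ ((2 * Real.pi) • ξ) = P.be ξ - 1 / γ := fun ξ => by
    rw [M.be_eq]; ring
  have hγ : 0 < γ := M.γ_eq ▸ P.γ_pos
  simp only [e]
  refine memLp_mul_schwartz (P.measurable_be.sub_const _) (C := P.hi + 1 / γ) (fun ξ => ?_) ψ p
  have h1 := P.be_mem ξ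
  have h2 := (P.wt_pos (some 0) ξ).le
  change 0 ≤ P.be ξ at h2
  have h3 : 0 < 1 / γ := by positivity
  refine (abs_sub _ _).trans ?_
  rw [abs_of_nonneg h2, abs_of_pos h3, add_mul]
  have h4 : 1 / γ ≤ 1 / γ * (1 + ‖ξ‖ ^ 2) := le_mul_of_one_le_right h3.le (by
    nlinarith [sq_nonneg ‖ξ‖])
  linarith [h1.2]

/-- The multiplier applied to `∂_j φ`, in Fourier variables. -/
noncomputable def hM (φ : 𝓢(Plane, ℂ)) (j : Fin 2) : L2Space ℂ :=
  (M.memLp_disp (𝓕 (∂_{basisVec j} φ : 𝓢(Plane, ℂ))) 2).toLp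

lemma multiplier_ae (φ : 𝓢(Plane, ℂ)) (j : Fin 2) :
    multiplier (dispSymbol γ a 1 μ₂) (∂_{basisVec j} φ : 𝓢(Plane, ℂ)) =ᵐ[volume]
      (𝓕⁻ (M.hM φ j) : L2Space ℂ) := by
  have h1 := memLp_one_iff_integrable.1 (M.memLp_disp (𝓕 (∂_{basisVec j} φ : 𝓢(Plane, ℂ))) 1)
  exact (fourierInv_toLp_ae h1 (M.memLp_disp (𝓕 (∂_{basisVec j} φ : 𝓢(Plane, ℂ))) 2)).symm

/-- The test function `φ - bΔφ`. -/
noncomputable def testJ (b : ℝ) (φ : 𝓢(Plane, ℂ)) : 𝓢(Plane, ℂ) := φ + (-(b : ℂ)) • (Δ φ : 𝓢(Plane, ℂ))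

/-- The test function `(1-γ) (∂_jφ + c Δ∂_jφ)`. -/
noncomputable def testB (γ c : ℝ) (φ : 𝓢(Plane, ℂ)) (j : Fin 2) : 𝓢(Plane, ℂ) :=
  ((1 - γ : ℝ) : ℂ) • ((∂_{basisVec j} φ : 𝓢(Plane, ℂ)) +
    (c : ℂ) • (Δ (∂_{basisVec j} φ : 𝓢(Plane, ℂ)) : 𝓢(Plane, ℂ)))

/-- The test data in Fourier variables of a Schwartz function. -/
noncomputable def test (φ : 𝓢(Plane, ℂ)) : P.Test where
  h := (𝓕 φ : 𝓢(Plane, ℂ))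
  hJ := 𝓕 ((testJ b φ).toLp 2 : L2Space ℂ)
  hD j := 𝓕 ((∂_{basisVec j} φ : 𝓢(Plane, ℂ)).toLp 2 : L2Space ℂ)
  hA j := ((1 / γ : ℝ) : ℂ) • 𝓕 ((∂_{basisVec j} φ : 𝓢(Plane, ℂ)).toLp 2 : L2Space ℂ) + M.hM φ j
  hB j := 𝓕 ((testB γ c φ j).toLp 2 : L2Space ℂ)
  hJ_ae := by
    refine (fourier_toLp_ae _).trans (Eventually.of_forall fun ξ => ?_)
    have e : (𝓕 (testJ b φ) : 𝓢(Plane, ℂ)) = 𝓕 φ + (-(b : ℂ)) • 𝓕 (Δ φ : 𝓢(Plane, ℂ)) := by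
      rw [testJ, FourierTransform.fourier_add, FourierTransform.fourier_smul]
    simp only [e, add_apply, smul_apply, fourier_laplacian_apply, M.J_eq,
      smul_eq_mul]
    push_cast
    ring
  hD_ae j := by
    refine (fourier_toLp_ae _).trans (Eventually.of_forall fun ξ => ?_)
    exact fourier_lineDeriv_apply φ j ξ
  hA_ae j := by
    filter_upwards [Lp.coeFn_add (((1 / γ : ℝ) : ℂ) •
      𝓕 ((∂_{basisVec j} φ : 𝓢(Plane, ℂ)).toLp 2 : L2Space ℂ)) (M.hM φ j),
      Lp.coeFn_smul ((1 / γ : ℝ) : ℂ) (𝓕 ((∂_{basisVec j} φ : 𝓢(Plane, ℂ)).toLp 2 : L2Space ℂ)),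
      fourier_toLp_ae (∂_{basisVec j} φ : 𝓢(Plane, ℂ)),
      (M.memLp_disp (𝓕 (∂_{basisVec j} φ : 𝓢(Plane, ℂ))) 2).coeFn_toLp] with ξ h1 h2 h3 h4
    rw [h1, Pi.add_apply, h2, Pi.smul_apply, h3, hM, h4, fourier_lineDeriv_apply, M.be_eq,
      smul_eq_mul]
    push_cast
    ring
  hB_ae j := by
    refine (fourier_toLp_ae _).trans (Eventually.of_forall fun ξ => ?_)
    have e : (𝓕 (testB γ c φ j) : 𝓢(Plane, ℂ)) = ((1 - γ : ℝ) : ℂ) •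
        (𝓕 (∂_{basisVec j} φ : 𝓢(Plane, ℂ)) +
          (c : ℂ) • 𝓕 (Δ (∂_{basisVec j} φ : 𝓢(Plane, ℂ)) : 𝓢(Plane, ℂ))) := by
      rw [testB, FourierTransform.fourier_smul, FourierTransform.fourier_add,
        FourierTransform.fourier_smul]
    simp only [e, add_apply, smul_apply, fourier_laplacian_apply, M.al_eq,
      smul_eq_mul, fourier_lineDeriv_apply]
    push_cast
    ring

variable {Z : State} {ζ : Plane → ℝ} {v : Plane → Plane}

lemma lhs_zeta (hZ : P.Represents Z ζ v) (φ : 𝓢(Plane, ℂ)) :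
    ∫ x, (ζ x : ℂ) * (φ x - ((b * 1 : ℝ) : ℂ) * (Δ φ) x) =
      (M.test φ).functional none (P.hamiltonian.R Z) := by
  change _ = pairL2 ((P.qSymb none).op ((besselSymb StateVal).op Z)) _
  rw [qSymb_besselSymb]
  refine integral_eq_pairL2 hZ.zeta ?_
  filter_upwards [(testJ b φ).coeFn_toLp 2] with x h
  rw [h, mul_one, testJ, add_apply, smul_apply, smul_eq_mul, neg_mul, sub_eq_add_neg]

lemma lhs_v (hZ : P.Represents Z ζ v) (j : Fin 2) (φ : 𝓢(Plane, ℂ)) :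
    ∫ x, (v x j : ℂ) * (φ x - ((b * 1 : ℝ) : ℂ) * (Δ φ) x) =
      (M.test φ).functional (some j) (P.hamiltonian.R Z) := by
  change _ = pairL2 ((P.qSymb (some j)).op ((besselSymb StateVal).op Z)) _
  rw [qSymb_besselSymb]
  refine integral_eq_pairL2 (hZ.vec j) ?_
  filter_upwards [(testJ b φ).coeFn_toLp 2] with x h
  rw [h, mul_one, testJ, add_apply, smul_apply, smul_eq_mul, neg_mul, sub_eq_add_neg]

lemma pairL2_fourierInv_reProd (f g : L2Space ℂ) {u w : Plane → ℝ}
    (hu : (fun x => (u x : ℂ)) =ᵐ[volume] besselFourier f)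
    (hw : (fun x => (w x : ℂ)) =ᵐ[volume] besselFourier g) (ψ : 𝓢(Plane, ℂ)) :
    pairL2 (𝓕⁻ (reProd f g)) (𝓕 (ψ.toLp 2 : L2Space ℂ)) = ∫ x, ((u x * w x : ℝ) : ℂ) * ψ x ∧
      Integrable (fun x => ((u x * w x : ℝ) : ℂ) * ψ x) volume := by
  have e : (fun x => reProd f g x * (ψ.toLp 2 : L2Space ℂ) x) =ᵐ[volume]
      fun x => ((u x * w x : ℝ) : ℂ) * ψ x := by
    filter_upwards [reProd_ae f g, hu, hw, ψ.coeFn_toLp 2] with x h1 h2 h3 h4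
    rw [h1, h4, reMul, ← h2, ← h3, Complex.ofReal_re, Complex.ofReal_re]
  rw [pairL2_fourierInv_fourier, pairL2_apply]
  exact ⟨integral_congr_ae e, (integrable_L2_mul _ _).congr e⟩

lemma integrable_mul_schwartz {f : L2Space ℂ} {u : Plane → ℝ}
    (hu : (fun x => (u x : ℂ)) =ᵐ[volume] besselFourier f) (ψ : 𝓢(Plane, ℂ)) :
    Integrable (fun x => (u x : ℂ) * ψ x) volume := by
  refine (integrable_L2_mul (besselFourier f) (ψ.toLp 2)).congr ?_
  filter_upwards [hu, ψ.coeFn_toLp 2] with x h1 h2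
  rw [h2, ← h1]

/-- The linear flux (1/γ)∇·v and the dispersive multiplier together form be, while the product ζv is
the nonlinear interaction. -/
lemma rhs_zeta (hZ : P.Represents Z ζ v) (φ : 𝓢(Plane, ℂ)) :
    ∑ j : Fin 2, ((1 / γ : ℝ) *
        (∫ x, (((1 - 1 * ζ x) * v x j : ℝ) : ℂ) * (∂_{basisVec j} φ) x) +
      ∫ x, (v x j : ℂ) * multiplier (dispSymbol γ a 1 μ₂) (∂_{basisVec j} φ : 𝓢(Plane, ℂ)) x) =
    (M.test φ).functional none (P.hamiltonian.K Z + P.hamiltonian.R (P.hamiltonian.N Z)) := by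
  rw [Test.functional_rhs_none]
  refine Finset.sum_congr rfl fun j _ => ?_
  obtain ⟨h1, h2⟩ := pairL2_fourierInv_reProd _ _ hZ.zeta (hZ.vec j)
    (∂_{basisVec j} φ : 𝓢(Plane, ℂ))
  have h3 : ∫ x, (((1 - 1 * ζ x) * v x j : ℝ) : ℂ) * (∂_{basisVec j} φ) x =
      (∫ x, (v x j : ℂ) * (∂_{basisVec j} φ) x) -
        ∫ x, ((ζ x * v x j : ℝ) : ℂ) * (∂_{basisVec j} φ) x := by
    rw [← integral_sub (integrable_mul_schwartz (hZ.vec j) _) h2]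
    refine integral_congr_ae (Eventually.of_forall fun x => ?_)
    push_cast
    ring
  have h4 := integral_eq_pairL2 (χ := 𝓕⁻ (M.hM φ j)) (hZ.vec j) (M.multiplier_ae φ j)
  rw [FourierTransform.fourier_fourierInv_eq] at h4
  have h5 := integral_eq_pairL2 (hZ.vec j) ((∂_{basisVec j} φ : 𝓢(Plane, ℂ)).coeFn_toLp 2).symm
  rw [h3, h4, h5, ← h1, M.γ_eq]
  change _ = pairL2 _ (_ • _ + _) - _ * _
  rw [map_add, map_smul, smul_eq_mul]
  simp only [test]
  ring

lemma rhs_v (hZ : P.Represents Z ζ v) (j : Fin 2) (φ : 𝓢(Plane, ℂ)) :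
    (1 - γ : ℝ) * (∫ x, (ζ x : ℂ) *
          ((∂_{basisVec j} φ) x + ((c * 1 : ℝ) : ℂ) * (Δ (∂_{basisVec j} φ)) x)) -
        (1 / (2 * γ) : ℝ) * ∫ x, ((‖v x‖ ^ 2 : ℝ) : ℂ) * (∂_{basisVec j} φ) x =
    (M.test φ).functional (some j) (P.hamiltonian.K Z + P.hamiltonian.R (P.hamiltonian.N Z)) := by
  rw [Test.functional_rhs_some]
  have h := fun k => pairL2_fourierInv_reProd _ _ (hZ.vec k) (hZ.vec k)
    (∂_{basisVec j} φ : 𝓢(Plane, ℂ))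
  have h3 : ∫ x, ((‖v x‖ ^ 2 : ℝ) : ℂ) * (∂_{basisVec j} φ) x =
      ∑ k, ∫ x, ((v x k * v x k : ℝ) : ℂ) * (∂_{basisVec j} φ) x := by
    rw [← integral_finsetSum _ fun k _ => (h k).2]
    refine integral_congr_ae (Eventually.of_forall fun x => ?_)
    simp only [EuclideanSpace.norm_sq_eq, Fin.sum_univ_two, Real.norm_eq_abs, sq_abs]
    push_cast
    ring
  have h5 := integral_eq_pairL2 hZ.zeta ((testB γ c φ j).coeFn_toLp 2).symm
  have h6 : ∫ x, (ζ x : ℂ) * testB γ c φ j x = (1 - γ : ℝ) * (∫ x, (ζ x : ℂ) *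
      ((∂_{basisVec j} φ) x + ((c * 1 : ℝ) : ℂ) * (Δ (∂_{basisVec j} φ)) x)) := by
    rw [← integral_const_mul]
    refine integral_congr_ae (Eventually.of_forall fun x => ?_)
    simp only [testB, smul_apply, add_apply, smul_eq_mul, mul_one]
    ring
  rw [h3, ← h6, h5, M.γ_eq]
  simp only [← (h _).1]
  rfl

end Models
end Weights
end Weak

/-! ### Equivalence with the equation for states and well-posedness for small data. -/

section WellPosed

namespace Weights.Models

variable {P : Weights} {γ a b c μ₂ : ℝ} (M : P.Models γ a b c μ₂)

/-- The transforms of test functions range over all Schwartz functions, so J times each component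
vanishes as a distribution, and J is positive. -/
lemma eq_zero_of_functional_eq_zero {Y : State}
    (h : ∀ i (φ : 𝓢(Plane, ℂ)), (M.test φ).functional i Y = 0) : Y = 0 := by
  refine ext_qSymb (P := P) fun i => ?_
  rw [map_zero, Lp.eq_zero_iff_ae_eq_zero]
  have hJ : Continuous fun ξ : Plane => ((1 + b * (2 * Real.pi * ‖ξ‖) ^ 2 : ℝ) : ℂ) := by
    fun_prop
  have hl : LocallyIntegrable (fun ξ => ((1 + b * (2 * Real.pi * ‖ξ‖) ^ 2 : ℝ) : ℂ) *
      (P.qSymb i).op Y ξ) volume := by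
    rw [locallyIntegrable_iff]
    intro k hk
    exact (((Lp.memLp ((P.qSymb i).op Y)).locallyIntegrable (by norm_num)).integrableOn_isCompact
      hk).continuousOn_mul hJ.continuousOn hk
  have h0 := ae_eq_zero_of_forall_schwartz hl fun ψ => ?_
  · filter_upwards [h0] with ξ hξ
    have h1 := (P.J_pos ξ).ne'
    rw [M.J_eq] at h1
    exact (mul_eq_zero.1 hξ).resolve_left (Complex.ofReal_ne_zero.2 h1)
  · have h2 := h i (𝓕⁻ ψ)
    rw [Test.functional_apply, pairL2_apply] at h2
    rw [← h2]
    refine integral_congr_ae ?_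
    filter_upwards [(M.test (𝓕⁻ ψ)).hJ_ae] with ξ h3
    rw [h3, M.J_eq]
    have : (M.test (𝓕⁻ ψ)).h ξ = ψ ξ := by
      change (𝓕 (𝓕⁻ ψ) : 𝓢(Plane, ℂ)) ξ = _
      rw [FourierTransform.fourier_fourierInv_eq]
    rw [this]
    ring

lemma hasDerivWithinAt_functional {V : ℝ → State} {ζ : ℝ → Plane → ℝ} {v : ℝ → Plane → Plane}
    (hV : ∀ t, 0 ≤ t → P.Represents (V t) (ζ t) (v t))
    {ζ₀ : Plane → ℝ} {v₀ : Plane → Plane} (hs : IsGlobalSolution γ a b c b 1 1 μ₂ ζ₀ v₀ ζ v)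
    (i : Option (Fin 2)) (φ : 𝓢(Plane, ℂ)) {t : ℝ} (ht : 0 ≤ t) :
    HasDerivWithinAt (fun s => (M.test φ).functional i (P.hamiltonian.R (V s)))
      ((M.test φ).functional i
        (P.hamiltonian.K (V t) + P.hamiltonian.R (P.hamiltonian.N (V t)))) (Ici 0) t := by
  cases i with
  | none =>
    rw [← M.rhs_zeta (hV t ht)]
    exact (hs.eq_zeta φ t ht).congr (fun s h => (M.lhs_zeta (hV s h) φ).symm)
      (M.lhs_zeta (hV t ht) φ).symm
  | some j =>
    rw [← M.rhs_v (hV t ht)]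
    exact (hs.eq_v j φ t ht).congr (fun s h => (M.lhs_v (hV s h) j φ).symm)
      (M.lhs_v (hV t ht) j φ).symm

include M in
-- Distributional solutions are solutions of the Hilbert space equation, so uniqueness holds in the
-- full class of the theorem.
lemma exists_state {ζ₀ : Plane → ℝ} {v₀ : Plane → Plane} {ζ : ℝ → Plane → ℝ}
    {v : ℝ → Plane → Plane} (hs : IsGlobalSolution γ a b c b 1 1 μ₂ ζ₀ v₀ ζ v) :
    ∃ V : ℝ → State, (∀ t, 0 ≤ t → P.Represents (V t) (ζ t) (v t)) ∧ ContinuousOn V (Ici 0) ∧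
      ∀ t, 0 ≤ t → HasDerivWithinAt (fun s => P.hamiltonian.R (V s))
        (P.hamiltonian.K (V t) + P.hamiltonian.R (P.hamiltonian.N (V t))) (Ici 0) t := by
  obtain ⟨hfin, hcont⟩ := hs.continuous
  have hex : ∀ t, ∃ Z, 0 ≤ t → P.Represents Z (ζ t) (v t) := fun t => by
    by_cases ht : 0 ≤ t
    · obtain ⟨Z, hZ⟩ := exists_represents (P := P) (hfin t ht).1 (hfin t ht).2
      exact ⟨Z, fun _ => hZ⟩
    · exact ⟨0, fun h => absurd h ht⟩
  choose V hV using hex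
  have hVc : ContinuousOn V (Ici 0) := by
    intro t ht
    rw [ContinuousWithinAt, tendsto_iff_edist_tendsto_0]
    have h1 : Tendsto (fun s => ENNReal.ofReal (2 * √P.hi) *
        (xNorm 1 (ζ s - ζ t) + xNormVec 1 (v s - v t))) (𝓝[Ici 0] t) (𝓝 0) := by
      have := ENNReal.Tendsto.const_mul (hcont t ht) (Or.inr ENNReal.ofReal_ne_top)
        (a := ENNReal.ofReal (2 * √P.hi))
      rwa [mul_zero] at this
    refine tendsto_of_tendsto_of_tendsto_of_le_of_le' tendsto_const_nhds h1
      (Eventually.of_forall fun _ => zero_le) ?_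
    filter_upwards [self_mem_nhdsWithin] with s hs
    rw [edist_eq_enorm_sub, ← ofReal_norm]
    exact ((hV s hs).sub (hV t ht)).enorm_le
  refine ⟨V, hV, hVc, ?_⟩
  set H := P.hamiltonian with hH
  have hNc : Continuous H.N := H.continuous_N
  have hfc : ContinuousOn (fun s => H.K (V s) + H.R (H.N (V s))) (Ici 0) :=
    (H.K.continuous.comp_continuousOn hVc).add
      ((H.R.continuous.comp hNc).comp_continuousOn hVc)
  obtain ⟨F, hF0, hF⟩ := exists_primitive hfc
  -- The weak equation only gives scalar derivatives, one test at a time. Comparison with the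
  -- primitive of the continuous right-hand side promotes them to a derivative in norm.
  have hconst : ∀ t, 0 ≤ t → H.R (V t) = H.R (V 0) + F t := by
    intro t ht
    rw [← sub_eq_zero]
    refine M.eq_zero_of_functional_eq_zero fun i φ => ?_
    set L := (M.test φ).functional i
    have hd : ∀ τ, 0 ≤ τ → HasDerivWithinAt (fun τ => L (H.R (V τ)) - L (F τ)) 0
        (Ici 0) τ := fun τ hτ => by
      have h := (M.hasDerivWithinAt_functional hV hs i φ hτ).sub
        (L.hasFDerivAt.comp_hasDerivWithinAt τ (hF τ hτ))
      rwa [sub_self] at h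
    have := constant_of_has_deriv_right_zero (a := 0) (b := t)
      (fun τ hτ => (hd τ hτ.1).continuousWithinAt.mono Icc_subset_Ici_self)
      (fun τ hτ => (hd τ hτ.1).mono (Ici_subset_Ici.2 hτ.1)) t (right_mem_Icc.2 ht)
    simp only [hF0, map_zero, sub_zero] at this
    rw [map_sub, map_add, ← this]
    ring
  exact fun t ht => ((hF t ht).const_add _).congr (fun s hs => hconst s hs) (hconst t ht)

/-- `sharpState` commutes with every term, so it maps the solution to a solution with the same data;
uniqueness concludes. -/
lemma sharpState_solution {U : ℝ → State} (hUc : ContinuousOn U (Ici 0))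
    (hU : ∀ t, 0 ≤ t → HasDerivWithinAt (fun s => P.hamiltonian.R (U s))
        (P.hamiltonian.K (U t) + P.hamiltonian.R (P.hamiltonian.N (U t))) (Ici 0) t)
    (h0 : sharpState (U 0) = U 0) {t : ℝ} (ht : 0 ≤ t) : sharpState (U t) = U t := by
  have hR : ∀ Z, P.hamiltonian.R (sharpState Z) = sharpState (P.hamiltonian.R Z) :=
    besselSymb_sharpState
  have hK : ∀ Z, P.hamiltonian.K (sharpState Z) = sharpState (P.hamiltonian.K Z) := P.kSymb_sharp
  have hN : ∀ Z, P.hamiltonian.N (sharpState Z) = sharpState (P.hamiltonian.N Z) := fun Z => by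
    rw [HamiltonianData.N, HamiltonianData.N, ← hK]
    exact congrArg _ (P.quad_sharp Z Z)
  refine P.hamiltonian.global_solution_unique (sharpState.continuous.comp_continuousOn hUc) hUc
    (fun t ht => ?_) hU h0 ht
  have h := sharpState.hasFDerivAt.comp_hasDerivWithinAt t (hU t ht)
  rw [map_add, ← hK, ← hR, ← hN] at h
  exact h.congr (fun s _ => hR (U s)) (hR (U t))

include M in
lemma isGlobalSolution_of_state {U : ℝ → State} {ζ : ℝ → Plane → ℝ} {v : ℝ → Plane → Plane}
    (hUc : ContinuousOn U (Ici 0))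
    (hU : ∀ t, 0 ≤ t → HasDerivWithinAt (fun s => P.hamiltonian.R (U s))
        (P.hamiltonian.K (U t) + P.hamiltonian.R (P.hamiltonian.N (U t))) (Ici 0) t)
    (hr : ∀ t, 0 ≤ t → P.Represents (U t) (ζ t) (v t)) {ζ₀ : Plane → ℝ} {v₀ : Plane → Plane}
    (h0 : P.Represents (U 0) ζ₀ v₀) : IsGlobalSolution γ a b c b 1 1 μ₂ ζ₀ v₀ ζ v := by
  have h1 := (hr 0 le_rfl).ae_eq h0
  refine ⟨⟨fun t ht => ?_, fun t ht => ?_⟩, h1.1, h1.2, fun φ t ht => ?_, fun j φ t ht => ?_⟩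
  · exact ENNReal.add_lt_top.1 ((hr t ht).xNorm_add_le.trans_lt ENNReal.ofReal_lt_top)
  · have h2 : Tendsto (fun s => ENNReal.ofReal (6 * Real.pi * (√P.lo)⁻¹ * ‖U s - U t‖))
        (𝓝[Ici 0] t) (𝓝 0) := by
      have h3 := ENNReal.tendsto_ofReal
        ((((hUc t ht).sub_const (U t)).norm).const_mul (6 * Real.pi * (√P.lo)⁻¹))
      simpa using h3
    refine tendsto_of_tendsto_of_tendsto_of_le_of_le' tendsto_const_nhds h2
      (Eventually.of_forall fun _ => zero_le) ?_
    filter_upwards [self_mem_nhdsWithin] with s hs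
    exact ((hr s hs).sub (hr t ht)).xNorm_add_le
  · rw [M.rhs_zeta (hr t ht)]
    exact (((M.test φ).functional none).hasFDerivAt.comp_hasDerivWithinAt t (hU t ht)).congr
      (fun s h => M.lhs_zeta (hr s h) φ) (M.lhs_zeta (hr t ht) φ)
  · rw [M.rhs_v (hr t ht)]
    exact (((M.test φ).functional (some j)).hasFDerivAt.comp_hasDerivWithinAt t (hU t ht)).congr
      (fun s h => M.lhs_v (hr s h) j φ) (M.lhs_v (hr t ht) j φ)

include M in
theorem hasUniqueBoundedGlobalSolution {η : ℝ}
    (hη : 2 * √P.hi * η ≤ 1 / (8 * quadBound P.γ P.lo)) {ζ₀ : Plane → ℝ} {v₀ : Plane → Plane}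
    (h₀ : xNorm 1 ζ₀ + xNormVec 1 v₀ ≤ ENNReal.ofReal η) :
    HasUniqueBoundedGlobalSolution (24 * Real.pi * (√P.lo)⁻¹ * √P.hi) γ a b c b 1 1 μ₂ ζ₀ v₀ := by
  obtain ⟨h1, h2⟩ := ENNReal.add_lt_top.1 (h₀.trans_lt ENNReal.ofReal_lt_top)
  obtain ⟨Z, hZ⟩ := exists_represents (P := P) h1 h2
  have hg := quadBound_pos P.γ_pos P.lo_pos
  have hZn : ‖Z‖ ≤ 1 / (8 * quadBound P.γ P.lo) := by
    have h3 : ENNReal.ofReal ‖Z‖ ≤ ENNReal.ofReal (2 * √P.hi * η) := by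
      refine hZ.enorm_le.trans ?_
      rw [ENNReal.ofReal_mul (by positivity : 0 ≤ 2 * √P.hi)]
      gcongr
    have h4 : ENNReal.ofReal ‖Z‖ ≤ ENNReal.ofReal (1 / (8 * quadBound P.γ P.lo)) :=
      h3.trans (ENNReal.ofReal_le_ofReal hη)
    exact (ENNReal.ofReal_le_ofReal_iff (by positivity)).1 h4
  obtain ⟨U, hU0, hUc, hUb, hU⟩ := P.hamiltonian.exists_global_solution hg P.norm_quad_le
    norm_besselSymb_op_le hZn
  have hsharp : ∀ t, 0 ≤ t → sharpState (U t) = U t := fun t ht =>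
    sharpState_solution hUc hU (hU0 ▸ hZ.sharpState_eq) ht
  have hr : ∀ t, 0 ≤ t → P.Represents (U t) (P.zetaOf (U t)) (P.vecOf (U t)) := fun t ht =>
    represents_of_sharpState_eq (hsharp t ht)
  refine ⟨fun t => P.zetaOf (U t), fun t => P.vecOf (U t),
    M.isGlobalSolution_of_state hUc hU hr (hU0 ▸ hZ), fun t ht => ?_, fun ζ' v' hs t ht => ?_⟩
  -- The constant is 24 = 6 · 2 · 2: norm of functions by norm of state, growth along the flow, and
  -- norm of the initial state by that of the data.
  · calc _ ≤ ENNReal.ofReal (6 * Real.pi * (√P.lo)⁻¹ * ‖U t‖) := (hr t ht).xNorm_add_le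
      _ ≤ ENNReal.ofReal (12 * Real.pi * (√P.lo)⁻¹ * ‖Z‖) := by
          refine ENNReal.ofReal_le_ofReal ?_
          calc _ ≤ 6 * Real.pi * (√P.lo)⁻¹ * (2 * ‖Z‖) := by gcongr; exact hUb t ht
            _ = _ := by ring
      _ = ENNReal.ofReal (12 * Real.pi * (√P.lo)⁻¹) * ENNReal.ofReal ‖Z‖ :=
          ENNReal.ofReal_mul (by positivity)
      _ ≤ ENNReal.ofReal (12 * Real.pi * (√P.lo)⁻¹) *
          (ENNReal.ofReal (2 * √P.hi) * (xNorm 1 ζ₀ + xNormVec 1 v₀)) := by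
          gcongr
          exact hZ.enorm_le
      _ = _ := by
          rw [← mul_assoc, ← ENNReal.ofReal_mul (by positivity)]
          congr 2
          ring
  · obtain ⟨V, hV, hVc, hVd⟩ := M.exists_state hs
    have hV0 : V 0 = U 0 := by
      rw [hU0]
      exact (hV 0 le_rfl).unique (hZ.congr hs.initial_zeta hs.initial_v)
    have e := P.hamiltonian.global_solution_unique hVc hUc hVd hU hV0 ht
    exact (e ▸ hV t ht).ae_eq (hr t ht)

end Weights.Models
end WellPosed

/-! ### Two-sided bounds for the symbols, uniform in μ₂. -/

section SymbolBounds

lemma le_rCoth {μ₂ r : ℝ} (hμ : 0 < μ₂) (hr : 0 ≤ r) : r ≤ rCoth μ₂ r := by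
  have hs := Real.sqrt_pos.2 hμ
  rw [rCoth]
  split_ifs with h
  · rw [h]; positivity
  · have hr' : 0 < r := lt_of_le_of_ne hr (Ne.symm h)
    refine le_mul_of_one_le_right hr ?_
    rw [one_le_div (Real.sinh_pos_iff.2 (mul_pos hs hr'))]
    exact (Real.sinh_lt_cosh _).le

/-- From cosh y - sinh y = e^(-y) ≤ 1 and y ≤ sinh y, with y = √μ₂ r, one gets r coth y ≤ r + r /
sinh y ≤ r + 1/√μ₂. -/
lemma rCoth_le {μ₂ r : ℝ} (hμ : 0 < μ₂) (hr : 0 ≤ r) : rCoth μ₂ r ≤ r + 1 / √μ₂ := by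
  have hs := Real.sqrt_pos.2 hμ
  rw [rCoth]
  split_ifs with h
  · rw [h, zero_add]
  · have hr' : 0 < r := lt_of_le_of_ne hr (Ne.symm h)
    have h1 : 0 < √μ₂ * r := mul_pos hs hr'
    have h2 := Real.sinh_pos_iff.2 h1
    have h3 : √μ₂ * r ≤ Real.sinh (√μ₂ * r) := Real.self_le_sinh_iff.2 h1.le
    have h4 : Real.cosh (√μ₂ * r) - Real.sinh (√μ₂ * r) ≤ 1 := by
      rw [Real.cosh_sub_sinh]
      exact Real.exp_le_one_iff.2 (by linarith)
    rw [← mul_div_assoc, div_le_iff₀ h2]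
    have h5 : r ≤ 1 / √μ₂ * Real.sinh (√μ₂ * r) := by
      rw [one_div, le_inv_mul_iff₀ hs]
      exact h3
    nlinarith

lemma measurable_rCoth (μ₂ : ℝ) : Measurable (rCoth μ₂) := by
  unfold rCoth
  refine Measurable.ite (measurableSet_singleton 0) measurable_const ?_
  exact measurable_id.mul ((Real.measurable_cosh.comp (measurable_id.const_mul _)).div
    (Real.measurable_sinh.comp (measurable_id.const_mul _)))

lemma one_add_dispSymbol_eq {γ a μ₂ : ℝ} (hγ : 0 < γ) (ξ : Plane) :
    1 / γ + dispSymbol γ a 1 μ₂ ξ = 1 / γ *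
      (1 - rCoth μ₂ ‖ξ‖ / γ + (rCoth μ₂ ‖ξ‖ / γ) ^ 2 - a * ‖ξ‖ ^ 2) := by
  rw [dispSymbol, Real.sqrt_one]
  field_simp
  ring

lemma norm_two_pi_smul (ξ : Plane) : ‖(2 * Real.pi) • ξ‖ = 2 * Real.pi * ‖ξ‖ := by
  rw [norm_smul, Real.norm_of_nonneg (by positivity)]

lemma one_le_two_pi_sq : (1 : ℝ) ≤ (2 * Real.pi) ^ 2 := by nlinarith [Real.pi_gt_three]

/-- With x = q/γ, the identity 1 - x + x² = (1 + x²)/2 + (1 - x)²/2 absorbs the negative dispersive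
term, and x ≥ r because coth ≥ 1 and γ < 1; the sign of a only helps. For the upper bound, q ≤ r +
1/√m uses only the lower bound m on μ₂. -/
lemma beSymbol_mem {γ a m μ₂ : ℝ} (hγ : γ ∈ Ioo (0 : ℝ) 1) (ha : a ≤ 0) (hm : 0 < m)
    (hμ : m ≤ μ₂) (ξ : Plane) : 1 / γ + dispSymbol γ a 1 μ₂ ((2 * Real.pi) • ξ) ∈
      Icc (1 / (2 * γ) * (1 + ‖ξ‖ ^ 2))
        (1 / γ * (1 + 2 / (m * γ ^ 2) + (2 / γ ^ 2 - a) * (2 * Real.pi) ^ 2) * (1 + ‖ξ‖ ^ 2)) := by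
  obtain ⟨h0, h1⟩ := hγ
  have hμ0 : 0 < μ₂ := hm.trans_le hμ
  rw [one_add_dispSymbol_eq h0, norm_two_pi_smul]
  set r := 2 * Real.pi * ‖ξ‖ with hr
  have hr0 : 0 ≤ r := by positivity
  have hr2 : r ^ 2 = (2 * Real.pi) ^ 2 * ‖ξ‖ ^ 2 := mul_pow _ _ _
  have hq := le_rCoth hμ0 hr0
  have hq' : rCoth μ₂ r ≤ r + 1 / √m := (rCoth_le hμ0 hr0).trans (by gcongr)
  set q := rCoth μ₂ r
  have hsm := Real.sqrt_pos.2 hm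
  have hn : ‖ξ‖ ^ 2 ≤ r ^ 2 := by
    rw [hr2]; exact le_mul_of_one_le_left (sq_nonneg _) one_le_two_pi_sq
  have hx : r ≤ q / γ := hq.trans (le_div_self (hr0.trans hq) h0 h1.le)
  have hx2 : (q / γ) ^ 2 ≤ 2 / γ ^ 2 * r ^ 2 + 2 / (m * γ ^ 2) := by
    have h2 : q ^ 2 ≤ 2 * r ^ 2 + 2 / m := by
      have h3 : (1 / √m) ^ 2 = 1 / m := by rw [div_pow, Real.sq_sqrt hm.le, one_pow]
      have h4 : q ^ 2 ≤ (r + 1 / √m) ^ 2 := by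
        have := hr0.trans hq
        gcongr
      have h5 := two_mul_le_add_sq r (1 / √m)
      have h6 : 2 / m = 2 * (1 / m) := by ring
      rw [h6, ← h3]
      nlinarith
    rw [div_pow, div_le_iff₀ (by positivity)]
    refine h2.trans_eq ?_
    field_simp
  set x := q / γ
  constructor
  · have h2 : 1 / (2 * γ) * (1 + ‖ξ‖ ^ 2) = 1 / γ * ((1 + ‖ξ‖ ^ 2) / 2) := by field_simp
    rw [h2]
    gcongr
    have h3 : r ^ 2 ≤ x ^ 2 := by gcongr
    nlinarith [sq_nonneg (1 - x), mul_nonneg (neg_nonneg.2 ha) (sq_nonneg r)]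
  · rw [mul_assoc]
    gcongr
    have h3 : 0 ≤ x := hr0.trans hx
    have h4 : (0 : ℝ) ≤ 2 / (m * γ ^ 2) := by positivity
    have h5 : (0 : ℝ) ≤ 2 / γ ^ 2 := by positivity
    have h6 := sq_nonneg (2 * Real.pi)
    have h7 := sq_nonneg ‖ξ‖
    have h8 : 0 ≤ (2 / γ ^ 2 - a) * (2 * Real.pi) ^ 2 := mul_nonneg (by linarith) h6
    calc _ ≤ 1 + (2 / γ ^ 2 * r ^ 2 + 2 / (m * γ ^ 2)) - a * r ^ 2 := by linarith
      _ = 1 + 2 / (m * γ ^ 2) + (2 / γ ^ 2 - a) * (2 * Real.pi) ^ 2 * ‖ξ‖ ^ 2 := by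
          rw [hr2]; ring
      _ ≤ _ := by nlinarith

lemma one_add_mul_sq_mem {e : ℝ} (he : 0 < e) (ξ : Plane) :
    1 + e * (2 * Real.pi * ‖ξ‖) ^ 2 ∈
      Icc (min 1 e * (1 + ‖ξ‖ ^ 2)) ((1 + e * (2 * Real.pi) ^ 2) * (1 + ‖ξ‖ ^ 2)) := by
  have h7 := sq_nonneg ‖ξ‖
  have h6 := one_le_two_pi_sq
  rw [mul_pow]
  constructor
  · have h1 := min_le_left 1 e
    have h2 := min_le_right 1 e
    have h3 : min 1 e * ‖ξ‖ ^ 2 ≤ e * ‖ξ‖ ^ 2 := by gcongr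
    have h4 : e * ‖ξ‖ ^ 2 ≤ e * ((2 * Real.pi) ^ 2 * ‖ξ‖ ^ 2) := by
      gcongr; exact le_mul_of_one_le_left h7 h6
    linarith
  · have h1 : 0 ≤ e * (2 * Real.pi) ^ 2 := by positivity
    nlinarith

/-- What matters is the order of the quantifiers: the bounds are chosen before μ₂. -/
theorem exists_weights {γ a b c m : ℝ} (hγ : γ ∈ Ioo (0 : ℝ) 1) (hb : 0 < b) (ha : a ≤ 0)
    (hc : c < 0) (hm : 0 < m) : ∃ lo hi : ℝ, 0 < lo ∧ ∀ μ₂, m ≤ μ₂ →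
      ∃ P : Weights, P.lo = lo ∧ P.hi = hi ∧ P.Models γ a b c μ₂ := by
  have h0 := hγ.1
  have h1 : 0 < 1 - γ := sub_pos.2 hγ.2
  set l₁ := (1 - γ) * min 1 (-c)
  set l₂ := 1 / (2 * γ)
  set l₃ := min 1 b
  set u₁ := (1 - γ) * (1 + -c * (2 * Real.pi) ^ 2)
  set u₂ := 1 / γ * (1 + 2 / (m * γ ^ 2) + (2 / γ ^ 2 - a) * (2 * Real.pi) ^ 2)
  set u₃ := 1 + b * (2 * Real.pi) ^ 2
  have hl₁ : 0 < l₁ := mul_pos h1 (lt_min one_pos (neg_pos.2 hc))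
  have hl₂ : 0 < l₂ := by positivity
  have hl₃ : 0 < l₃ := lt_min one_pos hb
  have key : ∀ {l u x : ℝ} {ξ : Plane}, min l₁ (min l₂ l₃) ≤ l → u ≤ max u₁ (max u₂ u₃) →
      x ∈ Icc (l * (1 + ‖ξ‖ ^ 2)) (u * (1 + ‖ξ‖ ^ 2)) →
      x ∈ Icc (min l₁ (min l₂ l₃) * (1 + ‖ξ‖ ^ 2)) (max u₁ (max u₂ u₃) * (1 + ‖ξ‖ ^ 2)) := by
    intro l u x ξ hl hu hx
    exact ⟨le_trans (by gcongr) hx.1, hx.2.trans (by gcongr)⟩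
  refine ⟨min l₁ (min l₂ l₃), max u₁ (max u₂ u₃), lt_min hl₁ (lt_min hl₂ hl₃), fun μ₂ hμ => ?_⟩
  have hn : Measurable fun ξ : Plane => ‖ξ‖ := measurable_norm
  refine ⟨{
    γ := γ
    γ_pos := h0
    al := fun ξ => (1 - γ) * (1 - c * (2 * Real.pi * ‖ξ‖) ^ 2)
    be := fun ξ => 1 / γ + dispSymbol γ a 1 μ₂ ((2 * Real.pi) • ξ)
    J := fun ξ => 1 + b * (2 * Real.pi * ‖ξ‖) ^ 2
    measurable_al := by fun_prop
    measurable_be := by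
      have h : Measurable fun ξ : Plane => rCoth μ₂ (2 * Real.pi * ‖ξ‖) :=
        (measurable_rCoth μ₂).comp (hn.const_mul _)
      simp only [dispSymbol, norm_two_pi_smul]
      fun_prop
    measurable_J := by fun_prop
    lo := min l₁ (min l₂ l₃)
    hi := max u₁ (max u₂ u₃)
    lo_pos := lt_min hl₁ (lt_min hl₂ hl₃)
    al_mem := fun ξ => key (min_le_left _ _) (le_max_left _ _) (by
      have h := one_add_mul_sq_mem (neg_pos.2 hc) ξ
      rw [mul_assoc, mul_assoc, sub_eq_add_neg 1 (c * _), ← neg_mul]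
      exact ⟨mul_le_mul_of_nonneg_left h.1 h1.le, mul_le_mul_of_nonneg_left h.2 h1.le⟩)
    be_mem := fun ξ => key ((min_le_right _ _).trans (min_le_left _ _))
      ((le_max_left _ _).trans (le_max_right _ _)) (beSymbol_mem hγ ha hm hμ ξ)
    J_mem := fun ξ => key ((min_le_right _ _).trans (min_le_right _ _))
      ((le_max_right _ _).trans (le_max_right _ _)) (one_add_mul_sq_mem hb ξ)
    even_al := fun ξ => by simp only [norm_neg]
    even_be := fun ξ => by simp only [dispSymbol, smul_neg, norm_neg]
    even_J := fun ξ => by simp only [norm_neg] }, rfl, rfl,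
    ⟨rfl, fun _ => rfl, fun _ => rfl, fun _ => rfl⟩⟩

theorem small_solutions {γ a b c : ℝ} (hγ : γ ∈ Ioo (0 : ℝ) 1) (hb : 0 < b) (ha : a ≤ 0)
    (hc : c < 0) {m : ℝ} (hm : 0 < m) : ∃ C η : ℝ, 0 < C ∧ 0 < η ∧ ∀ μ₂ : ℝ, m ≤ μ₂ →
      ∀ (ζ₀ : Plane → ℝ) (v₀ : Plane → Plane),
        xNorm 1 ζ₀ + xNormVec 1 v₀ ≤ ENNReal.ofReal η →
          HasUniqueBoundedGlobalSolution C γ a b c b 1 1 μ₂ ζ₀ v₀ := by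
  obtain ⟨lo, hi, hlo, h⟩ := exists_weights hγ hb ha hc hm
  have hhi : 0 < hi := by
    obtain ⟨P, -, rfl, -⟩ := h m le_rfl
    exact P.hi_pos
  have h1 := Real.sqrt_pos.2 hlo
  have h2 := Real.sqrt_pos.2 hhi
  have hg := Weights.quadBound_pos hγ.1 hlo
  -- The size η is such that 2√hi η, a bound for the norm of the initial state, equals the smallness
  -- threshold of the abstract theorem.
  refine ⟨24 * Real.pi * (√lo)⁻¹ * √hi, 1 / (8 * Weights.quadBound γ lo) / (2 * √hi),
    by positivity, by positivity, fun μ₂ hμ ζ₀ v₀ h₀ => ?_⟩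
  obtain ⟨P, rfl, rfl, M⟩ := h μ₂ hμ
  refine M.hasUniqueBoundedGlobalSolution ?_ h₀
  rw [M.γ_eq, mul_div_cancel₀ _ (by positivity)]

end SymbolBounds

/-! ### Dilations -/

section Dilation

lemma finrank_plane : Module.finrank ℝ Plane = 2 := by simp

lemma integral_dilate {F : Type*} [NormedAddCommGroup F] [NormedSpace ℝ F] {r : ℝ}
    (f : Plane → F) : ∫ x, f (r⁻¹ • x) = r ^ 2 • ∫ x, f x := by
  rw [Measure.integral_comp_inv_smul, finrank_plane, abs_of_nonneg (sq_nonneg r)]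

lemma lintegral_dilate {r : ℝ} (hr : 0 < r) (f : Plane → ℝ≥0∞) :
    ∫⁻ x, f (r⁻¹ • x) = ENNReal.ofReal (r ^ 2) * ∫⁻ x, f x := by
  have h := (Homeomorph.smulOfNeZero (α := Plane) r⁻¹ (inv_ne_zero hr.ne')).measurableEmbedding
  have h2 := h.lintegral_map (μ := volume) f
  have h3 : Measure.map (⇑(Homeomorph.smulOfNeZero (α := Plane) r⁻¹ (inv_ne_zero hr.ne')))
      volume = ENNReal.ofReal (r ^ 2) • (volume : Measure Plane) := by
    have := Measure.map_addHaar_smul (volume : Measure Plane) (inv_ne_zero hr.ne')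
    rw [finrank_plane, inv_pow, inv_inv, abs_of_nonneg (sq_nonneg r)] at this
    exact this
  rw [h3, lintegral_smul_measure] at h2
  exact h2.symm

lemma quasiMeasurePreserving_smul {r : ℝ} (hr : r ≠ 0) :
    Measure.QuasiMeasurePreserving (fun x : Plane => r • x) volume volume := by
  refine ⟨measurable_const_smul r, ?_⟩
  rw [Measure.map_addHaar_smul _ hr]
  exact Measure.smul_absolutelyContinuous

lemma ae_smul_iff {r : ℝ} (hr : r ≠ 0) {p : Plane → Prop} : (∀ᵐ x, p (r • x)) ↔ ∀ᵐ x, p x := by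
  refine ⟨fun h => ?_, fun h => (quasiMeasurePreserving_smul hr).ae h⟩
  filter_upwards [(quasiMeasurePreserving_smul (inv_ne_zero hr)).ae h] with x hx
  rwa [smul_inv_smul₀ hr] at hx

lemma memLp_two_dilate {r : ℝ} (hr : 0 < r) {f : Plane → ℂ} (hf : MemLp f 2 volume) :
    MemLp (fun x => f (r⁻¹ • x)) 2 volume := by
  refine ⟨hf.1.comp_quasiMeasurePreserving (quasiMeasurePreserving_smul (inv_ne_zero hr.ne')), ?_⟩
  have h : eLpNorm (fun x => f (r⁻¹ • x)) 2 volume ^ 2 < ⊤ := by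
    rw [eLpNorm_two_sq, lintegral_dilate hr (fun x => ‖f x‖ₑ ^ 2), ← eLpNorm_two_sq]
    exact ENNReal.mul_lt_top ENNReal.ofReal_lt_top (ENNReal.pow_lt_top hf.2)
  by_contra h'
  rw [not_lt, top_le_iff] at h'
  rw [h'] at h
  simp at h

/-- The dilation `x ↦ r x` of the plane. -/
noncomputable def dilationEquiv (r : ℝ) (hr : r ≠ 0) : Plane ≃L[ℝ] Plane :=
  ContinuousLinearEquiv.smulLeft (Units.mk0 r hr)

lemma dilationEquiv_apply (r : ℝ) (hr : r ≠ 0) (x : Plane) : dilationEquiv r hr x = r • x := rfl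

/-- The Schwartz function `x ↦ φ (r x)`. -/
noncomputable def dilateSchwartz (r : ℝ) (hr : r ≠ 0) (φ : 𝓢(Plane, ℂ)) : 𝓢(Plane, ℂ) :=
  SchwartzMap.compCLMOfContinuousLinearEquiv ℂ (dilationEquiv r hr) φ

variable {r : ℝ} (hr : r ≠ 0)

lemma dilateSchwartz_apply (φ : 𝓢(Plane, ℂ)) (x : Plane) :
    dilateSchwartz r hr φ x = φ (r • x) := rfl

lemma dilateSchwartz_surjective : Function.Surjective (dilateSchwartz r hr) := fun φ =>
  ⟨dilateSchwartz r⁻¹ (inv_ne_zero hr) φ, by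
    ext x
    rw [dilateSchwartz_apply, dilateSchwartz_apply, inv_smul_smul₀ hr]⟩

lemma lineDeriv_dilateSchwartz (φ : 𝓢(Plane, ℂ)) (m : Plane) :
    (∂_{m} (dilateSchwartz r hr φ) : 𝓢(Plane, ℂ)) =
      (r : ℂ) • dilateSchwartz r hr (∂_{m} φ : 𝓢(Plane, ℂ)) := by
  rw [dilateSchwartz, SchwartzMap.lineDerivOp_compCLMOfContinuousLinearEquiv, dilationEquiv_apply,
    LineDeriv.lineDerivOp_left_smul]
  ext x
  change r • (∂_{m} φ : 𝓢(Plane, ℂ)) (r • x) = (r : ℂ) * (∂_{m} φ : 𝓢(Plane, ℂ)) (r • x)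
  rw [Complex.real_smul]

lemma laplacian_dilateSchwartz (φ : 𝓢(Plane, ℂ)) :
    (Δ (dilateSchwartz r hr φ) : 𝓢(Plane, ℂ)) =
      ((r ^ 2 : ℝ) : ℂ) • dilateSchwartz r hr (Δ φ : 𝓢(Plane, ℂ)) := by
  ext x
  rw [SchwartzMap.laplacian_eq_sum (EuclideanSpace.basisFun (Fin 2) ℝ),
    SchwartzMap.laplacian_eq_sum (EuclideanSpace.basisFun (Fin 2) ℝ)]
  simp only [lineDeriv_dilateSchwartz, LineDeriv.lineDerivOp_smul, Fin.sum_univ_two, smul_apply, add_apply,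
    dilateSchwartz_apply]
  simp only [smul_eq_mul]
  push_cast
  ring

lemma fourier_dilate {r : ℝ} (hr : 0 < r) (f : Plane → ℂ) (ξ : Plane) :
    𝓕 (fun x => f (r⁻¹ • x)) ξ = (r ^ 2 : ℝ) • 𝓕 f (r • ξ) := by
  rw [Real.fourier_eq, Real.fourier_eq, ← integral_dilate]
  refine integral_congr_ae (Eventually.of_forall fun x => ?_)
  simp only [inner_smul_left, inner_smul_right]
  simp [hr.ne']

lemma fourierInv_dilate {r : ℝ} (hr : 0 < r) (f : Plane → ℂ) (ξ : Plane) :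
    𝓕⁻ (fun x => f (r⁻¹ • x)) ξ = (r ^ 2 : ℝ) • 𝓕⁻ f (r • ξ) := by
  rw [Real.fourierInv_eq_fourier_neg, Real.fourierInv_eq_fourier_neg, fourier_dilate hr, smul_neg]

/-- The Fourier transform in `L²` of a dilated function. -/
lemma fourierL2_dilate {r : ℝ} (hr : 0 < r) {F G : L2Space ℂ}
    (h : G =ᵐ[volume] fun ξ => F (r⁻¹ • ξ)) :
    (𝓕 G : L2Space ℂ) =ᵐ[volume] fun x => ((r ^ 2 : ℝ) : ℂ) * (𝓕 F : L2Space ℂ) (r • x) := by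
  have hr' := inv_pos.2 hr
  have hm : MemLp (fun x => ((r ^ 2 : ℝ) : ℂ) * (𝓕 F : L2Space ℂ) (r • x)) 2 volume := by
    have := memLp_two_dilate hr' (Lp.memLp (𝓕 F : L2Space ℂ))
    rw [inv_inv] at this
    exact this.const_mul _
  -- The L² transform is not given by an integral, so the identity is tested against Schwartz
  -- functions, which carry the transform instead.
  have h0 := ae_eq_zero_of_forall_schwartz
    (((Lp.memLp (𝓕 G : L2Space ℂ)).sub hm).locallyIntegrable (by norm_num)) fun φ => ?_
  · filter_upwards [h0] with x hx
    exact sub_eq_zero.1 hx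
  · have i1 : Integrable (fun x => (𝓕 G : L2Space ℂ) x * φ x) volume :=
      (Lp.memLp _).integrable_mul (φ.memLp 2 volume)
    have i2 : Integrable (fun x => ((r ^ 2 : ℝ) : ℂ) * (𝓕 F : L2Space ℂ) (r • x) * φ x) volume :=
      hm.integrable_mul (φ.memLp 2 volume)
    simp only [Pi.sub_apply, sub_mul]
    rw [integral_sub i1 i2, sub_eq_zero]
    have key : ∀ (H : L2Space ℂ) (ψ : 𝓢(Plane, ℂ)),
        ∫ x, (𝓕 H : L2Space ℂ) x * ψ x = ∫ x, H x * 𝓕 ψ x := by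
      intro H ψ
      have h3 := pairL2_fourier H (ψ.toLp 2)
      rw [SchwartzMap.toLp_fourier_eq, pairL2_apply, pairL2_apply] at h3
      refine Eq.trans (integral_congr_ae ?_) (h3.trans (integral_congr_ae ?_))
      · filter_upwards [ψ.coeFn_toLp 2] with x h
        rw [h]
      · filter_upwards [(𝓕 ψ).coeFn_toLp 2] with x h
        rw [h]
    have e1 : ∫ x, ((r ^ 2 : ℝ) : ℂ) * (𝓕 F : L2Space ℂ) (r • x) * φ x =
        ∫ x, (𝓕 F : L2Space ℂ) x * dilateSchwartz r⁻¹ hr'.ne' φ x := by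
      have := integral_dilate (r := r⁻¹) fun x => ((r ^ 2 : ℝ) : ℂ) *
        ((𝓕 F : L2Space ℂ) x * φ (r⁻¹ • x))
      simp only [inv_inv, inv_smul_smul₀ hr.ne'] at this
      simp only [mul_assoc, dilateSchwartz_apply]
      rw [this, integral_const_mul, Complex.real_smul]
      push_cast
      have : (r : ℂ) ≠ 0 := by exact_mod_cast hr.ne'
      field_simp
    have e2 : ∫ x, G x * 𝓕 φ x = ∫ x, F x * 𝓕 (dilateSchwartz r⁻¹ hr'.ne' φ) x := by
      have h4 : ∀ x, 𝓕 (dilateSchwartz r⁻¹ hr'.ne' φ) x = (r ^ 2 : ℝ) • 𝓕 φ (r • x) := fun x => by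
        exact fourier_dilate hr φ x
      have := integral_dilate (r := r) fun x => F x * 𝓕 φ (r • x)
      simp only [smul_inv_smul₀ hr.ne'] at this
      simp only [h4, mul_smul_comm]
      rw [integral_smul, ← this]
      refine integral_congr_ae ?_
      filter_upwards [h] with x hx
      rw [hx]
    rw [key, e1, key, e2]

end Dilation

/-! ### Behaviour of the norm and of the multiplier under rescaling. -/

section Scaling

variable {ε μ : ℝ}

lemma memLp_rescaleSpace_iff (hε : 0 < ε) (hμ : 0 < μ) {u : Plane → ℝ} :
    MemLp (fun x => ((rescaleSpace ε μ u x : ℝ) : ℂ)) 2 volume ↔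
      MemLp (fun x => (u x : ℂ)) 2 volume := by
  have hr := Real.sqrt_pos.2 hμ
  have e : (fun x => ((rescaleSpace ε μ u x : ℝ) : ℂ)) =
      fun x => (ε⁻¹ : ℂ) * (u ((√μ)⁻¹ • x) : ℂ) := by
    funext x; simp [rescaleSpace]
  rw [e]
  constructor
  · intro h
    have h2 := (memLp_two_dilate (inv_pos.2 hr) h).const_mul (ε : ℂ)
    have : (ε : ℂ) ≠ 0 := by exact_mod_cast hε.ne'
    simpa [smul_smul, hr.ne', ← mul_assoc, this] using h2
  · intro h
    exact (memLp_two_dilate hr h).const_mul _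

lemma xNorm_rescaleSpace (hε : 0 < ε) (hμ : 0 < μ) (u : Plane → ℝ) :
    xNorm μ (rescaleSpace ε μ u) = ENNReal.ofReal (√μ / ε) * xNorm 1 u := by
  have hr := Real.sqrt_pos.2 hμ
  by_cases hu : MemLp (fun x => (u x : ℂ)) 2 volume
  swap
  · rw [xNorm, xNorm, dif_neg hu, dif_neg (fun h => hu ((memLp_rescaleSpace_iff hε hμ).1 h)),
      ENNReal.mul_top]
    rw [ne_eq, ENNReal.ofReal_eq_zero, not_le]
    positivity
  set F : L2Space ℂ := 𝓕⁻ (hu.toLp _) with hF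
  have hFu : (fun x => (u x : ℂ)) =ᵐ[volume] (𝓕 F : L2Space ℂ) := by
    rw [hF, FourierTransform.fourier_fourierInv_eq]
    exact hu.coeFn_toLp.symm
  have hm : MemLp (fun ξ => F (√μ • ξ)) 2 volume := by
    have := memLp_two_dilate (inv_pos.2 hr) (Lp.memLp F)
    rwa [inv_inv] at this
  have hG := fourierL2_dilate (r := (√μ)⁻¹) (inv_pos.2 hr) (F := F) (G := hm.toLp _) (by
    rw [inv_inv]; exact hm.coeFn_toLp)
  -- The inverse transform of the rescaled function: the amplitude gives ε⁻¹, and the Jacobian of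
  -- the dilation gives μ.
  set G : L2Space ℂ := ((μ / ε : ℝ) : ℂ) • hm.toLp _ with hGdef
  have hGu : (fun x => ((rescaleSpace ε μ u x : ℝ) : ℂ)) =ᵐ[volume] (𝓕 G : L2Space ℂ) := by
    rw [hGdef, FourierTransform.fourier_smul]
    filter_upwards [hG, Lp.coeFn_smul ((μ / ε : ℝ) : ℂ) (𝓕 (hm.toLp _) : L2Space ℂ),
      (quasiMeasurePreserving_smul (inv_ne_zero hr.ne')).ae hFu] with x h1 h2 h3
    rw [h2, Pi.smul_apply, h1, ← h3, rescaleSpace, inv_pow, Real.sq_sqrt hμ.le]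
    have h4 : (μ : ℂ) ≠ 0 := by exact_mod_cast hμ.ne'
    simp only [smul_eq_mul]
    push_cast
    field_simp
  have e : xNorm μ (rescaleSpace ε μ u) ^ 2 = (ENNReal.ofReal (√μ / ε) * xNorm 1 u) ^ 2 := by
    rw [mul_pow, xNorm_sq hGu, xNorm_sq hFu]
    have h1 := lintegral_dilate (inv_pos.2 hr) fun ξ =>
      ENNReal.ofReal (1 + 1 * (2 * Real.pi * ‖ξ‖) ^ 2) * ‖F ξ‖ₑ ^ 2
    rw [inv_inv] at h1
    have h2 : ∫⁻ ξ, ENNReal.ofReal (1 + μ * (2 * Real.pi * ‖ξ‖) ^ 2) * ‖G ξ‖ₑ ^ 2 =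
        ∫⁻ ξ, ENNReal.ofReal ((μ / ε) ^ 2) *
          (ENNReal.ofReal (1 + 1 * (2 * Real.pi * ‖√μ • ξ‖) ^ 2) * ‖F (√μ • ξ)‖ₑ ^ 2) := by
      refine lintegral_congr_ae ?_
      filter_upwards [Lp.coeFn_smul ((μ / ε : ℝ) : ℂ) (hm.toLp _), hm.coeFn_toLp] with ξ h1 h2
      rw [h1, Pi.smul_apply, h2, enorm_smul, mul_pow ‖((μ / ε : ℝ) : ℂ)‖ₑ, ← ofReal_norm ((μ / ε : ℝ) : ℂ),
        Complex.norm_real, Real.norm_of_nonneg (by positivity), ENNReal.ofReal_pow (by positivity),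
        norm_smul, Real.norm_of_nonneg hr.le]
      have h3 : 1 + 1 * (2 * Real.pi * (√μ * ‖ξ‖)) ^ 2 = 1 + μ * (2 * Real.pi * ‖ξ‖) ^ 2 := by
        have := Real.sq_sqrt hμ.le
        linear_combination (2 * Real.pi * ‖ξ‖) ^ 2 * this
      rw [h3]
      rw [mul_left_comm]
    rw [h2, lintegral_const_mul' _ _ ENNReal.ofReal_ne_top, h1, ← mul_assoc,
      ← ENNReal.ofReal_mul (by positivity), ← ENNReal.ofReal_pow (by positivity)]
    congr 2
    rw [div_pow, div_pow, inv_pow, Real.sq_sqrt hμ.le]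
    field_simp
  exact le_antisymm ((ENNReal.pow_le_pow_left_iff (n := 2) (by norm_num)).1 e.le)
    ((ENNReal.pow_le_pow_left_iff (n := 2) (by norm_num)).1 e.ge)

lemma xNormVec_rescaleSpace (hε : 0 < ε) (hμ : 0 < μ) (w : Plane → Plane) :
    xNormVec μ (rescaleSpace ε μ w) = ENNReal.ofReal (√μ / ε) * xNormVec 1 w := by
  have h : ∀ j, xNorm μ (fun x => rescaleSpace ε μ w x j) =
      ENNReal.ofReal (√μ / ε) * xNorm 1 (fun x => w x j) := fun j =>
    xNorm_rescaleSpace hε hμ fun x => w x j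
  rw [xNormVec, xNormVec]
  simp only [h, mul_pow, ← Finset.mul_sum]
  rw [ENNReal.mul_rpow_of_nonneg _ _ (by norm_num), ← ENNReal.rpow_natCast (ENNReal.ofReal _),
    ← ENNReal.rpow_mul]
  norm_num

lemma rCoth_div_sqrt (hμ : 0 < μ) {μ₂ : ℝ} (hμ₂ : 0 < μ₂) (r : ℝ) :
    rCoth μ₂ ((√μ)⁻¹ * r) = (√μ)⁻¹ * rCoth (μ₂ / μ) r := by
  have h := Real.sqrt_pos.2 hμ
  have h2 := Real.sqrt_pos.2 hμ₂
  rw [rCoth, rCoth, Real.sqrt_div hμ₂.le]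
  by_cases hr : r = 0
  · rw [if_pos hr, if_pos (by rw [hr, mul_zero])]
    field_simp
  · rw [if_neg hr, if_neg (mul_ne_zero (inv_ne_zero h.ne') hr), mul_assoc]
    congr 3 <;> congr 1 <;> field_simp

/-- The powers of μ in the symbol are exactly those compensating the dilation of frequencies; only
the ratio μ₂/μ remains. -/
lemma dispSymbol_rescale (γ a : ℝ) (hμ : 0 < μ) {μ₂ : ℝ} (hμ₂ : 0 < μ₂) (ξ : Plane) :
    dispSymbol γ a μ μ₂ ((√μ)⁻¹ • ξ) = dispSymbol γ a 1 (μ₂ / μ) ξ := by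
  have h := Real.sqrt_pos.2 hμ
  have e : μ = √μ ^ 2 := (Real.sq_sqrt hμ.le).symm
  rw [dispSymbol, dispSymbol, norm_smul, norm_inv, Real.norm_of_nonneg h.le,
    rCoth_div_sqrt hμ hμ₂, Real.sqrt_one]
  generalize rCoth (μ₂ / μ) ‖ξ‖ = q
  generalize ‖ξ‖ = r
  have e2 : μ / γ * (-a * ((√μ)⁻¹ * r) ^ 2 + 1 / γ ^ 2 * ((√μ)⁻¹ * q) ^ 2) =
      μ * (√μ)⁻¹ ^ 2 * (1 / γ * (-a * r ^ 2 + 1 / γ ^ 2 * q ^ 2)) := by ring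
  rw [e2, inv_pow, Real.sq_sqrt hμ.le, mul_inv_cancel₀ hμ.ne', one_mul]
  congr 1
  field_simp

lemma multiplier_dilate {r : ℝ} (hr : 0 < r) (m : Plane → ℝ) (f : Plane → ℂ) (x : Plane) :
    multiplier m f (r • x) = multiplier (fun ξ => m (r⁻¹ • ξ)) (fun y => f (r • y)) x := by
  have h1 : ∀ ξ, 𝓕 (fun y => f (r • y)) ξ = ((r⁻¹ ^ 2 : ℝ) : ℂ) * 𝓕 f (r⁻¹ • ξ) := fun ξ => by
    have := fourier_dilate (inv_pos.2 hr) f ξ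
    rwa [inv_inv, Complex.real_smul] at this
  have h2 := fourierInv_dilate hr (fun ξ => ((r⁻¹ ^ 2 : ℝ) : ℂ) *
    ((m ((2 * Real.pi) • ξ) : ℂ) * 𝓕 f ξ)) x
  have h3 : (fun ξ : Plane => (m (r⁻¹ • (2 * Real.pi) • ξ) : ℂ) * 𝓕 (fun y => f (r • y)) ξ) =
      fun ξ => ((r⁻¹ ^ 2 : ℝ) : ℂ) * ((m ((2 * Real.pi) • r⁻¹ • ξ) : ℂ) * 𝓕 f (r⁻¹ • ξ)) := by
    funext ξ
    rw [h1, smul_comm r⁻¹ (2 * Real.pi) ξ]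
    ring
  rw [multiplier, multiplier, h3, h2]
  have h4 : ∀ (k : ℂ) (g : Plane → ℂ) (y : Plane), 𝓕⁻ (fun ξ => k * g ξ) y = k * 𝓕⁻ g y := by
    intro k g y
    rw [Real.fourierInv_eq, Real.fourierInv_eq, ← integral_const_mul]
    refine integral_congr_ae (Eventually.of_forall fun ξ => ?_)
    simp only [Circle.smul_def, smul_eq_mul]
    ring
  rw [h4, Complex.real_smul, ← mul_assoc, ← Complex.ofReal_mul, inv_pow,
    mul_inv_cancel₀ (by positivity), Complex.ofReal_one, one_mul]

lemma multiplier_const_mul (m : Plane → ℝ) (k : ℂ) (f : Plane → ℂ) (x : Plane) :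
    multiplier m (fun y => k * f y) x = k * multiplier m f x := by
  have h1 : ∀ (g : Plane → ℂ) (ξ : Plane), 𝓕 (fun y => k * g y) ξ = k * 𝓕 g ξ := fun g ξ => by
    rw [Real.fourier_eq, Real.fourier_eq, ← integral_const_mul]
    refine integral_congr_ae (Eventually.of_forall fun ξ => ?_)
    simp only [Circle.smul_def, smul_eq_mul]
    ring
  rw [multiplier, multiplier, Real.fourierInv_eq, Real.fourierInv_eq, ← integral_const_mul]
  refine integral_congr_ae (Eventually.of_forall fun ξ => ?_)
  simp only [Circle.smul_def, smul_eq_mul, h1]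
  ring

lemma hasDerivWithinAt_rescale {L : ℝ → ℂ} {D k : ℂ} {r t : ℝ} (hr : 0 < r)
    (h : HasDerivWithinAt L D (Ici 0) (r * t)) :
    HasDerivWithinAt (fun s => k * L (r * s)) (k * (r * D)) (Ici 0) t := by
  have h1 : HasDerivWithinAt (fun s : ℝ => r * s) r (Ici 0) t := by
    simpa using ((hasDerivAt_id t).const_mul r).hasDerivWithinAt
  have h2 := h.scomp t h1 (fun s hs => mul_nonneg hr.le hs)
  have h3 := h2.const_mul k
  rwa [Complex.real_smul] at h3

lemma hasDerivWithinAt_rescale_iff {L : ℝ → ℂ} {D k : ℂ} {r t : ℝ} (hr : 0 < r) (hk : k ≠ 0) :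
    HasDerivWithinAt (fun s => k * L (r * s)) (k * (r * D)) (Ici 0) t ↔
      HasDerivWithinAt L D (Ici 0) (r * t) := by
  refine ⟨fun h => ?_, hasDerivWithinAt_rescale hr⟩
  have hr' : (r : ℂ) ≠ 0 := by exact_mod_cast hr.ne'
  have h1 : t = r⁻¹ * (r * t) := by rw [inv_mul_cancel_left₀ hr.ne']
  rw [h1] at h
  have h2 := hasDerivWithinAt_rescale (k := k⁻¹) (inv_pos.2 hr) h
  have e : k⁻¹ * (((r⁻¹ : ℝ) : ℂ) * (k * (r * D))) = D := by
    push_cast; field_simp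
  rw [e] at h2
  refine h2.congr (fun s _ => ?_) ?_ <;>
    rw [inv_mul_cancel_left₀ hk, mul_inv_cancel_left₀ hr.ne']

lemma forall_nonneg_mul_iff {r : ℝ} (hr : 0 < r) {p : ℝ → Prop} :
    (∀ t, 0 ≤ t → p (r * t)) ↔ ∀ t, 0 ≤ t → p t := by
  refine ⟨fun h t ht => ?_, fun h t ht => h _ (by positivity)⟩
  have := h (r⁻¹ * t) (by positivity)
  rwa [mul_inv_cancel_left₀ hr.ne'] at this

lemma map_mul_nhdsWithin {r : ℝ} (hr : 0 < r) (t : ℝ) :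
    Filter.map (fun s => r * s) (𝓝[Ici 0] t) = 𝓝[Ici 0] (r * t) := by
  have h := (Homeomorph.mulLeft₀ r hr.ne').isEmbedding.map_nhdsWithin_eq (Ici 0) t
  have h2 : (fun s => r * s) '' Ici 0 = Ici (0 : ℝ) := by
    rw [image_mul_left_Ici hr, mul_zero]
  rw [Homeomorph.coe_mulLeft₀, h2] at h
  exact h

lemma rescale_sub {F : Type*} [AddCommGroup F] [Module ℝ F] (w : ℝ → Plane → F) (s t : ℝ) :
    rescale ε μ w s - rescale ε μ w t =
      rescaleSpace ε μ (w ((√μ)⁻¹ * s) - w ((√μ)⁻¹ * t)) := by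
  funext x
  simp [rescale, rescaleSpace, smul_sub]

lemma continuousInX_rescale_iff (hε : 0 < ε) (hμ : 0 < μ) (ζ : ℝ → Plane → ℝ)
    (v : ℝ → Plane → Plane) :
    ContinuousInX μ (rescale ε μ ζ) (rescale ε μ v) ↔ ContinuousInX 1 ζ v := by
  have hr := inv_pos.2 (Real.sqrt_pos.2 hμ)
  have hk0 : ENNReal.ofReal (√μ / ε) ≠ 0 := by
    rw [ne_eq, ENNReal.ofReal_eq_zero, not_le]
    have := Real.sqrt_pos.2 hμ
    positivity
  have hk : ENNReal.ofReal (√μ / ε) ≠ ⊤ := ENNReal.ofReal_ne_top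
  have e1 : ∀ t, xNorm μ (rescale ε μ ζ t) =
      ENNReal.ofReal (√μ / ε) * xNorm 1 (ζ ((√μ)⁻¹ * t)) := fun t => xNorm_rescaleSpace hε hμ _
  have e2 : ∀ t, xNormVec μ (rescale ε μ v t) =
      ENNReal.ofReal (√μ / ε) * xNormVec 1 (v ((√μ)⁻¹ * t)) :=
    fun t => xNormVec_rescaleSpace hε hμ _
  have e3 : ∀ {x : ℝ≥0∞}, ENNReal.ofReal (√μ / ε) * x < ⊤ ↔ x < ⊤ := by
    intro x
    rw [lt_top_iff_ne_top, lt_top_iff_ne_top, not_iff_not, ENNReal.mul_eq_top]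
    tauto
  unfold ContinuousInX
  refine and_congr ?_ ?_
  · rw [← forall_nonneg_mul_iff hr (p := fun t => xNorm 1 (ζ t) < ⊤ ∧ xNormVec 1 (v t) < ⊤)]
    simp only [e1, e2, e3]
  · rw [← forall_nonneg_mul_iff hr (p := fun t =>
      Tendsto (fun s => xNorm 1 (ζ s - ζ t) + xNormVec 1 (v s - v t)) (𝓝[Ici 0] t) (𝓝 0))]
    refine forall₂_congr fun t _ => ?_
    rw [← map_mul_nhdsWithin hr, tendsto_map'_iff, Function.comp_def]
    simp only [rescale_sub, xNorm_rescaleSpace hε hμ, xNormVec_rescaleSpace hε hμ, ← mul_add]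
    constructor
    · intro h
      have h2 := ENNReal.Tendsto.const_mul (a := (ENNReal.ofReal (√μ / ε))⁻¹) h
        (Or.inr (ENNReal.inv_ne_top.2 hk0))
      simpa only [← mul_assoc, ENNReal.inv_mul_cancel hk0 hk, one_mul, mul_zero] using h2
    · intro h
      have h2 := ENNReal.Tendsto.const_mul (a := ENNReal.ofReal (√μ / ε)) h (Or.inr hk)
      simpa only [mul_zero] using h2

lemma rescaleSpace_ae_iff {F : Type*} [AddCommGroup F] [Module ℝ F] (hε : 0 < ε) (hμ : 0 < μ)
    {u w : Plane → F} :
    rescaleSpace ε μ u =ᵐ[volume] rescaleSpace ε μ w ↔ u =ᵐ[volume] w := by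
  have hr := inv_ne_zero (Real.sqrt_pos.2 hμ).ne'
  refine Iff.trans ?_ (ae_smul_iff hr (p := fun x => u x = w x))
  refine eventually_congr (Eventually.of_forall fun x => ?_)
  simp only [rescaleSpace]
  rw [smul_right_inj (inv_ne_zero hε.ne')]

end Scaling

/-! ### Invariance of the system under rescaling. -/

section Rescaling

variable {γ a b c ε μ μ₂ : ℝ}

lemma sqrt_ne_zero_of_pos (hμ : 0 < μ) : √μ ≠ 0 := (Real.sqrt_pos.2 hμ).ne'

/-- Integration of a rescaled function against a test function. -/
lemma integral_rescale (hμ : 0 < μ) (k : ℂ) (f g : Plane → ℂ) :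
    ∫ x, (k * f ((√μ)⁻¹ • x)) * g x = k * μ * ∫ x, f x * g (√μ • x) := by
  have h := integral_dilate (r := √μ) fun x => (k * f x) * g (√μ • x)
  simp only [smul_inv_smul₀ (sqrt_ne_zero_of_pos hμ)] at h
  rw [h, Real.sq_sqrt hμ.le, Complex.real_smul]
  simp only [mul_assoc]
  rw [integral_const_mul]
  ring

lemma lhs_rescale (hμ : 0 < μ) (e : ℝ) (u : Plane → ℝ) (φ : 𝓢(Plane, ℂ)) :
    ∫ x, ((rescaleSpace ε μ u x : ℝ) : ℂ) * (φ x - ((e * μ : ℝ) : ℂ) * (Δ φ) x) =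
      ((ε⁻¹ * μ : ℝ) : ℂ) * ∫ x, (u x : ℂ) *
        (dilateSchwartz (√μ) (sqrt_ne_zero_of_pos hμ) φ x - ((e * 1 : ℝ) : ℂ) *
          (Δ (dilateSchwartz (√μ) (sqrt_ne_zero_of_pos hμ) φ)) x) := by
  have h := integral_rescale hμ ((ε⁻¹ : ℝ) : ℂ) (fun x => (u x : ℂ))
    fun x => φ x - ((e * μ : ℝ) : ℂ) * (Δ φ) x
  simp only [rescaleSpace, smul_eq_mul, Complex.ofReal_mul] at h ⊢
  rw [h]
  congr 1
  refine integral_congr_ae (Eventually.of_forall fun x => ?_)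
  simp only [laplacian_dilateSchwartz, smul_apply, dilateSchwartz_apply, Real.sq_sqrt hμ.le,
    smul_eq_mul]
  push_cast
  ring

lemma lineDeriv_smul_eq (hμ : 0 < μ) (φ : 𝓢(Plane, ℂ)) (j : Fin 2) (x : Plane) :
    (∂_{basisVec j} φ : 𝓢(Plane, ℂ)) (√μ • x) = (((√μ)⁻¹ : ℝ) : ℂ) *
      (∂_{basisVec j} (dilateSchwartz (√μ) (sqrt_ne_zero_of_pos hμ) φ) : 𝓢(Plane, ℂ)) x := by
  have h : (√μ : ℂ) ≠ 0 := by exact_mod_cast sqrt_ne_zero_of_pos hμ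
  rw [lineDeriv_dilateSchwartz, smul_apply, dilateSchwartz_apply, smul_eq_mul, Complex.ofReal_inv,
    inv_mul_cancel_left₀ h]

/-- The factor ε⁻¹ is the amplitude and μ the Jacobian, as on the time-derivative side. The extra
1/√μ comes from the derivative of the test function and matches the rescaling of time. -/
lemma rhs_zeta_rescale (hε : 0 < ε) (hμ : 0 < μ) (hμ₂ : 0 < μ₂) (ζ : Plane → ℝ)
    (v : Plane → Plane) (φ : 𝓢(Plane, ℂ)) (j : Fin 2) :
    (1 / γ : ℝ) * (∫ x, (((1 - ε * rescaleSpace ε μ ζ x) * rescaleSpace ε μ v x j : ℝ) : ℂ) *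
          (∂_{basisVec j} φ) x) +
        ∫ x, ((rescaleSpace ε μ v x j : ℝ) : ℂ) *
          multiplier (dispSymbol γ a μ μ₂) (∂_{basisVec j} φ : 𝓢(Plane, ℂ)) x =
      ((ε⁻¹ * μ : ℝ) : ℂ) * (((√μ)⁻¹ : ℝ) * ((1 / γ : ℝ) *
        (∫ x, (((1 - 1 * ζ x) * v x j : ℝ) : ℂ) *
          (∂_{basisVec j} (dilateSchwartz (√μ) (sqrt_ne_zero_of_pos hμ) φ)) x) +
        ∫ x, (v x j : ℂ) * multiplier (dispSymbol γ a 1 (μ₂ / μ)) (∂_{basisVec j}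
          (dilateSchwartz (√μ) (sqrt_ne_zero_of_pos hμ) φ) : 𝓢(Plane, ℂ)) x)) := by
  have h1 := integral_rescale hμ ((ε⁻¹ : ℝ) : ℂ) (fun x => (((1 - 1 * ζ x) * v x j : ℝ) : ℂ))
    fun x => (∂_{basisVec j} φ : 𝓢(Plane, ℂ)) x
  have h2 := integral_rescale hμ ((ε⁻¹ : ℝ) : ℂ) (fun x => (v x j : ℂ))
    fun x => multiplier (dispSymbol γ a μ μ₂) (∂_{basisVec j} φ : 𝓢(Plane, ℂ)) x
  have e1 : ∀ x, (((1 - ε * rescaleSpace ε μ ζ x) * rescaleSpace ε μ v x j : ℝ) : ℂ) =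
      ((ε⁻¹ : ℝ) : ℂ) * (((1 - 1 * ζ ((√μ)⁻¹ • x)) * v ((√μ)⁻¹ • x) j : ℝ) : ℂ) := fun x => by
    simp only [rescaleSpace, smul_eq_mul, PiLp.smul_apply, mul_inv_cancel_left₀ hε.ne']
    push_cast
    ring
  have e2 : ∀ x, ((rescaleSpace ε μ v x j : ℝ) : ℂ) =
      ((ε⁻¹ : ℝ) : ℂ) * (v ((√μ)⁻¹ • x) j : ℂ) := fun x => by
    simp only [rescaleSpace, smul_eq_mul, PiLp.smul_apply]
    push_cast
    ring
  have e3 : ∀ x, multiplier (dispSymbol γ a μ μ₂) (∂_{basisVec j} φ : 𝓢(Plane, ℂ)) (√μ • x) =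
      (((√μ)⁻¹ : ℝ) : ℂ) * multiplier (dispSymbol γ a 1 (μ₂ / μ)) (∂_{basisVec j}
          (dilateSchwartz (√μ) (sqrt_ne_zero_of_pos hμ) φ) : 𝓢(Plane, ℂ)) x := fun x => by
    rw [multiplier_dilate (Real.sqrt_pos.2 hμ), ← multiplier_const_mul]
    simp only [dispSymbol_rescale γ a hμ hμ₂, lineDeriv_smul_eq hμ]
  simp only [e1, e2]
  rw [h1, h2]
  simp only [e3, lineDeriv_smul_eq hμ, mul_left_comm _ (((√μ)⁻¹ : ℝ) : ℂ)]
  rw [integral_const_mul, integral_const_mul]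
  push_cast
  ring

lemma laplacian_smul_schwartz (k : ℂ) (φ : 𝓢(Plane, ℂ)) :
    (Δ (k • φ) : 𝓢(Plane, ℂ)) = k • (Δ φ : 𝓢(Plane, ℂ)) := by
  ext x
  rw [SchwartzMap.laplacian_eq_sum (EuclideanSpace.basisFun (Fin 2) ℝ),
    SchwartzMap.laplacian_eq_sum (EuclideanSpace.basisFun (Fin 2) ℝ)]
  simp only [LineDeriv.lineDerivOp_smul, Fin.sum_univ_two, smul_add]

lemma rhs_v_rescale (hε : 0 < ε) (hμ : 0 < μ) (ζ : Plane → ℝ) (v : Plane → Plane)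
    (φ : 𝓢(Plane, ℂ)) (j : Fin 2) :
    (1 - γ : ℝ) * (∫ x, ((rescaleSpace ε μ ζ x : ℝ) : ℂ) *
          ((∂_{basisVec j} φ) x + ((c * μ : ℝ) : ℂ) * (Δ (∂_{basisVec j} φ)) x)) -
        (ε / (2 * γ) : ℝ) * ∫ x, ((‖rescaleSpace ε μ v x‖ ^ 2 : ℝ) : ℂ) * (∂_{basisVec j} φ) x =
      ((ε⁻¹ * μ : ℝ) : ℂ) * (((√μ)⁻¹ : ℝ) * ((1 - γ : ℝ) * (∫ x, (ζ x : ℂ) *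
          ((∂_{basisVec j} (dilateSchwartz (√μ) (sqrt_ne_zero_of_pos hμ) φ)) x +
            ((c * 1 : ℝ) : ℂ) *
              (Δ (∂_{basisVec j} (dilateSchwartz (√μ) (sqrt_ne_zero_of_pos hμ) φ))) x)) -
        (1 / (2 * γ) : ℝ) * ∫ x, ((‖v x‖ ^ 2 : ℝ) : ℂ) *
          (∂_{basisVec j} (dilateSchwartz (√μ) (sqrt_ne_zero_of_pos hμ) φ)) x)) := by
  have hs : (√μ : ℂ) ≠ 0 := by exact_mod_cast sqrt_ne_zero_of_pos hμ
  have h1 := integral_rescale hμ ((ε⁻¹ : ℝ) : ℂ) (fun x => (ζ x : ℂ))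
    fun x => (∂_{basisVec j} φ : 𝓢(Plane, ℂ)) x +
      ((c * μ : ℝ) : ℂ) * (Δ (∂_{basisVec j} φ : 𝓢(Plane, ℂ)) : 𝓢(Plane, ℂ)) x
  have h2 := integral_rescale hμ (((ε⁻¹) ^ 2 : ℝ) : ℂ) (fun x => ((‖v x‖ ^ 2 : ℝ) : ℂ))
    fun x => (∂_{basisVec j} φ : 𝓢(Plane, ℂ)) x
  have e1 : ∀ x, ((rescaleSpace ε μ ζ x : ℝ) : ℂ) =
      ((ε⁻¹ : ℝ) : ℂ) * (ζ ((√μ)⁻¹ • x) : ℂ) := fun x => by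
    simp only [rescaleSpace, smul_eq_mul]
    push_cast
    ring
  have e2 : ∀ x, ((‖rescaleSpace ε μ v x‖ ^ 2 : ℝ) : ℂ) =
      (((ε⁻¹) ^ 2 : ℝ) : ℂ) * ((‖v ((√μ)⁻¹ • x)‖ ^ 2 : ℝ) : ℂ) := fun x => by
    rw [rescaleSpace, norm_smul, Real.norm_of_nonneg (inv_pos.2 hε).le, mul_pow,
      Complex.ofReal_mul]
  have e3 : ∀ x, (∂_{basisVec j} φ : 𝓢(Plane, ℂ)) (√μ • x) +
      ((c * μ : ℝ) : ℂ) * (Δ (∂_{basisVec j} φ : 𝓢(Plane, ℂ)) : 𝓢(Plane, ℂ)) (√μ • x) =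
      (((√μ)⁻¹ : ℝ) : ℂ) *
        ((∂_{basisVec j} (dilateSchwartz (√μ) (sqrt_ne_zero_of_pos hμ) φ) : 𝓢(Plane, ℂ)) x +
          ((c * 1 : ℝ) : ℂ) * (Δ (∂_{basisVec j} (dilateSchwartz (√μ)
            (sqrt_ne_zero_of_pos hμ) φ) : 𝓢(Plane, ℂ)) : 𝓢(Plane, ℂ)) x) := fun x => by
    have h3 : (Δ ((√μ : ℂ) • dilateSchwartz (√μ) (sqrt_ne_zero_of_pos hμ)
        (∂_{basisVec j} φ : 𝓢(Plane, ℂ))) : 𝓢(Plane, ℂ)) =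
        (√μ : ℂ) • (Δ (dilateSchwartz (√μ) (sqrt_ne_zero_of_pos hμ)
        (∂_{basisVec j} φ : 𝓢(Plane, ℂ))) : 𝓢(Plane, ℂ)) :=
      laplacian_smul_schwartz _ _
    rw [lineDeriv_dilateSchwartz, h3, laplacian_dilateSchwartz]
    simp only [smul_apply, dilateSchwartz_apply, Real.sq_sqrt hμ.le, smul_eq_mul]
    push_cast
    field_simp
  simp only [e1, e2]
  rw [h1, h2]
  simp only [e3]
  simp only [lineDeriv_smul_eq hμ, mul_left_comm _ (((√μ)⁻¹ : ℝ) : ℂ)]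
  rw [integral_const_mul, integral_const_mul]
  have : (ε : ℂ) ≠ 0 := by exact_mod_cast hε.ne'
  push_cast
  field_simp

/-- Each tested equation for the rescaled functions is the one for the original functions, at the
rescaled time and with dilated test function, up to a nonzero factor. -/
theorem isGlobalSolution_rescale_iff (hε : 0 < ε) (hμ : 0 < μ) (hμ₂ : 0 < μ₂) {d : ℝ}
    {ζ₀ : Plane → ℝ} {v₀ : Plane → Plane} {ζ : ℝ → Plane → ℝ} {v : ℝ → Plane → Plane} :
    IsGlobalSolution γ a b c d ε μ μ₂ (rescaleSpace ε μ ζ₀) (rescaleSpace ε μ v₀)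
        (rescale ε μ ζ) (rescale ε μ v) ↔
      IsGlobalSolution γ a b c d 1 1 (μ₂ / μ) ζ₀ v₀ ζ v := by
  have hs := Real.sqrt_pos.2 hμ
  have hk : ((ε⁻¹ * μ : ℝ) : ℂ) ≠ 0 := by
    exact_mod_cast (by positivity : ε⁻¹ * μ ≠ 0)
  have hζ : ∀ t, rescale ε μ ζ t = rescaleSpace ε μ (ζ ((√μ)⁻¹ * t)) := fun _ => rfl
  have hv : ∀ t, rescale ε μ v t = rescaleSpace ε μ (v ((√μ)⁻¹ * t)) := fun _ => rfl
  have hvj : ∀ (j : Fin 2) (t : ℝ) (x : Plane), rescale ε μ v t x j =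
      rescaleSpace ε μ (fun x => v ((√μ)⁻¹ * t) x j) x := fun _ _ _ => rfl
  have h0 : (√μ)⁻¹ * 0 = 0 := mul_zero _
  have A := continuousInX_rescale_iff hε hμ ζ v
  have B : rescale ε μ ζ 0 =ᵐ[volume] rescaleSpace ε μ ζ₀ ↔ ζ 0 =ᵐ[volume] ζ₀ := by
    rw [hζ, rescaleSpace_ae_iff hε hμ, h0]
  have C : rescale ε μ v 0 =ᵐ[volume] rescaleSpace ε μ v₀ ↔ v 0 =ᵐ[volume] v₀ := by
    rw [hv, rescaleSpace_ae_iff hε hμ, h0]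
  have D : ∀ φ t, HasDerivWithinAt
      (fun s => ∫ x, ((rescale ε μ ζ s x : ℝ) : ℂ) * (φ x - ((b * μ : ℝ) : ℂ) * (Δ φ) x))
      (∑ j : Fin 2,
        ((1 / γ : ℝ) * (∫ x, (((1 - ε * rescale ε μ ζ t x) * rescale ε μ v t x j : ℝ) : ℂ) *
            (∂_{basisVec j} φ) x) +
          ∫ x, (rescale ε μ v t x j : ℂ) *
            multiplier (dispSymbol γ a μ μ₂) (∂_{basisVec j} φ : 𝓢(Plane, ℂ)) x)) (Ici 0) t ↔
      HasDerivWithinAt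
      (fun s => ∫ x, (ζ s x : ℂ) * (dilateSchwartz (√μ) hs.ne' φ x - ((b * 1 : ℝ) : ℂ) *
        (Δ (dilateSchwartz (√μ) hs.ne' φ)) x))
      (∑ j : Fin 2,
        ((1 / γ : ℝ) * (∫ x, (((1 - 1 * ζ ((√μ)⁻¹ * t) x) * v ((√μ)⁻¹ * t) x j : ℝ) : ℂ) *
            (∂_{basisVec j} (dilateSchwartz (√μ) hs.ne' φ)) x) +
          ∫ x, (v ((√μ)⁻¹ * t) x j : ℂ) *
            multiplier (dispSymbol γ a 1 (μ₂ / μ))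
              (∂_{basisVec j} (dilateSchwartz (√μ) hs.ne' φ) : 𝓢(Plane, ℂ)) x))
      (Ici 0) ((√μ)⁻¹ * t) := by
    intro φ t
    rw [← hasDerivWithinAt_rescale_iff (inv_pos.2 hs) hk]
    simp only [hζ, hv, lhs_rescale hμ b, rhs_zeta_rescale hε hμ hμ₂, Finset.mul_sum]
  have E : ∀ (j : Fin 2) (φ : 𝓢(Plane, ℂ)) t, HasDerivWithinAt
      (fun s => ∫ x, (rescale ε μ v s x j : ℂ) * (φ x - ((d * μ : ℝ) : ℂ) * (Δ φ) x))
      ((1 - γ : ℝ) * (∫ x, ((rescale ε μ ζ t x : ℝ) : ℂ) *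
          ((∂_{basisVec j} φ) x + ((c * μ : ℝ) : ℂ) * (Δ (∂_{basisVec j} φ)) x)) -
        (ε / (2 * γ) : ℝ) * ∫ x, ((‖rescale ε μ v t x‖ ^ 2 : ℝ) : ℂ) * (∂_{basisVec j} φ) x)
      (Ici 0) t ↔
      HasDerivWithinAt
      (fun s => ∫ x, (v s x j : ℂ) * (dilateSchwartz (√μ) hs.ne' φ x - ((d * 1 : ℝ) : ℂ) *
        (Δ (dilateSchwartz (√μ) hs.ne' φ)) x))
      ((1 - γ : ℝ) * (∫ x, (ζ ((√μ)⁻¹ * t) x : ℂ) *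
          ((∂_{basisVec j} (dilateSchwartz (√μ) hs.ne' φ)) x + ((c * 1 : ℝ) : ℂ) *
            (Δ (∂_{basisVec j} (dilateSchwartz (√μ) hs.ne' φ))) x)) -
        (1 / (2 * γ) : ℝ) * ∫ x, ((‖v ((√μ)⁻¹ * t) x‖ ^ 2 : ℝ) : ℂ) *
          (∂_{basisVec j} (dilateSchwartz (√μ) hs.ne' φ)) x)
      (Ici 0) ((√μ)⁻¹ * t) := by
    intro j φ t
    rw [← hasDerivWithinAt_rescale_iff (inv_pos.2 hs) hk]
    simp only [hvj, lhs_rescale hμ d]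
    simp only [hζ, hv, rhs_v_rescale hε hμ]
  constructor
  · rintro ⟨h1, h2, h3, h4, h5⟩
    -- For this direction every test function has to be a dilate of another, and every time t ≥ 0 of
    -- the form s/√μ.
    refine ⟨A.1 h1, B.1 h2, C.1 h3, fun φ => ?_, fun j φ => ?_⟩ <;>
      obtain ⟨ψ, rfl⟩ := dilateSchwartz_surjective hs.ne' φ <;>
      rw [← forall_nonneg_mul_iff (inv_pos.2 hs)]
    · exact fun t ht => (D ψ t).1 (h4 ψ t ht)
    · exact fun t ht => (E j ψ t).1 (h5 j ψ t ht)
  · rintro ⟨h1, h2, h3, h4, h5⟩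
    exact ⟨A.2 h1, B.2 h2, C.2 h3, fun φ t ht => (D φ t).2 (h4 _ _ (by positivity)),
      fun j φ t ht => (E j φ t).2 (h5 _ _ _ (by positivity))⟩

end Rescaling

/-! ### Transfer of well-posedness from ε = μ = 1. -/

section Transfer

variable {γ a b c d C ε μ μ₂ : ℝ}

lemma rescaleSpace_surjective {F : Type*} [AddCommGroup F] [Module ℝ F] (hε : 0 < ε) (hμ : 0 < μ) :
    Function.Surjective (rescaleSpace (F := F) ε μ) := fun u =>
  ⟨fun x => ε • u (√μ • x), by
    funext x
    simp only [rescaleSpace]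
    rw [smul_inv_smul₀ (sqrt_ne_zero_of_pos hμ), inv_smul_smul₀ hε.ne']⟩

lemma rescale_surjective {F : Type*} [AddCommGroup F] [Module ℝ F] (hε : 0 < ε) (hμ : 0 < μ) :
    Function.Surjective (rescale (F := F) ε μ) := fun u =>
  ⟨fun t x => ε • u (√μ * t) (√μ • x), by
    funext t x
    simp only [rescale]
    rw [smul_inv_smul₀ (sqrt_ne_zero_of_pos hμ), inv_smul_smul₀ hε.ne',
      mul_inv_cancel_left₀ (sqrt_ne_zero_of_pos hμ)]⟩

lemma HasUniqueBoundedGlobalSolution.rescale (hε : 0 < ε) (hμ : 0 < μ) (hμ₂ : 0 < μ₂)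
    {ζ₀ : Plane → ℝ} {v₀ : Plane → Plane}
    (h : HasUniqueBoundedGlobalSolution C γ a b c d 1 1 (μ₂ / μ) ζ₀ v₀) :
    HasUniqueBoundedGlobalSolution C γ a b c d ε μ μ₂ (rescaleSpace ε μ ζ₀)
      (rescaleSpace ε μ v₀) := by
  obtain ⟨ζ, v, hs, hb, hu⟩ := h
  have hr := inv_pos.2 (Real.sqrt_pos.2 hμ)
  refine ⟨_root_.rescale ε μ ζ, _root_.rescale ε μ v,
    (isGlobalSolution_rescale_iff hε hμ hμ₂).2 hs, fun t ht => ?_, fun ζ' v' hs' t ht => ?_⟩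
  · have h1 := hb ((√μ)⁻¹ * t) (by positivity)
    have e1 : xNorm μ (_root_.rescale ε μ ζ t) =
      ENNReal.ofReal (√μ / ε) * xNorm 1 (ζ ((√μ)⁻¹ * t)) := xNorm_rescaleSpace hε hμ _
    have e2 : xNormVec μ (_root_.rescale ε μ v t) =
      ENNReal.ofReal (√μ / ε) * xNormVec 1 (v ((√μ)⁻¹ * t)) := xNormVec_rescaleSpace hε hμ _
    rw [e1, e2, xNorm_rescaleSpace hε hμ, xNormVec_rescaleSpace hε hμ, ← mul_add, ← mul_add,
      mul_left_comm]
    gcongr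
  · obtain ⟨ζ'', rfl⟩ := rescale_surjective hε hμ ζ'
    obtain ⟨v'', rfl⟩ := rescale_surjective hε hμ v'
    have h1 := hu ζ'' v'' ((isGlobalSolution_rescale_iff hε hμ hμ₂).1 hs') ((√μ)⁻¹ * t)
      (by positivity)
    exact ⟨(rescaleSpace_ae_iff hε hμ).2 h1.1, (rescaleSpace_ae_iff hε hμ).2 h1.2⟩

/-- The norm scales by √μ/ε, so `hM` says exactly that data of size M become data of size at most η.
The constant C is unchanged because both sides of the bound scale alike. -/
lemma HasUniqueBoundedGlobalSolution.of_small {m η M : ℝ}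
    (h : ∀ μ₂ : ℝ, m ≤ μ₂ → ∀ (ζ₀ : Plane → ℝ) (v₀ : Plane → Plane),
      xNorm 1 ζ₀ + xNormVec 1 v₀ ≤ ENNReal.ofReal η →
        HasUniqueBoundedGlobalSolution C γ a b c d 1 1 μ₂ ζ₀ v₀)
    (hε : 0 < ε) (hμ : 0 < μ) (hμ₂ : 0 < μ₂) (hm : m ≤ μ₂ / μ) (hM : M * ε ≤ η * √μ)
    {ζ₀ : Plane → ℝ} {v₀ : Plane → Plane}
    (h₀ : xNorm μ ζ₀ + xNormVec μ v₀ ≤ ENNReal.ofReal M) :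
    HasUniqueBoundedGlobalSolution C γ a b c d ε μ μ₂ ζ₀ v₀ := by
  have hs := Real.sqrt_pos.2 hμ
  obtain ⟨ζ₀, rfl⟩ := rescaleSpace_surjective hε hμ ζ₀
  obtain ⟨v₀, rfl⟩ := rescaleSpace_surjective hε hμ v₀
  refine (h _ hm ζ₀ v₀ ?_).rescale hε hμ hμ₂
  rw [xNorm_rescaleSpace hε hμ, xNormVec_rescaleSpace hε hμ, ← mul_add] at h₀
  have h1 : ENNReal.ofReal M ≤ ENNReal.ofReal (√μ / ε) * ENNReal.ofReal η := by
    rw [← ENNReal.ofReal_mul (by positivity)]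
    refine ENNReal.ofReal_le_ofReal ?_
    rw [div_mul_eq_mul_div, le_div_iff₀ hε, mul_comm √μ]
    exact hM
  refine (ENNReal.mul_le_mul_iff_right ?_ ENNReal.ofReal_ne_top).1 (h₀.trans h1)
  rw [ne_eq, ENNReal.ofReal_eq_zero, not_le]
  positivity

end Transfer

theorem mainTheorem3 (γ a b c d : ℝ) (hγ : γ ∈ Set.Ioo (0 : ℝ) 1)
    (hbd : b = d) (hd : 0 < d) (ha : a ≤ 0) (hc : c < 0) :
    -- The change of variables: it multiplies norms by `√μ / ε`, and it carries the global solutions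
    -- for `ε = μ = 1` and `μ₂ / μ` exactly to those for `(ε, μ, μ₂)`.
    (∀ ε μ μ₂ : ℝ, 0 < ε → 0 < μ → 0 < μ₂ →
      (∀ u : Plane → ℝ,
        xNorm μ (rescaleSpace ε μ u) = ENNReal.ofReal (√μ / ε) * xNorm 1 u) ∧
      (∀ w : Plane → Plane,
        xNormVec μ (rescaleSpace ε μ w) = ENNReal.ofReal (√μ / ε) * xNormVec 1 w) ∧
      ∀ (ζ₀ : Plane → ℝ) (v₀ : Plane → Plane) (ζ : ℝ → Plane → ℝ) (v : ℝ → Plane → Plane),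
        IsGlobalSolution γ a b c d ε μ μ₂ (rescaleSpace ε μ ζ₀) (rescaleSpace ε μ v₀)
            (rescale ε μ ζ) (rescale ε μ v) ↔
          IsGlobalSolution γ a b c d 1 1 (μ₂ / μ) ζ₀ v₀ ζ v) ∧
    -- The global existence theorem for `ε ≤ ε₀` and `μ ∼ ε`, `μ₂ ∼ 1`.
    (∀ κ : ℝ, 1 ≤ κ → ∃ C : ℝ, 0 < C ∧ ∀ M : ℝ, 0 < M → ∃ ε₀ : ℝ, 0 < ε₀ ∧
      ∀ ε μ μ₂ : ℝ, 0 < ε → ε ≤ ε₀ → μ ∈ Set.Icc (κ⁻¹ * ε) (κ * ε) → μ₂ ∈ Set.Icc κ⁻¹ κ →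
        ∀ (ζ₀ : Plane → ℝ) (v₀ : Plane → Plane),
          xNorm μ ζ₀ + xNormVec μ v₀ ≤ ENNReal.ofReal M →
            HasUniqueBoundedGlobalSolution C γ a b c d ε μ μ₂ ζ₀ v₀) ∧
    -- Global existence of small solutions for `ε = μ = 1`, uniformly for `μ₂` bounded below.
    (∀ m : ℝ, 0 < m → ∃ C η : ℝ, 0 < C ∧ 0 < η ∧ ∀ μ₂ : ℝ, m ≤ μ₂ →
      ∀ (ζ₀ : Plane → ℝ) (v₀ : Plane → Plane),
        xNorm 1 ζ₀ + xNormVec 1 v₀ ≤ ENNReal.ofReal η →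
          HasUniqueBoundedGlobalSolution C γ a b c d 1 1 μ₂ ζ₀ v₀) ∧
    -- Global existence of small solutions for `ε ∼ μ ∼ 1`.
    (∀ κ : ℝ, 1 ≤ κ → ∃ C η : ℝ, 0 < C ∧ 0 < η ∧
      ∀ ε μ μ₂ : ℝ, ε ∈ Set.Icc κ⁻¹ κ → μ ∈ Set.Icc κ⁻¹ κ → μ₂ ∈ Set.Icc κ⁻¹ κ →
        ∀ (ζ₀ : Plane → ℝ) (v₀ : Plane → Plane),
          xNorm μ ζ₀ + xNormVec μ v₀ ≤ ENNReal.ofReal η →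
            HasUniqueBoundedGlobalSolution C γ a b c d ε μ μ₂ ζ₀ v₀) := by
  subst hbd
  refine ⟨fun ε μ μ₂ hε hμ hμ₂ => ⟨xNorm_rescaleSpace hε hμ, xNormVec_rescaleSpace hε hμ,
    fun ζ₀ v₀ ζ v => isGlobalSolution_rescale_iff hε hμ hμ₂⟩, fun κ hκ => ?_,
    fun m hm => small_solutions hγ hd ha hc hm, fun κ hκ => ?_⟩
  · have hκ0 : 0 < κ := one_pos.trans_le hκ
    obtain ⟨C, η, hC, hη, h⟩ := small_solutions hγ hd ha hc (m := κ⁻¹ / κ) (by positivity)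
    -- The second entry gives M²ε² ≤ η²ε/κ ≤ η²μ. The entry 1 gives μ ≤ κ, hence μ₂/μ ≥ κ⁻¹/κ.
    refine ⟨C, hC, fun M hM => ⟨min 1 (η ^ 2 / (M ^ 2 * κ)), by positivity, ?_⟩⟩
    intro ε μ μ₂ hε hε₀ hμ hμ₂ ζ₀ v₀ h₀
    have hμ0 : 0 < μ := lt_of_lt_of_le (by positivity) hμ.1
    have hμ₂0 : 0 < μ₂ := lt_of_lt_of_le (by positivity) hμ₂.1
    refine HasUniqueBoundedGlobalSolution.of_small h hε hμ0 hμ₂0 ?_ ?_ h₀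
    · have h1 : μ ≤ κ := hμ.2.trans (mul_le_of_le_one_right hκ0.le (hε₀.trans (min_le_left _ _)))
      exact div_le_div₀ hμ₂0.le hμ₂.1 hμ0 h1
    · have h1 := hε₀.trans (min_le_right _ _)
      rw [le_div_iff₀ (by positivity)] at h1
      refine (pow_le_pow_iff_left₀ (by positivity) (by positivity) two_ne_zero).1 ?_
      rw [mul_pow, mul_pow, Real.sq_sqrt hμ0.le]
      calc M ^ 2 * ε ^ 2 = (ε * (M ^ 2 * κ)) * (κ⁻¹ * ε) := by field_simp
        _ ≤ η ^ 2 * μ := by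
            gcongr
            exact hμ.1
  · have hκ0 : 0 < κ := one_pos.trans_le hκ
    obtain ⟨C, η, hC, hη, h⟩ := small_solutions hγ hd ha hc (m := κ⁻¹ / κ) (by positivity)
    -- One factor κ absorbs ε ≤ κ, and the other absorbs √μ ≥ κ⁻¹, which holds because μ ≥ κ⁻¹ ≥
    -- κ⁻².
    refine ⟨C, η / κ ^ 2, hC, by positivity, ?_⟩
    intro ε μ μ₂ hε hμ hμ₂ ζ₀ v₀ h₀
    have hε0 : 0 < ε := lt_of_lt_of_le (by positivity) hε.1
    have hμ0 : 0 < μ := lt_of_lt_of_le (by positivity) hμ.1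
    have hμ₂0 : 0 < μ₂ := lt_of_lt_of_le (by positivity) hμ₂.1
    refine HasUniqueBoundedGlobalSolution.of_small h hε0 hμ0 hμ₂0 ?_ ?_ h₀
    · exact div_le_div₀ hμ₂0.le hμ₂.1 hμ0 hμ.2
    · have h1 : κ⁻¹ ≤ √μ := by
        refine Real.le_sqrt_of_sq_le (le_trans ?_ hμ.1)
        rw [sq]
        exact mul_le_of_le_one_left (by positivity) (inv_le_one_of_one_le₀ hκ)
      calc η / κ ^ 2 * ε ≤ η / κ ^ 2 * κ := by
            gcongr
            exact hε.2
        _ = η * κ⁻¹ := by field_simp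
        _ ≤ η * √μ := by gcongr
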